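/- Let $n\ge 1$ and let $M$ be a Liouville domain of dimension $2n$: a compact smooth manifold with boundary together with a smooth one-form $\theta$ such that $\omega=d\theta$ is symplectic and the Liouville vector field $Z$, determined by $i_Z\omega=\theta$, points strictly outwards along $\partial M$. Let $L_0\subset M$ be a compact Lagrangian submanifold (of dimension $n$, possibly with boundary) with $\partial L_0=L_0\cap\partial M$, meeting $\partial M$ transversally. Suppose that $\theta|_{L_0}$ is exact, that is, $\theta|_{L_0}=df$ for some $f\in C^\infty(L_0,\mathbb R)$, and that the restriction $\theta|_{\partial L_0}\in\Omega^1(\partial L_0)$ is zero (equivalently, $\partial L_0$ is Legendrian). Then there is a Hamiltonian isotopy rel $\partial M$, that is, a smooth family $(\varphi_t)_{t\in\mathbb R}$ of diffeomorphisms of $M$ with $\varphi_0=\mathrm{id}$ and $\varphi_t|_{\partial M}=\mathrm{id}_{\partial M}$ for all $t$, satisfying $\frac{d}{dt}\varphi_t=X_t\circ\varphi_t$ with $i_{X_t}\omega=-dH_t$ for some smooth family of functions $H_t\in C^\infty(M,\mathbb R)$, such that $L_1=\varphi_1(L_0)$ is again a Lagrangian submanifold with $\partial L_1=L_1\cap\partial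 M$, transverse to $\partial M$, such that $\theta|_{L_1}$ is exact and $\theta|_{L_1}$ vanishes on a neighbourhood of $\partial L_1$ in $L_1$. -/

import Mathlib

open scoped Manifold ContDiff

noncomputable section

section Forms

variable {m : ℕ} [NeZero m] {M : Type*} [TopologicalSpace M]
  [ChartedSpace (EuclideanHalfSpace m) M] [IsManifold (𝓡∂ m) ∞ M]

/-- Smooth one-forms on an `m`-dimensional smooth manifold `M` with boundary: smooth sections of
the cotangent bundle. -/
abbrev OneForm (m : ℕ) [NeZero m] (M : Type*) [TopologicalSpace M]
    [ChartedSpace (EuclideanHalfSpace m) M] [IsManifold (𝓡∂ m) ∞ M] :=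
  ContMDiffSection (𝓡∂ m) (EuclideanSpace ℝ (Fin m) →L[ℝ] ℝ) ∞
    (fun x : M => TangentSpace (𝓡∂ m) x →L[ℝ] ℝ)

/-- The coordinate expression of the one-form `θ` in the preferred chart `φ` at `x`, that is, the
pullback of `θ` by `φ⁻¹`. -/
def OneForm.inChart (θ : OneForm m M) (x : M) (y : EuclideanSpace ℝ (Fin m)) :
    EuclideanSpace ℝ (Fin m) →L[ℝ] ℝ :=
  (θ ((extChartAt (𝓡∂ m) x).symm y)).comp
    (mfderivWithin 𝓘(ℝ, EuclideanSpace ℝ (Fin m)) (𝓡∂ m)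
      (extChartAt (𝓡∂ m) x).symm (Set.range (𝓡∂ m)) y)

/-- The exterior derivative `dθ` at the point `x`, evaluated on `v` and `w`. It is computed in the
preferred chart at `x`; the tangent space at `x` is by definition the coordinate space of that
chart. -/
def OneForm.d (θ : OneForm m M) (x : M) (v w : TangentSpace (𝓡∂ m) x) : ℝ :=
  extDerivWithin
    (fun y => ContinuousAlternatingMap.ofSubsingleton ℝ (EuclideanSpace ℝ (Fin m)) ℝ (0 : Fin 1)
      (θ.inChart x y))
    (Set.range (𝓡∂ m)) (extChartAt (𝓡∂ m) x x)
    (![v, w] : Fin 2 → EuclideanSpace ℝ (Fin m))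

/-- At a boundary point `x`: the tangent vector `v` is tangent to the boundary. The model half space
is `{y | 0 ≤ y 0}`, and `v` is its own coordinate vector in the preferred chart at `x`. -/
def IsTangentToBoundary (x : M) (v : TangentSpace (𝓡∂ m) x) : Prop :=
  let y : EuclideanSpace ℝ (Fin m) := v
  y 0 = 0

/-- At a boundary point `x`: the tangent vector `v` points strictly outwards. -/
def PointsOutward (x : M) (v : TangentSpace (𝓡∂ m) x) : Prop :=
  let y : EuclideanSpace ℝ (Fin m) := v
  y 0 < 0

/-- `θ` makes `M` (assumed to be compact) a Liouville domain: `dθ` is symplectic, and the Liouville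
vector field `Z`, determined by `dθ(Z, ·) = θ`, points strictly outwards along the boundary. -/
structure IsLiouvilleForm (θ : OneForm m M) : Prop where
  nondegenerate : ∀ (x : M) (v : TangentSpace (𝓡∂ m) x), (∀ w, θ.d x v w = 0) → v = 0
  outward : ∃ Z : (x : M) → TangentSpace (𝓡∂ m) x, (∀ x w, θ.d x (Z x) w = θ x w) ∧
    ∀ x ∈ (𝓡∂ m).boundary M, PointsOutward x (Z x)

/-- `φ` is a Hamiltonian isotopy relative to the boundary: a smooth family of diffeomorphisms of
`M`, starting at the identity and fixing every boundary point, which is generated by the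
Hamiltonian vector fields `X_t` of a smooth family of functions `H t`, where `dθ(X_t, ·) = -dH_t`. -/
structure IsHamiltonianIsotopyRelBoundary (θ : OneForm m M)
    (φ : ℝ → M ≃ₘ^∞⟮𝓡∂ m, 𝓡∂ m⟯ M) : Prop where
  contMDiff : ContMDiff (𝓘(ℝ, ℝ).prod (𝓡∂ m)) (𝓡∂ m) ∞ (fun p : ℝ × M => φ p.1 p.2)
  map_zero : ∀ x, φ 0 x = x
  fixes_boundary : ∀ t, ∀ x ∈ (𝓡∂ m).boundary M, φ t x = x
  hamiltonian : ∃ H : ℝ → M → ℝ,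
    ContMDiff (𝓘(ℝ, ℝ).prod (𝓡∂ m)) 𝓘(ℝ, ℝ) ∞ (fun p : ℝ × M => H p.1 p.2) ∧
    ∀ (t : ℝ) (x : M) (w : TangentSpace (𝓡∂ m) (φ t x)),
      θ.d (φ t x) (mfderiv 𝓘(ℝ, ℝ) (𝓡∂ m) (fun s => φ s x) t (1 : ℝ)) w =
        -(mfderiv (𝓡∂ m) 𝓘(ℝ, ℝ) (H t) (φ t x) w : ℝ)

end Forms

section Lagrangians

variable {n : ℕ} [NeZero n] {M : Type*} [TopologicalSpace M]
  [ChartedSpace (EuclideanHalfSpace (2 * n)) M] [IsManifold (𝓡∂ (2 * n)) ∞ M]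
  {L : Type*} [TopologicalSpace L] [ChartedSpace (EuclideanHalfSpace n) L]

/-- The value of the pullback `i^*θ` on the tangent vector `v` at `p`. For the inclusion `i` of a
submanifold `L` this is the restriction `θ|L`. -/
def OneForm.pullback (θ : OneForm (2 * n) M) (i : L → M) (p : L) (v : TangentSpace (𝓡∂ n) p) : ℝ :=
  θ (i p) (mfderiv (𝓡∂ n) (𝓡∂ (2 * n)) i p v)

/-- The smooth embedding `i` identifies the `n`-dimensional manifold `L` with a Lagrangian
submanifold of the `2n`-dimensional manifold `M` with symplectic form `dθ`. The submanifold meets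
the boundary of `M` exactly in its own boundary, and transversally. -/
structure IsLagrangianSubmanifold (θ : OneForm (2 * n) M) (i : L → M) : Prop where
  isSmoothEmbedding : Manifold.IsSmoothEmbedding (𝓡∂ n) (𝓡∂ (2 * n)) ∞ i
  isotropic : ∀ (p : L) (v w : TangentSpace (𝓡∂ n) p),
    θ.d (i p) (mfderiv (𝓡∂ n) (𝓡∂ (2 * n)) i p v) (mfderiv (𝓡∂ n) (𝓡∂ (2 * n)) i p w) = 0
  boundary_eq : (𝓡∂ n).boundary L = i ⁻¹' (𝓡∂ (2 * n)).boundary M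
  transverse : ∀ p ∈ (𝓡∂ n).boundary L, ∀ w : TangentSpace (𝓡∂ (2 * n)) (i p),
    ∃ v : TangentSpace (𝓡∂ n) p,
      IsTangentToBoundary (i p) (w - mfderiv (𝓡∂ n) (𝓡∂ (2 * n)) i p v)

/-- `θ|L` is exact: it is the differential of a smooth function on `L`. -/
def IsExactOn (θ : OneForm (2 * n) M) (i : L → M) : Prop :=
  ∃ f : L → ℝ, ContMDiff (𝓡∂ n) 𝓘(ℝ, ℝ) ∞ f ∧
    ∀ (p : L) (v : TangentSpace (𝓡∂ n) p),
      θ.pullback i p v = mfderiv (𝓡∂ n) 𝓘(ℝ, ℝ) f p v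

/-- The restriction of `θ` to the boundary of `L`, as a one-form on the boundary, is zero. -/
def VanishesOnBoundary (θ : OneForm (2 * n) M) (i : L → M) : Prop :=
  ∀ p ∈ (𝓡∂ n).boundary L, ∀ v : TangentSpace (𝓡∂ n) p,
    IsTangentToBoundary p v → θ.pullback i p v = 0

/-- `θ|L` is zero on a neighbourhood in `L` of the boundary of `L`. -/
def VanishesNearBoundary (θ : OneForm (2 * n) M) (i : L → M) : Prop :=
  ∃ U : Set L, IsOpen U ∧ (𝓡∂ n).boundary L ⊆ U ∧
    ∀ p ∈ U, ∀ v : TangentSpace (𝓡∂ n) p, θ.pullback i p v = 0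

end Lagrangians

end

/-!
The isotopy is found by controlling the primitive of the change of `θ`.

*Reduction.* Let `F` be a primitive of `θ` on `L`. Since the boundary of `L` is Legendrian, `F` is
locally constant there, so that it takes finitely many values on the boundary. Let `h : ℝ → ℝ` be
smooth and constant near each of these values, with fixed points at them
(`Set.Finite.exists_contDiff_eventually_const`). Then `h ∘ F - F` vanishes on the boundary of `L`, and
near the boundary it is a primitive of `-θ`. By means of local retractions of `M` onto `L` it extends
to a function `A` on `M` vanishing on `∂M` (`Manifold.IsSmoothEmbedding.exists_extension`). It is
enough to find a Hamiltonian isotopy `φ` fixing `∂M` with `φ₁^*θ = θ + dS` and `S = A` near `∂M`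
(`exists_isotopy_of_eq_zero_boundary`): then `F + S ∘ i₀` is a primitive of `θ` on `φ₁(L)`, and near
the boundary it is equal to `h ∘ F`, hence locally constant.

*Localization.* By a partition of unity `A` is a finite sum of functions with supports in charts, and
the isotopies for the summands can be concatenated: when `φ₁^*θ = θ + dS` has been achieved, the next
step is carried out for `θ + dS`, which has the same exterior derivative, and whose Liouville field
still points outwards since `S` vanishes on `∂M` (`exists_isotopy_of_sum_chartExtend`).

*The local problem.* It remains to treat a compactly supported function `G`, vanishing on the boundary,
on an open subset of a half-space (`exists_local_isotopy`). If `X` is the Hamiltonian field of `K`,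
then the Lie derivative of `θ` is the differential of `θ(X) - K`, so that `S` is the integral of
`θ(X) - K` along the flow. For `0 ≤ τ ≤ 1` let `Z` be the Liouville field of `θ + (1 - τ) dG`; then
`θ(X) + (1 - τ) dG(X) = dθ(Z, X) = dK(Z)`, and hence the function `S + (1 - τ) G ∘ φ` is constant along
the trajectories on which `dK(Z) = K + G`. As its values at `τ = 0` and `τ = 1` are `G` and `S`, it
suffices to solve this equation near the boundary. Since `Z` is transverse to the boundary, the boundary
is noncharacteristic, and the solution with `K = 0` and `dK = 0` on the boundary is found by integrating
along the characteristics (`exists_solution_of_outward`, `exists_hamiltonian`). The Hamiltonian field of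
`K` is zero on the boundary, so that the flow fixes the boundary and does not leave the half-space.
-/

open Set Filter Metric Topology
open scoped Manifold ContDiff NNReal

set_option linter.unusedSectionVars false

/-! ### Ordinary differential equations on the unit time interval -/

section ODE

variable {W : Type*} [NormedAddCommGroup W] [NormedSpace ℝ W]

theorem HasDerivWithinAt.Ici_of_Icc {f : ℝ → W} {f' : W} {a b t : ℝ}
    (h : HasDerivWithinAt f f' (Icc a b) t) (ht : t ∈ Ico a b) :
    HasDerivWithinAt f f' (Ici t) t :=
  h.mono_of_mem_nhdsWithin (Icc_mem_nhdsGE_of_mem ht)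

theorem gronwallBound_le_add_mul_exp {δ K ε t : ℝ} (hδ : 0 ≤ δ) (hK : 1 ≤ K) (hε : 0 ≤ ε)
    (ht : t ∈ Icc (0 : ℝ) 1) : gronwallBound δ K ε (t - 0) ≤ (δ + ε) * Real.exp K := by
  have hK0 : 0 < K := by linarith
  rw [gronwallBound_of_K_ne_0 hK0.ne', sub_zero]
  have h1 : Real.exp (K * t) ≤ Real.exp K := Real.exp_le_exp.2 (by nlinarith [ht.2])
  have h2 : ε / K ≤ ε := div_le_self hε hK
  have h3 : 0 ≤ Real.exp (K * t) - 1 := by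
    have := Real.add_one_le_exp (K * t)
    nlinarith [ht.1, mul_nonneg hK0.le ht.1]
  nlinarith [mul_le_mul h2 (show Real.exp (K * t) - 1 ≤ Real.exp K by linarith) h3 hε,
    mul_le_mul_of_nonneg_left h1 hδ]

theorem norm_le_add_mul_exp_of_deriv {f f' : ℝ → W} {δ K ε : ℝ} (hδ : 0 ≤ δ) (hK : 1 ≤ K)
    (hε : 0 ≤ ε) (hf : ∀ t ∈ Icc (0 : ℝ) 1, HasDerivWithinAt f (f' t) (Icc 0 1) t)
    (h0 : ‖f 0‖ ≤ δ) (hb : ∀ t ∈ Icc (0 : ℝ) 1, ‖f' t‖ ≤ K * ‖f t‖ + ε) :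
    ∀ t ∈ Icc (0 : ℝ) 1, ‖f t‖ ≤ (δ + ε) * Real.exp K := fun t ht ↦
  (norm_le_gronwallBound_of_norm_deriv_right_le (fun t ht ↦ (hf t ht).continuousWithinAt)
    (fun t ht ↦ (hf t (Ico_subset_Icc_self ht)).Ici_of_Icc ht) h0
    (fun t ht ↦ hb t (Ico_subset_Icc_self ht)) t ht).trans
    (gronwallBound_le_add_mul_exp hδ hK hε ht)

/-- For a bounded vector field the Picard-Lindelöf radius can be taken so large that the solution
exists on the whole time interval. -/
theorem exists_hasDerivWithinAt_of_lipschitzWith_of_bounded [CompleteSpace W] {f : ℝ → W → W}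
    {K L : ℝ≥0} (hlip : ∀ t ∈ Icc (0 : ℝ) 1, LipschitzWith K (f t))
    (hc : ∀ x, ContinuousOn (f · x) (Icc 0 1)) (hb : ∀ t ∈ Icc (0 : ℝ) 1, ∀ x, ‖f t x‖ ≤ L)
    (x₀ : W) : ∃ α : ℝ → W, α 0 = x₀ ∧
      ∀ t ∈ Icc (0 : ℝ) 1, HasDerivWithinAt α (f t (α t)) (Icc 0 1) t := by
  have hP : IsPicardLindelof f (⟨0, by simp⟩ : Icc (0 : ℝ) 1) x₀ L 0 L K :=
    { lipschitzOnWith := fun t ht ↦ (hlip t ht).lipschitzOnWith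
      continuousOn := fun x _ ↦ hc x
      norm_le := fun t ht x _ ↦ hb t ht x
      mul_max_le := by simp }
  exact hP.exists_eq_forall_mem_Icc_hasDerivWithinAt₀

/-- Linear equations have solutions on the whole time interval: an a priori bound allows to cut the
linear field off outside a large ball. -/
theorem exists_hasDerivWithinAt_linear [FiniteDimensional ℝ W] {B : ℝ → W →L[ℝ] W}
    (hB : ContinuousOn B (Icc 0 1)) (a : W) : ∃ α : ℝ → W, α 0 = a ∧
      ∀ t ∈ Icc (0 : ℝ) 1, HasDerivWithinAt α (B t (α t)) (Icc 0 1) t := by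
  obtain ⟨M', hM'⟩ := isCompact_Icc.exists_bound_of_continuousOn hB
  obtain ⟨M, hM1, hM⟩ : ∃ M : ℝ, 1 ≤ M ∧ ∀ t ∈ Icc (0 : ℝ) 1, ‖B t‖ ≤ M :=
    ⟨max 1 M', le_max_left _ _, fun t ht ↦ (hM' t ht).trans (le_max_right _ _)⟩
  set R : ℝ := ‖a‖ * Real.exp M + 1 with hR
  have hRpos : 0 < R := by positivity
  let χ : ContDiffBump (0 : W) := ⟨R, R + 1, hRpos, by linarith⟩
  have hg : ContDiff ℝ 1 (fun x : W ↦ χ x • x) := χ.contDiff.smul contDiff_id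
  have hgs : HasCompactSupport (fun x : W ↦ χ x • x) := χ.hasCompactSupport.smul_right
  obtain ⟨K, hK⟩ := ContDiff.lipschitzWith_of_hasCompactSupport hgs hg one_ne_zero
  obtain ⟨C, hC⟩ := hgs.exists_bound_of_continuous hg.continuous
  have hC0 : 0 ≤ C := (norm_nonneg _).trans (hC 0)
  obtain ⟨α, h0, hα⟩ := exists_hasDerivWithinAt_of_lipschitzWith_of_bounded
    (f := fun t x ↦ B t (χ x • x)) (K := ⟨M, by linarith⟩ * K) (L := ⟨M * C, by positivity⟩)
    (fun t ht ↦ ((B t).lipschitz.comp hK).weaken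
      (mul_le_mul_left (by exact_mod_cast hM t ht) _))
    (fun x ↦ hB.clm_apply continuousOn_const)
    (fun t ht x ↦ ((B t).le_opNorm _).trans
      (mul_le_mul (hM t ht) (hC x) (norm_nonneg _) (by linarith))) a
  have hbound : ∀ t ∈ Icc (0 : ℝ) 1, ‖α t‖ ≤ R := fun t ht ↦ by
    have := norm_le_add_mul_exp_of_deriv (norm_nonneg a) hM1 le_rfl hα (by rw [h0]) (fun t ht ↦ by
      rw [add_zero]
      refine ((B t).le_opNorm _).trans (mul_le_mul (hM t ht) ?_ (norm_nonneg _) (by linarith))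
      rw [norm_smul, Real.norm_of_nonneg χ.nonneg]
      exact mul_le_of_le_one_left (norm_nonneg _) χ.le_one) t ht
    linarith
  refine ⟨α, h0, fun t ht ↦ ?_⟩
  have := hα t ht
  rwa [χ.one_of_mem_closedBall (by simpa using hbound t ht), one_smul] at this

/-- A form of the tube lemma for strict inequalities. -/
theorem eventually_forall_mem_lt_of_continuousOn {X Y : Type*} [TopologicalSpace X]
    [TopologicalSpace Y] {g : X × Y → ℝ} {S : Set X} {K : Set Y} (hg : ContinuousOn g (S ×ˢ K))
    (hK : IsCompact K) {x₀ : X} (hx₀ : x₀ ∈ S) {c : ℝ} (h : ∀ y ∈ K, g (x₀, y) < c) :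
    ∀ᶠ x in 𝓝[S] x₀, ∀ y ∈ K, g (x, y) < c := by
  have := hK.eventually_forall_of_forall_eventually (x₀ := x₀)
    (P := fun x y ↦ x ∈ S → y ∈ K → g (x, y) < c) fun y hy ↦ by
      have := (hg (x₀, y) ⟨hx₀, hy⟩).eventually (gt_mem_nhds (h y hy))
      rw [eventually_nhdsWithin_iff] at this
      exact this.mono fun z hz h1 h2 ↦ hz ⟨h1, h2⟩
  rw [eventually_nhdsWithin_iff]
  exact this.mono fun x hx hxS y hy ↦ hx y hy hxS hy

/-- Solutions of a linear equation depend continuously on the coefficients. -/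
theorem continuousOn_of_hasDerivWithinAt_linear {X : Type*} [TopologicalSpace X]
    {B : X × ℝ → W →L[ℝ] W} {S : Set X} (hB : ContinuousOn B (S ×ˢ Icc 0 1)) {α : X × ℝ → W} {a : W}
    (h0 : ∀ x ∈ S, α (x, 0) = a) (hα : ∀ x ∈ S, ∀ t ∈ Icc (0 : ℝ) 1,
      HasDerivWithinAt (fun t ↦ α (x, t)) (B (x, t) (α (x, t))) (Icc 0 1) t) :
    ContinuousOn α (S ×ˢ Icc 0 1) := by
  have hαc : ∀ x ∈ S, ContinuousOn (fun t ↦ α (x, t)) (Icc 0 1) :=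
    fun x hx t ht ↦ (hα x hx t ht).continuousWithinAt
  rintro ⟨x₀, t₀⟩ ⟨hx₀ : x₀ ∈ S, ht₀ : t₀ ∈ Icc (0 : ℝ) 1⟩
  have hsec : ContinuousOn (fun t ↦ B (x₀, t)) (Icc 0 1) :=
    hB.comp (by fun_prop) fun t ht ↦ ⟨hx₀, ht⟩
  obtain ⟨M', hM'⟩ := isCompact_Icc.exists_bound_of_continuousOn hsec
  obtain ⟨M, hM1, hM⟩ : ∃ M : ℝ, 1 ≤ M ∧ ∀ t ∈ Icc (0 : ℝ) 1, ‖B (x₀, t)‖ < M :=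
    ⟨max 1 (M' + 1), le_max_left _ _, fun t ht ↦
      ((hM' t ht).trans_lt (lt_add_one _)).trans_le (le_max_right _ _)⟩
  have key : ∀ ε > 0, ∀ᶠ x in 𝓝[S] x₀, ∀ t ∈ Icc (0 : ℝ) 1,
      ‖α (x, t) - α (x₀, t)‖ ≤ ε * Real.exp M := fun ε hε ↦ by
    have hp2 : ContinuousOn (fun p : X × ℝ ↦ p.2) (S ×ˢ Icc (0 : ℝ) 1) := by fun_prop
    have e1 := eventually_forall_mem_lt_of_continuousOn hB.norm isCompact_Icc hx₀ hM
    have e2 := eventually_forall_mem_lt_of_continuousOn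
      (g := fun p ↦ ‖(B p - B (x₀, p.2)) (α (x₀, p.2))‖) (c := ε)
      ((hB.sub (hsec.comp hp2 fun p hp ↦ hp.2)).clm_apply
        ((hαc x₀ hx₀).comp hp2 fun p hp ↦ hp.2)).norm isCompact_Icc hx₀ (by simp [hε])
    filter_upwards [e1, e2, self_mem_nhdsWithin] with x h1 h2 hx t ht
    have := norm_le_add_mul_exp_of_deriv le_rfl hM1 hε.le
      (fun t ht ↦ (hα x hx t ht).fun_sub (hα x₀ hx₀ t ht)) (by simp [h0 x hx, h0 x₀ hx₀])
      (fun t ht ↦ by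
        have : B (x, t) (α (x, t)) - B (x₀, t) (α (x₀, t)) =
            B (x, t) (α (x, t) - α (x₀, t)) + (B (x, t) - B (x₀, t)) (α (x₀, t)) := by
          simp
        rw [this]
        refine (norm_add_le _ _).trans (add_le_add ?_ (h2 t ht).le)
        exact ((B (x, t)).le_opNorm _).trans
          (mul_le_mul_of_nonneg_right (h1 t ht).le (norm_nonneg _))) t ht
    simpa using this
  rw [ContinuousWithinAt, tendsto_iff_norm_sub_tendsto_zero]
  have t2 : Tendsto (fun p : X × ℝ ↦ ‖α (x₀, p.2) - α (x₀, t₀)‖) (𝓝[S ×ˢ Icc 0 1] (x₀, t₀))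
      (𝓝 0) := by
    rw [← tendsto_iff_norm_sub_tendsto_zero]
    refine (hαc x₀ hx₀ t₀ ht₀).tendsto.comp ?_
    rw [nhdsWithin_prod_eq]
    exact tendsto_snd
  have t1 : Tendsto (fun p : X × ℝ ↦ ‖α p - α (x₀, p.2)‖) (𝓝[S ×ˢ Icc 0 1] (x₀, t₀)) (𝓝 0) := by
    refine Metric.tendsto_nhds.2 fun ε hε ↦ ?_
    have hexp := Real.exp_pos M
    have h1 := key (ε / 2 / Real.exp M) (by positivity)
    rw [nhdsWithin_prod_eq]
    filter_upwards [h1.prod_mk (self_mem_nhdsWithin : Icc (0 : ℝ) 1 ∈ 𝓝[Icc 0 1] t₀)]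
      with p hp
    have h2 := hp.1 p.2 hp.2
    rw [div_mul_cancel₀ _ hexp.ne'] at h2
    rw [Real.dist_eq, sub_zero, abs_of_nonneg (norm_nonneg _)]
    linarith
  refine squeeze_zero (fun _ ↦ norm_nonneg _) (fun p ↦ ?_) (by simpa using t1.add t2)
  have := norm_sub_le_norm_sub_add_norm_sub (α p) (α (x₀, p.2)) (α (x₀, t₀))
  exact this

end ODE

section SmoothFlow

variable {F : Type*} [NormedAddCommGroup F] [NormedSpace ℝ F] [FiniteDimensional ℝ F]

/-- The flow of a vector field that is continuously differentiable in the space variable is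
differentiable, and its spatial derivative solves the variational equation. The domain `C` is only
assumed convex, so that it may have a boundary. -/
theorem exists_hasFDerivWithinAt_flow {C : Set F} (hC : Convex ℝ C) {f φ : ℝ × F → F}
    {Df : ℝ × F → F →L[ℝ] F} (hf : ∀ t ∈ Icc (0 : ℝ) 1, ∀ y ∈ C,
      HasFDerivWithinAt (fun z ↦ f (t, z)) (Df (t, y)) C y)
    (hDf : ContinuousOn Df (Icc 0 1 ×ˢ C)) (hφ : ContinuousOn φ (Icc 0 1 ×ˢ C))
    (hmaps : MapsTo φ (Icc 0 1 ×ˢ C) C) (h0 : ∀ y ∈ C, φ (0, y) = y)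
    (hode : ∀ y ∈ C, ∀ t ∈ Icc (0 : ℝ) 1,
      HasDerivWithinAt (fun s ↦ φ (s, y)) (f (t, φ (t, y))) (Icc 0 1) t) :
    ∃ A : ℝ × F → F →L[ℝ] F, ContinuousOn A (Icc 0 1 ×ˢ C) ∧
      (∀ y ∈ C, A (0, y) = ContinuousLinearMap.id ℝ F) ∧
      (∀ y ∈ C, ∀ t ∈ Icc (0 : ℝ) 1,
        HasDerivWithinAt (fun s ↦ A (s, y)) ((Df (t, φ (t, y))).comp (A (t, y))) (Icc 0 1) t) ∧
      ∀ t ∈ Icc (0 : ℝ) 1, ∀ y ∈ C, HasFDerivWithinAt φ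
        ((ContinuousLinearMap.toSpanSingleton ℝ (f (t, φ (t, y)))).comp
          (ContinuousLinearMap.fst ℝ ℝ F) + (A (t, y)).comp (ContinuousLinearMap.snd ℝ ℝ F))
        (Icc 0 1 ×ˢ C) (t, y) := by
  classical
  set I : Set ℝ := Icc 0 1 with hI
  -- the coefficients of the variational equation along the trajectories
  have hcoef : ContinuousOn (fun p : ℝ × F ↦ Df (p.1, φ p)) (I ×ˢ C) :=
    hDf.comp (continuousOn_fst.prodMk hφ) fun p hp ↦ ⟨hp.1, hmaps hp⟩
  have hcoef' : ContinuousOn (fun p : F × ℝ ↦ Df (p.2, φ (p.2, p.1))) (C ×ˢ I) :=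
    hcoef.comp continuous_swap.continuousOn fun p hp ↦ ⟨hp.2, hp.1⟩
  have hex : ∀ y : F, ∃ α : ℝ → F →L[ℝ] F, y ∈ C → α 0 = ContinuousLinearMap.id ℝ F ∧
      ∀ t ∈ I, HasDerivWithinAt α ((Df (t, φ (t, y))).comp (α t)) I t := fun y ↦ by
    by_cases hy : y ∈ C
    · obtain ⟨α, h1, h2⟩ := exists_hasDerivWithinAt_linear
        (B := fun t ↦ ContinuousLinearMap.compL ℝ F F F (Df (t, φ (t, y))))
        ((ContinuousLinearMap.compL ℝ F F F).continuous.comp_continuousOn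
          (hcoef.comp (f := fun t : ℝ ↦ (t, y)) (by fun_prop) fun t ht ↦ ⟨ht, hy⟩))
        (ContinuousLinearMap.id ℝ F)
      exact ⟨α, fun _ ↦ ⟨h1, h2⟩⟩
    · exact ⟨0, fun h ↦ absurd h hy⟩
  choose α hα using hex
  have hA : ContinuousOn (fun p : ℝ × F ↦ α p.2 p.1) (I ×ˢ C) := by
    have := continuousOn_of_hasDerivWithinAt_linear (α := fun p : F × ℝ ↦ α p.1 p.2) (S := C)
      (B := fun p ↦ ContinuousLinearMap.compL ℝ F F F (Df (p.2, φ (p.2, p.1))))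
      ((ContinuousLinearMap.compL ℝ F F F).continuous.comp_continuousOn hcoef')
      (fun y hy ↦ (hα y hy).1) (fun y hy ↦ (hα y hy).2)
    exact this.comp continuous_swap.continuousOn fun p hp ↦ ⟨hp.2, hp.1⟩
  refine ⟨fun p ↦ α p.2 p.1, hA, fun y hy ↦ (hα y hy).1, fun y hy ↦ (hα y hy).2, ?_⟩
  -- uniform first order expansion of the field along nearby trajectories
  have hE : ∀ y₀ ∈ C, ∀ ε > 0, ∀ᶠ y in 𝓝[C] y₀, ∀ t ∈ I,
      ‖f (t, φ (t, y)) - f (t, φ (t, y₀)) - Df (t, φ (t, y₀)) (φ (t, y) - φ (t, y₀))‖ ≤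
        ε * ‖φ (t, y) - φ (t, y₀)‖ := fun y₀ hy₀ ε hε ↦ by
    have := isCompact_Icc.eventually_forall_of_forall_eventually (x₀ := y₀) (K := I)
      (P := fun y t ↦ y ∈ C → t ∈ I →
        ‖f (t, φ (t, y)) - f (t, φ (t, y₀)) - Df (t, φ (t, y₀)) (φ (t, y) - φ (t, y₀))‖ ≤
        ε * ‖φ (t, y) - φ (t, y₀)‖) fun t₀ ht₀ ↦ by
      have hz : φ (t₀, y₀) ∈ C := hmaps (show (t₀, y₀) ∈ I ×ˢ C from ⟨ht₀, hy₀⟩)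
      obtain ⟨r, hr, hr'⟩ := Metric.continuousWithinAt_iff.1
        (hDf (t₀, φ (t₀, y₀)) ⟨ht₀, hz⟩) (ε / 2) (by positivity)
      have c1 := hφ (t₀, y₀) ⟨ht₀, hy₀⟩
      have n1 : ∀ᶠ p in 𝓝 (y₀, t₀), p ∈ C ×ˢ I → dist (φ (p.2, p.1)) (φ (t₀, y₀)) < r := by
        have : ContinuousWithinAt (fun p : F × ℝ ↦ φ (p.2, p.1)) (C ×ˢ I) (y₀, t₀) :=
          ContinuousWithinAt.comp (t := I ×ˢ C) (f := fun p : F × ℝ ↦ (p.2, p.1)) c1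
            (by fun_prop) fun p hp ↦ ⟨hp.2, hp.1⟩
        have := Metric.tendsto_nhds.1 this r hr
        rwa [eventually_nhdsWithin_iff] at this
      have n2 : ∀ᶠ p in 𝓝 (y₀, t₀), p ∈ C ×ˢ I → dist (φ (p.2, y₀)) (φ (t₀, y₀)) < r := by
        have : ContinuousWithinAt (fun p : F × ℝ ↦ φ (p.2, y₀)) (C ×ˢ I) (y₀, t₀) :=
          ContinuousWithinAt.comp (t := I ×ˢ C) (f := fun p : F × ℝ ↦ (p.2, y₀)) c1
            (by fun_prop) fun p hp ↦ ⟨hp.2, hy₀⟩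
        have := Metric.tendsto_nhds.1 this r hr
        rwa [eventually_nhdsWithin_iff] at this
      have n3 : ∀ᶠ p in 𝓝 (y₀, t₀), dist p.2 t₀ < r :=
        (continuous_snd.tendsto (y₀, t₀)).eventually (ball_mem_nhds t₀ hr)
      filter_upwards [n1, n2, n3] with p h1 h2 h3 hpC hpI
      replace h1 := h1 ⟨hpC, hpI⟩
      replace h2 := h2 ⟨hpC, hpI⟩
      have hclose : ∀ z ∈ C ∩ ball (φ (t₀, y₀)) r,
          dist (Df (p.2, z)) (Df (t₀, φ (t₀, y₀))) < ε / 2 := fun z hz ↦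
        hr' ⟨hpI, hz.1⟩ (by
          rw [Prod.dist_eq]; exact max_lt h3 hz.2)
      have m0 : φ (p.2, y₀) ∈ C ∩ ball (φ (t₀, y₀)) r :=
        ⟨hmaps (show (p.2, y₀) ∈ I ×ˢ C from ⟨hpI, hy₀⟩), h2⟩
      have m1 : φ (p.2, p.1) ∈ C ∩ ball (φ (t₀, y₀)) r :=
        ⟨hmaps (show (p.2, p.1) ∈ I ×ˢ C from ⟨hpI, hpC⟩), h1⟩
      exact Convex.norm_image_sub_le_of_norm_hasFDerivWithin_le'
        (f' := fun z ↦ Df (p.2, z)) (s := C ∩ ball (φ (t₀, y₀)) r)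
        (fun z hz ↦ (hf p.2 hpI z hz.1).mono inter_subset_left)
        (fun z hz ↦ by
          rw [← dist_eq_norm]
          have := dist_triangle_right (Df (p.2, z)) (Df (p.2, φ (p.2, y₀)))
            (Df (t₀, φ (t₀, y₀)))
          linarith [hclose z hz, hclose _ m0])
        (hC.inter (convex_ball _ _)) m0 m1
    rw [eventually_nhdsWithin_iff]
    exact this.mono fun y hy hyC t ht ↦ hy t ht hyC ht
  -- Grönwall turns it into a uniform first order expansion of the flow
  have hU : ∀ y₀ ∈ C, ∀ ε > 0, ∀ᶠ y in 𝓝[C] y₀, ∀ t ∈ I,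
      ‖φ (t, y) - φ (t, y₀) - α y₀ t (y - y₀)‖ ≤ ε * ‖y - y₀‖ := fun y₀ hy₀ ε hε ↦ by
    obtain ⟨M', hM'⟩ := isCompact_Icc.exists_bound_of_continuousOn
      (hcoef.comp (f := fun t : ℝ ↦ (t, y₀)) (by fun_prop) fun t ht ↦ ⟨ht, hy₀⟩)
    obtain ⟨M, hM1, hM⟩ : ∃ M : ℝ, 1 ≤ M ∧ ∀ t ∈ I, ‖Df (t, φ (t, y₀))‖ ≤ M :=
      ⟨max 1 M', le_max_left _ _, fun t ht ↦ (hM' t ht).trans (le_max_right _ _)⟩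
    have hexp := Real.exp_pos (M + 1)
    filter_upwards [hE y₀ hy₀ 1 one_pos,
      hE y₀ hy₀ (ε / (Real.exp (M + 1) * Real.exp (M + 1))) (by positivity),
      self_mem_nhdsWithin] with y h1 h2 hy
    have g1 : ∀ t ∈ I, ‖φ (t, y) - φ (t, y₀)‖ ≤ ‖y - y₀‖ * Real.exp (M + 1) := fun t ht ↦ by
      have := norm_le_add_mul_exp_of_deriv (norm_nonneg (y - y₀)) (K := M + 1) (by linarith)
        le_rfl (fun t ht ↦ (hode y hy t ht).fun_sub (hode y₀ hy₀ t ht))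
        (by rw [h0 y hy, h0 y₀ hy₀]) (fun t ht ↦ by
          have e := norm_le_norm_sub_add (f (t, φ (t, y)) - f (t, φ (t, y₀)))
            (Df (t, φ (t, y₀)) (φ (t, y) - φ (t, y₀)))
          have e2 := (Df (t, φ (t, y₀))).le_of_opNorm_le (hM t ht) (φ (t, y) - φ (t, y₀))
          linarith [h1 t ht]) t ht
      simpa using this
    intro t ht
    have hlin : ∀ t ∈ I, HasDerivWithinAt (fun s ↦ α y₀ s (y - y₀))
        (Df (t, φ (t, y₀)) (α y₀ t (y - y₀))) I t := fun t ht ↦ by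
      simpa using ((hα y₀ hy₀).2 t ht).clm_apply (hasDerivWithinAt_const t I (y - y₀))
    have := norm_le_add_mul_exp_of_deriv le_rfl (K := M + 1)
      (ε := ε / (Real.exp (M + 1) * Real.exp (M + 1)) * (‖y - y₀‖ * Real.exp (M + 1)))
      (by linarith) (by positivity)
      (fun t ht ↦ ((hode y hy t ht).fun_sub (hode y₀ hy₀ t ht)).fun_sub (hlin t ht))
      (by rw [h0 y hy, h0 y₀ hy₀, (hα y₀ hy₀).1]; simp) (fun t ht ↦ by
        have e : f (t, φ (t, y)) - f (t, φ (t, y₀)) - Df (t, φ (t, y₀)) (α y₀ t (y - y₀)) =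
          Df (t, φ (t, y₀)) (φ (t, y) - φ (t, y₀) - α y₀ t (y - y₀)) +
          (f (t, φ (t, y)) - f (t, φ (t, y₀)) -
            Df (t, φ (t, y₀)) (φ (t, y) - φ (t, y₀))) := by
          simp only [map_sub]; abel
        rw [e]
        refine (norm_add_le _ _).trans (add_le_add ?_ ((h2 t ht).trans ?_))
        · refine ((Df (t, φ (t, y₀))).le_of_opNorm_le (hM t ht) _).trans ?_
          exact mul_le_mul_of_nonneg_right (by linarith) (norm_nonneg _)
        · exact mul_le_mul_of_nonneg_left (g1 t ht) (by positivity)) t ht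
    refine this.trans (le_of_eq ?_)
    field_simp
    ring
  intro t ht y hy
  have p1 : HasFDerivWithinAt (fun p : ℝ × F ↦ φ (p.1, y))
      ((ContinuousLinearMap.toSpanSingleton ℝ (f (t, φ (t, y)))).comp
        (ContinuousLinearMap.fst ℝ ℝ F)) (I ×ˢ C) (t, y) :=
    HasFDerivWithinAt.comp (t := I) (g := fun s ↦ φ (s, y)) (f := Prod.fst) (t, y)
      (hode y hy t ht).hasFDerivWithinAt hasFDerivAt_fst.hasFDerivWithinAt fun p hp ↦ hp.1
  have p2 : HasFDerivWithinAt (fun p : ℝ × F ↦ φ p - φ (p.1, y))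
      ((α y t).comp (ContinuousLinearMap.snd ℝ ℝ F)) (I ×ˢ C) (t, y) := by
    rw [hasFDerivWithinAt_iff_isLittleO, Asymptotics.isLittleO_iff]
    intro ε hε
    have u1 := hU y hy (ε / 2) (by positivity)
    have u3 : ∀ᶠ p : ℝ × F in 𝓝[I ×ˢ C] (t, y), ∀ s ∈ I,
        ‖φ (s, p.2) - φ (s, y) - α y s (p.2 - y)‖ ≤ ε / 2 * ‖p.2 - y‖ := by
      rw [nhdsWithin_prod_eq]
      exact tendsto_snd.eventually u1
    -- compare with the derivative at time `p.1`, and let the latter tend to the one at time `t`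
    have u4 : ∀ᶠ p : ℝ × F in 𝓝[I ×ˢ C] (t, y), dist (α y p.1) (α y t) < ε / 2 := by
      have : ContinuousWithinAt (fun p : ℝ × F ↦ α y p.1) (I ×ˢ C) (t, y) :=
        ContinuousWithinAt.comp (t := I) (g := α y) (f := Prod.fst)
          (((hα y hy).2 t ht).continuousWithinAt) (by fun_prop) fun p hp ↦ hp.1
      exact Metric.tendsto_nhds.1 this _ (by positivity)
    filter_upwards [u3, u4, self_mem_nhdsWithin] with p h3 h4 hp
    have e : φ p - φ (p.1, y) - (φ (t, y) - φ (t, y)) -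
        ((α y t).comp (ContinuousLinearMap.snd ℝ ℝ F)) (p - (t, y)) =
        (φ (p.1, p.2) - φ (p.1, y) - α y p.1 (p.2 - y)) + (α y p.1 - α y t) (p.2 - y) := by
      simp
    rw [e]
    have n1 : ‖p.2 - y‖ ≤ ‖p - (t, y)‖ := norm_snd_le (p - (t, y))
    have n2 := (α y p.1 - α y t).le_of_opNorm_le (dist_eq_norm (α y p.1) (α y t)).ge (p.2 - y)
    refine (norm_add_le _ _).trans ?_
    have := h3 p.1 hp.1
    have n3 := mul_le_mul_of_nonneg_right h4.le (norm_nonneg (p.2 - y))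
    have n4 := mul_le_mul_of_nonneg_left n1 hε.le
    linarith
  exact (p1.fun_add p2).congr (fun p _ ↦ by simp) (by simp)

/-- The spatial derivative of a smooth time-dependent vector field. -/
noncomputable def spatialFDerivWithin {G : Type*} [NormedAddCommGroup G] [NormedSpace ℝ G] (f : ℝ × F → G)
    (C : Set F) (p : ℝ × F) : F →L[ℝ] G :=
  (fderivWithin ℝ f (Icc 0 1 ×ˢ C) p).comp (ContinuousLinearMap.inr ℝ ℝ F)

section

variable {G : Type*} [NormedAddCommGroup G] [NormedSpace ℝ G] {f : ℝ × F → G} {C : Set F}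

omit [FiniteDimensional ℝ F] in
theorem hasFDerivWithinAt_spatialFDerivWithin (hf : DifferentiableOn ℝ f (Icc 0 1 ×ˢ C)) {t : ℝ}
    (ht : t ∈ Icc (0 : ℝ) 1) {y : F} (hy : y ∈ C) :
    HasFDerivWithinAt (fun z ↦ f (t, z)) (spatialFDerivWithin f C (t, y)) C y :=
  HasFDerivWithinAt.comp (t := Icc 0 1 ×ˢ C) (g := f) (f := fun z ↦ (t, z)) y
    (hf (t, y) ⟨ht, hy⟩).hasFDerivWithinAt
    (hasFDerivAt_prodMk_right t y).hasFDerivWithinAt fun _ hz ↦ ⟨ht, hz⟩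

omit [FiniteDimensional ℝ F] in
theorem uniqueDiffOn_Icc_prod (hC : UniqueDiffOn ℝ C) :
    UniqueDiffOn ℝ (Icc (0 : ℝ) 1 ×ˢ C) :=
  (uniqueDiffOn_Icc zero_lt_one).prod hC

omit [FiniteDimensional ℝ F] in
theorem contDiffOn_spatialFDerivWithin {k : WithTop ℕ∞} (hC : UniqueDiffOn ℝ C)
    (hf : ContDiffOn ℝ (k + 1) f (Icc 0 1 ×ˢ C)) :
    ContDiffOn ℝ k (spatialFDerivWithin f C) (Icc 0 1 ×ˢ C) :=
  (((contDiffOn_succ_iff_fderivWithin (uniqueDiffOn_Icc_prod hC)).1 hf).2.2).clm_comp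
    contDiffOn_const

end

/-- The flow of a `C^k` vector field is `C^k`, up to the boundary of the convex domain `C`.
The induction step applies the statement to the system formed by the equation and its variational
equation. -/
theorem contDiffOn_flow {F : Type*} [NormedAddCommGroup F] [NormedSpace ℝ F]
    [FiniteDimensional ℝ F] (k : ℕ) {C : Set F} (hC : Convex ℝ C) (hCu : UniqueDiffOn ℝ C)
    {f φ : ℝ × F → F} (hf : ContDiffOn ℝ k f (Icc 0 1 ×ˢ C))
    (hφ : ContinuousOn φ (Icc 0 1 ×ˢ C))
    (hmaps : MapsTo φ (Icc 0 1 ×ˢ C) C) (h0 : ∀ y ∈ C, φ (0, y) = y)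
    (hode : ∀ y ∈ C, ∀ t ∈ Icc (0 : ℝ) 1,
      HasDerivWithinAt (fun s ↦ φ (s, y)) (f (t, φ (t, y))) (Icc 0 1) t) :
    ContDiffOn ℝ k φ (Icc 0 1 ×ˢ C) := by
  induction k generalizing F with
  | zero => exact contDiffOn_zero.2 hφ
  | succ k ih =>
    push_cast at hf ⊢
    have hDf := contDiffOn_spatialFDerivWithin hCu hf
    have hfd : DifferentiableOn ℝ f (Icc 0 1 ×ˢ C) := hf.differentiableOn (by simp)
    obtain ⟨A, hAc, hA0, hA1, hφA⟩ := exists_hasFDerivWithinAt_flow hC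
      (fun t ht y hy ↦ hasFDerivWithinAt_spatialFDerivWithin hfd ht hy) hDf.continuousOn hφ hmaps
      h0 hode
    have hfk : ContDiffOn ℝ k f (Icc 0 1 ×ˢ C) := hf.of_le (by exact_mod_cast Nat.le_succ k)
    have hφk := ih hC hCu hfk hφ hmaps h0 hode
    have m1 : MapsTo (fun p : ℝ × F × (F →L[ℝ] F) ↦ (p.1, p.2.1))
        (Icc 0 1 ×ˢ C ×ˢ univ) (Icc (0 : ℝ) 1 ×ˢ C) := fun p hp ↦ ⟨hp.1, hp.2.1⟩
    have c1 : ContDiff ℝ k (fun p : ℝ × F × (F →L[ℝ] F) ↦ (p.1, p.2.1)) := by fun_prop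
    have hsys := ih (C := C ×ˢ (univ : Set (F →L[ℝ] F))) (hC.prod convex_univ)
      (hCu.prod uniqueDiffOn_univ)
      (f := fun p ↦ (f (p.1, p.2.1), (spatialFDerivWithin f C (p.1, p.2.1)).comp p.2.2))
      (φ := fun p ↦ (φ (p.1, p.2.1), (A (p.1, p.2.1)).comp p.2.2))
      ((hfk.comp c1.contDiffOn m1).prodMk
        ((hDf.comp c1.contDiffOn m1).clm_comp (by fun_prop)))
      ((hφ.comp c1.continuous.continuousOn m1).prodMk
        ((hAc.comp c1.continuous.continuousOn m1).clm_comp (by fun_prop)))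
      (fun p hp ↦ ⟨hmaps (m1 hp), mem_univ _⟩)
      (fun p hp ↦ by simp [h0 _ hp.1, hA0 _ hp.1])
      (fun p hp t ht ↦ (hode p.1 hp.1 t ht).prodMk (by
        have := (hA1 p.1 hp.1 t ht).clm_comp (hasDerivWithinAt_const t (Icc 0 1) p.2)
        simpa [ContinuousLinearMap.comp_assoc] using this))
    have hAk : ContDiffOn ℝ k A (Icc 0 1 ×ˢ C) := by
      have := hsys.snd.comp (s := Icc 0 1 ×ˢ C)
        (f := fun p : ℝ × F ↦ (p.1, p.2, ContinuousLinearMap.id ℝ F)) (by fun_prop)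
        fun p hp ↦ ⟨hp.1, hp.2, mem_univ _⟩
      exact this.congr fun p hp ↦ by simp
    rw [contDiffOn_succ_iff_hasFDerivWithinAt_of_uniqueDiffOn (uniqueDiffOn_Icc_prod hCu)]
    refine ⟨by simp, fun p ↦ (ContinuousLinearMap.toSpanSingleton ℝ (f (p.1, φ p))).comp
      (ContinuousLinearMap.fst ℝ ℝ F) + (A p).comp (ContinuousLinearMap.snd ℝ ℝ F), ?_,
      fun p hp ↦ hφA p.1 hp.1 p.2 hp.2⟩
    have c2 : ContDiffOn ℝ k (fun p : ℝ × F ↦ f (p.1, φ p)) (Icc 0 1 ×ˢ C) :=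
      hfk.comp (contDiffOn_fst.prodMk hφk) fun p hp ↦ ⟨hp.1, hmaps hp⟩
    refine ContDiffOn.add ?_ (hAk.clm_comp contDiffOn_const)
    exact ((ContinuousLinearMap.toSpanSingletonCLE (𝕜 := ℝ) (E := F)).contDiff.comp_contDiffOn
      c2).clm_comp contDiffOn_const

/-- A smooth field that vanishes outside a compact set is bounded and Lipschitz, uniformly in
time. -/
theorem exists_bound_and_lipschitzOnWith_of_eq_zero {G : Type*} [NormedAddCommGroup G]
    [NormedSpace ℝ G] {C Q : Set F} (hC : Convex ℝ C) (hCc : IsClosed C) (hCu : UniqueDiffOn ℝ C)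
    (hQ : IsCompact Q) {f : ℝ × F → G} (hf : ContDiffOn ℝ ∞ f (Icc 0 1 ×ˢ C))
    (hzero : ∀ t ∈ Icc (0 : ℝ) 1, ∀ y ∈ C, y ∉ Q → f (t, y) = 0) :
    ∃ L K : ℝ≥0, (∀ t ∈ Icc (0 : ℝ) 1, ∀ y ∈ C, ‖f (t, y)‖ ≤ L) ∧
      ∀ t ∈ Icc (0 : ℝ) 1, LipschitzOnWith K (fun y ↦ f (t, y)) C := by
  have hcomp : IsCompact (Icc (0 : ℝ) 1 ×ˢ (C ∩ Q)) := isCompact_Icc.prod (hQ.inter_left hCc)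
  have hsub : Icc (0 : ℝ) 1 ×ˢ (C ∩ Q) ⊆ Icc (0 : ℝ) 1 ×ˢ C :=
    prod_mono_right inter_subset_left
  have hfd : DifferentiableOn ℝ f (Icc 0 1 ×ˢ C) := hf.differentiableOn (by simp)
  obtain ⟨L, hL⟩ := hcomp.exists_bound_of_continuousOn (hf.continuousOn.mono hsub)
  obtain ⟨K, hK⟩ := hcomp.exists_bound_of_continuousOn
    ((contDiffOn_spatialFDerivWithin (k := 0) hCu (hf.of_le (by simp))).continuousOn.mono hsub)
  refine ⟨⟨max L 0, le_max_right _ _⟩, ⟨max K 0, le_max_right _ _⟩, fun t ht y hy ↦ ?_,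
    fun t ht ↦ ?_⟩
  · by_cases hyQ : y ∈ Q
    · exact (hL (t, y) ⟨ht, hy, hyQ⟩).trans (le_max_left _ _)
    · rw [hzero t ht y hy hyQ, norm_zero]
      exact le_max_right _ _
  · refine hC.lipschitzOnWith_of_nnnorm_hasFDerivWithin_le
      (fun y hy ↦ hasFDerivWithinAt_spatialFDerivWithin hfd ht hy) fun y hy ↦ ?_
    by_cases hyQ : y ∈ Q
    · exact (hK (t, y) ⟨ht, hy, hyQ⟩).trans (le_max_left _ _)
    · have h1 := hasFDerivWithinAt_spatialFDerivWithin hfd ht hy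
      have h2 : HasFDerivWithinAt (fun z ↦ f (t, z)) (0 : F →L[ℝ] G) C y := by
        refine (hasFDerivWithinAt_const (0 : G) y C).congr_of_eventuallyEq ?_
          (hzero t ht y hy hyQ)
        filter_upwards [self_mem_nhdsWithin,
          mem_nhdsWithin_of_mem_nhds (hQ.isClosed.isOpen_compl.mem_nhds hyQ)] with z hz hzQ
        exact hzero t ht z hz hzQ
      rw [(hCu y hy).eq h1 h2, nnnorm_zero]
      exact zero_le

/-- A smooth, bounded and Lipschitz vector field on a closed convex set `C` that is not left by the
trajectories has a smooth flow. Being confined to `C` is expressed with the help of a Lipschitz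
retraction onto `C`. -/
theorem exists_contDiffOn_flow {C : Set F} (hC : Convex ℝ C)
    (hCu : UniqueDiffOn ℝ C) {r : F → F} {R : ℝ≥0} (hr : LipschitzWith R r) (hrC : ∀ y, r y ∈ C)
    (hrid : ∀ y ∈ C, r y = y) {f : ℝ × F → F} (hf : ContDiffOn ℝ ∞ f (Icc 0 1 ×ˢ C)) {L K : ℝ≥0}
    (hL : ∀ t ∈ Icc (0 : ℝ) 1, ∀ y ∈ C, ‖f (t, y)‖ ≤ L)
    (hK : ∀ t ∈ Icc (0 : ℝ) 1, LipschitzOnWith K (fun y ↦ f (t, y)) C)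
    (hinv : ∀ α : ℝ → F, α 0 ∈ C →
      (∀ t ∈ Icc (0 : ℝ) 1, HasDerivWithinAt α (f (t, r (α t))) (Icc 0 1) t) →
      ∀ t ∈ Icc (0 : ℝ) 1, α t ∈ C) :
    ∃ φ : ℝ × F → F, ContDiffOn ℝ ∞ φ (Icc 0 1 ×ˢ C) ∧ MapsTo φ (Icc 0 1 ×ˢ C) C ∧
      (∀ y ∈ C, φ (0, y) = y) ∧ ∀ y ∈ C, ∀ t ∈ Icc (0 : ℝ) 1,
        HasDerivWithinAt (fun s ↦ φ (s, y)) (f (t, φ (t, y))) (Icc 0 1) t := by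
  have hlip : ∀ t ∈ Icc (0 : ℝ) 1, LipschitzWith (K * R) (fun y ↦ f (t, r y)) := fun t ht ↦
    lipschitzOnWith_univ.1 ((hK t ht).comp (hr.lipschitzOnWith (s := univ)) fun y _ ↦ hrC y)
  have hex : ∀ y : F, ∃ α : ℝ → F, α 0 = y ∧
      ∀ t ∈ Icc (0 : ℝ) 1, HasDerivWithinAt α (f (t, r (α t))) (Icc 0 1) t := fun y ↦
    exists_hasDerivWithinAt_of_lipschitzWith_of_bounded (f := fun t y ↦ f (t, r y)) hlip
      (fun x ↦ hf.continuousOn.comp (by fun_prop) fun t ht ↦ ⟨ht, hrC x⟩)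
      (fun t ht x ↦ hL t ht _ (hrC x)) y
  choose α hα0 hα using hex
  have hαC : ∀ y ∈ C, ∀ t ∈ Icc (0 : ℝ) 1, α y t ∈ C := fun y hy ↦
    hinv (α y) (by rwa [hα0]) (hα y)
  have hode : ∀ y ∈ C, ∀ t ∈ Icc (0 : ℝ) 1,
      HasDerivWithinAt (fun s ↦ α y s) (f (t, α y t)) (Icc 0 1) t := fun y hy t ht ↦ by
    have := hα y t ht
    rwa [hrid _ (hαC y hy t ht)] at this
  have hcont : ContinuousOn (fun p : ℝ × F ↦ α p.2 p.1) (Icc 0 1 ×ˢ C) := by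
    refine continuousOn_prod_of_continuousOn_lipschitzOnWith' _
      ⟨Real.exp K, (Real.exp_pos _).le⟩ (fun t ht ↦ ?_) fun y hy t ht ↦
      (hode y hy t ht).continuousWithinAt
    refine LipschitzOnWith.of_dist_le_mul fun y hy z hz ↦ ?_
    have := dist_le_of_trajectories_ODE_of_mem (v := fun t y ↦ f (t, y)) (s := fun _ ↦ C)
      (fun t ht ↦ hK t (Ico_subset_Icc_self ht))
      (fun t ht ↦ (hode y hy t ht).continuousWithinAt)
      (fun t ht ↦ (hode y hy t (Ico_subset_Icc_self ht)).Ici_of_Icc ht)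
      (fun t ht ↦ hαC y hy t (Ico_subset_Icc_self ht))
      (fun t ht ↦ (hode z hz t ht).continuousWithinAt)
      (fun t ht ↦ (hode z hz t (Ico_subset_Icc_self ht)).Ici_of_Icc ht)
      (fun t ht ↦ hαC z hz t (Ico_subset_Icc_self ht)) le_rfl t ht
    rw [hα0, hα0] at this
    rw [mul_comm]
    refine this.trans (mul_le_mul_of_nonneg_left ?_ dist_nonneg)
    exact Real.exp_le_exp.2 (mul_le_of_le_one_right K.2 (by linarith [ht.2]))
  refine ⟨fun p ↦ α p.2 p.1, ?_, fun p hp ↦ hαC _ hp.2 _ hp.1, fun y _ ↦ hα0 y, hode⟩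
  exact contDiffOn_infty.2 fun k ↦ contDiffOn_flow k hC hCu (hf.of_le (by exact_mod_cast le_top))
    hcont (fun p hp ↦ hαC _ hp.2 _ hp.1) (fun y _ ↦ hα0 y) hode

omit [FiniteDimensional ℝ F] in
/-- Trajectories of a Lipschitz field on `C` are determined by their value at any one time. -/
theorem eqOn_of_hasDerivWithinAt_of_lipschitzOnWith {C : Set F} {f : ℝ × F → F} {K : ℝ≥0}
    (hK : ∀ t ∈ Icc (0 : ℝ) 1, LipschitzOnWith K (fun y ↦ f (t, y)) C) {α β : ℝ → F}
    (hα : ∀ t ∈ Icc (0 : ℝ) 1, HasDerivWithinAt α (f (t, α t)) (Icc 0 1) t)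
    (hβ : ∀ t ∈ Icc (0 : ℝ) 1, HasDerivWithinAt β (f (t, β t)) (Icc 0 1) t)
    (hαC : ∀ t ∈ Icc (0 : ℝ) 1, α t ∈ C) (hβC : ∀ t ∈ Icc (0 : ℝ) 1, β t ∈ C) {t₀ : ℝ}
    (ht₀ : t₀ ∈ Icc (0 : ℝ) 1) (h : α t₀ = β t₀) : EqOn α β (Icc 0 1) := by
  have hsub1 : Icc t₀ 1 ⊆ Icc (0 : ℝ) 1 := Icc_subset_Icc_left ht₀.1
  have hsub2 : Icc 0 t₀ ⊆ Icc (0 : ℝ) 1 := Icc_subset_Icc_right ht₀.2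
  have hleft : ∀ {γ : ℝ → F} {v : F} {t : ℝ}, t ∈ Ioc 0 t₀ → HasDerivWithinAt γ v (Icc 0 1) t →
      HasDerivWithinAt γ v (Iic t) t := fun {γ v t} ht hγ ↦
    hγ.mono_of_mem_nhdsWithin (Icc_mem_nhdsLE_of_mem ⟨ht.1, ht.2.trans ht₀.2⟩)
  rw [← Icc_union_Icc_eq_Icc ht₀.1 ht₀.2]
  refine EqOn.union ?_ ?_
  · exact ODE_solution_unique_of_mem_Icc_left (v := fun t y ↦ f (t, y)) (s := fun _ ↦ C)
      (fun t ht ↦ hK t (hsub2 (Ioc_subset_Icc_self ht)))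
      (fun t ht ↦ (hα t (hsub2 ht)).continuousWithinAt.mono hsub2)
      (fun t ht ↦ hleft ht (hα t (hsub2 (Ioc_subset_Icc_self ht))))
      (fun t ht ↦ hαC t (hsub2 (Ioc_subset_Icc_self ht)))
      (fun t ht ↦ (hβ t (hsub2 ht)).continuousWithinAt.mono hsub2)
      (fun t ht ↦ hleft ht (hβ t (hsub2 (Ioc_subset_Icc_self ht))))
      (fun t ht ↦ hβC t (hsub2 (Ioc_subset_Icc_self ht))) h
  · exact ODE_solution_unique_of_mem_Icc_right (v := fun t y ↦ f (t, y)) (s := fun _ ↦ C)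
      (fun t ht ↦ hK t (hsub1 (Ico_subset_Icc_self ht)))
      (fun t ht ↦ (hα t (hsub1 ht)).continuousWithinAt.mono hsub1)
      (fun t ht ↦ (hα t (hsub1 (Ico_subset_Icc_self ht))).Ici_of_Icc ⟨ht₀.1.trans ht.1, ht.2⟩)
      (fun t ht ↦ hαC t (hsub1 (Ico_subset_Icc_self ht)))
      (fun t ht ↦ (hβ t (hsub1 ht)).continuousWithinAt.mono hsub1)
      (fun t ht ↦ (hβ t (hsub1 (Ico_subset_Icc_self ht))).Ici_of_Icc ⟨ht₀.1.trans ht.1, ht.2⟩)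
      (fun t ht ↦ hβC t (hsub1 (Ico_subset_Icc_self ht))) h

end SmoothFlow

section FlowWithIntegral

theorem HasDerivWithinAt.prod_fst {F G : Type*} [NormedAddCommGroup F] [NormedSpace ℝ F]
    [NormedAddCommGroup G] [NormedSpace ℝ G] {f : ℝ → F × G} {f' : F × G} {s : Set ℝ} {t : ℝ}
    (h : HasDerivWithinAt f f' s t) : HasDerivWithinAt (fun t ↦ (f t).1) f'.1 s t :=
  (hasFDerivAt_fst (𝕜 := ℝ) (p := f t)).comp_hasDerivWithinAt t h

theorem HasDerivWithinAt.prod_snd {F G : Type*} [NormedAddCommGroup F] [NormedSpace ℝ F]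
    [NormedAddCommGroup G] [NormedSpace ℝ G] {f : ℝ → F × G} {f' : F × G} {s : Set ℝ} {t : ℝ}
    (h : HasDerivWithinAt f f' s t) : HasDerivWithinAt (fun t ↦ (f t).2) f'.2 s t :=
  (hasFDerivAt_snd (𝕜 := ℝ) (p := f t)).comp_hasDerivWithinAt t h

variable {F : Type*} [NormedAddCommGroup F] [NormedSpace ℝ F] [FiniteDimensional ℝ F]

/-- The flow of a vector field together with the integral of a function along its trajectories;
both are components of the flow of one vector field on the product with a line. -/
theorem exists_contDiffOn_flow_and_integral {C : Set F} (hC : Convex ℝ C)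
    (hCu : UniqueDiffOn ℝ C) {r : F → F} {R : ℝ≥0} (hr : LipschitzWith R r) (hrC : ∀ y, r y ∈ C)
    (hrid : ∀ y ∈ C, r y = y) {f : ℝ × F → F} {h : ℝ × F → ℝ}
    (hf : ContDiffOn ℝ ∞ f (Icc 0 1 ×ˢ C)) (hh : ContDiffOn ℝ ∞ h (Icc 0 1 ×ˢ C)) {L K : ℝ≥0}
    (hL : ∀ t ∈ Icc (0 : ℝ) 1, ∀ y ∈ C, ‖(f (t, y), h (t, y))‖ ≤ L)
    (hK : ∀ t ∈ Icc (0 : ℝ) 1, LipschitzOnWith K (fun y ↦ (f (t, y), h (t, y))) C)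
    (hinv : ∀ α : ℝ → F, α 0 ∈ C →
      (∀ t ∈ Icc (0 : ℝ) 1, HasDerivWithinAt α (f (t, r (α t))) (Icc 0 1) t) →
      ∀ t ∈ Icc (0 : ℝ) 1, α t ∈ C) :
    ∃ (φ : ℝ × F → F) (S : ℝ × F → ℝ), ContDiffOn ℝ ∞ φ (Icc 0 1 ×ˢ C) ∧
      ContDiffOn ℝ ∞ S (Icc 0 1 ×ˢ C) ∧ MapsTo φ (Icc 0 1 ×ˢ C) C ∧
      (∀ y ∈ C, φ (0, y) = y) ∧ (∀ y ∈ C, S (0, y) = 0) ∧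
      (∀ y ∈ C, ∀ t ∈ Icc (0 : ℝ) 1,
        HasDerivWithinAt (fun s ↦ φ (s, y)) (f (t, φ (t, y))) (Icc 0 1) t) ∧
      ∀ y ∈ C, ∀ t ∈ Icc (0 : ℝ) 1,
        HasDerivWithinAt (fun s ↦ S (s, y)) (h (t, φ (t, y))) (Icc 0 1) t := by
  have m1 : MapsTo (fun p : ℝ × F × ℝ ↦ (p.1, p.2.1))
      (Icc 0 1 ×ˢ C ×ˢ univ) (Icc (0 : ℝ) 1 ×ˢ C) := fun p hp ↦ ⟨hp.1, hp.2.1⟩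
  have c1 : ContDiff ℝ ∞ (fun p : ℝ × F × ℝ ↦ (p.1, p.2.1)) := by fun_prop
  obtain ⟨Φ, hΦ, hΦC, hΦ0, hΦode⟩ := exists_contDiffOn_flow (C := C ×ˢ (univ : Set ℝ))
    (r := fun q ↦ (r q.1, q.2)) (f := fun p ↦ (f (p.1, p.2.1), h (p.1, p.2.1))) (hC.prod convex_univ)
    (hCu.prod uniqueDiffOn_univ) ((hr.comp LipschitzWith.prod_fst).prodMk LipschitzWith.prod_snd)
    (fun y ↦ ⟨hrC _, mem_univ _⟩) (fun y hy ↦ Prod.ext (hrid _ hy.1) rfl)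
    ((hf.comp c1.contDiffOn m1).prodMk (hh.comp c1.contDiffOn m1))
    (fun t ht y hy ↦ hL t ht y.1 hy.1)
    (fun t ht ↦ (hK t ht).comp (LipschitzWith.prod_fst.lipschitzOnWith (s := C ×ˢ univ))
      fun y hy ↦ hy.1)
    (fun α hα0 hα t ht ↦ ⟨hinv (fun s ↦ (α s).1) hα0.1 (fun s hs ↦
      (hα s hs).prod_fst) t ht, mem_univ _⟩)
  have c2 : ContDiff ℝ ∞ (fun p : ℝ × F ↦ (p.1, p.2, (0 : ℝ))) := by fun_prop
  have m2 : MapsTo (fun p : ℝ × F ↦ (p.1, p.2, (0 : ℝ)))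
      (Icc (0 : ℝ) 1 ×ˢ C) (Icc 0 1 ×ˢ C ×ˢ univ) := fun p hp ↦ ⟨hp.1, hp.2, mem_univ _⟩
  have hΨ := hΦ.comp c2.contDiffOn m2
  exact ⟨fun p ↦ (Φ (p.1, p.2, 0)).1, fun p ↦ (Φ (p.1, p.2, 0)).2, hΨ.fst, hΨ.snd,
    fun p hp ↦ (hΦC (m2 hp)).1, fun y hy ↦ by simp only [hΦ0 (y, 0) ⟨hy, mem_univ _⟩],
    fun y hy ↦ by simp only [hΦ0 (y, 0) ⟨hy, mem_univ _⟩],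
    fun y hy t ht ↦ (hΦode (y, 0) ⟨hy, mem_univ _⟩ t ht).prod_fst,
    fun y hy t ht ↦ (hΦode (y, 0) ⟨hy, mem_univ _⟩ t ht).prod_snd⟩

end FlowWithIntegral

/-! ### Half-spaces -/

section HalfSpace

variable {E : Type*} [NormedAddCommGroup E] [NormedSpace ℝ E] {ℓ : E →L[ℝ] ℝ} {e : E}

/-- The closed half-space on which the functional `ℓ` is nonnegative. -/
def halfSpace (ℓ : E →L[ℝ] ℝ) : Set E := {y | 0 ≤ ℓ y}

/-- The slab on which the functional `ℓ` takes values between zero and one. -/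
def slab (ℓ : E →L[ℝ] ℝ) : Set E := {y | ℓ y ∈ Icc (0 : ℝ) 1}

theorem slab_subset_halfSpace : slab ℓ ⊆ halfSpace ℓ := fun _ hy ↦ hy.1

theorem convex_halfSpace : Convex ℝ (halfSpace ℓ) :=
  convex_halfSpace_ge ℓ.isLinear 0

theorem convex_slab : Convex ℝ (slab ℓ) :=
  (convex_Icc (0 : ℝ) 1).linear_preimage ℓ.toLinearMap

theorem isClosed_halfSpace : IsClosed (halfSpace ℓ) :=
  isClosed_le continuous_const ℓ.continuous

theorem isClosed_slab : IsClosed (slab ℓ) := isClosed_Icc.preimage ℓ.continuous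

theorem nonempty_interior_slab (he : ℓ e = 1) : (interior (slab ℓ)).Nonempty := by
  refine ⟨(1 / 2 : ℝ) • e, interior_mono (s := ℓ ⁻¹' Ioo 0 1) (fun y (hy : ℓ y ∈ Ioo (0 : ℝ) 1) ↦ ?_) ?_⟩
  · exact Ioo_subset_Icc_self hy
  · rw [(isOpen_Ioo.preimage ℓ.continuous).interior_eq]
    simp only [mem_preimage, map_smul, he]
    norm_num

theorem nonempty_interior_halfSpace (he : ℓ e = 1) : (interior (halfSpace ℓ)).Nonempty :=
  (nonempty_interior_slab he).mono (interior_mono slab_subset_halfSpace)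

theorem uniqueDiffOn_halfSpace (he : ℓ e = 1) : UniqueDiffOn ℝ (halfSpace ℓ) :=
  uniqueDiffOn_convex convex_halfSpace (nonempty_interior_halfSpace he)

theorem uniqueDiffOn_slab (he : ℓ e = 1) : UniqueDiffOn ℝ (slab ℓ) :=
  uniqueDiffOn_convex convex_slab (nonempty_interior_slab he)

/-- The map moving the value of `ℓ` along the direction `e` according to the function `c`. -/
def adjustAlong (ℓ : E →L[ℝ] ℝ) (e : E) (c : ℝ → ℝ) (y : E) : E := y + (c (ℓ y) - ℓ y) • e

theorem apply_adjustAlong (he : ℓ e = 1) (c : ℝ → ℝ) (y : E) :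
    ℓ (adjustAlong ℓ e c y) = c (ℓ y) := by
  simp [adjustAlong, he]

theorem adjustAlong_of_eq {c : ℝ → ℝ} {y : E} (h : c (ℓ y) = ℓ y) : adjustAlong ℓ e c y = y := by
  simp [adjustAlong, h]

theorem exists_lipschitzWith_adjustAlong {c : ℝ → ℝ} {k : ℝ≥0} (hc : LipschitzWith k c) :
    ∃ R, LipschitzWith R (adjustAlong ℓ e c) := by
  have h1 := (hc.comp ℓ.lipschitz).sub ℓ.lipschitz
  have h2 := (ContinuousLinearMap.toSpanSingleton ℝ e).lipschitz.comp h1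
  exact ⟨_, LipschitzWith.id.add h2⟩

theorem lipschitzWith_projIcc_coe :
    LipschitzWith 1 (fun t : ℝ ↦ (projIcc (0 : ℝ) 1 zero_le_one t : ℝ)) := by
  simpa [Function.comp_def] using (LipschitzWith.subtype_val (Icc (0 : ℝ) 1)).comp
    (LipschitzWith.projIcc (zero_le_one (α := ℝ)))

end HalfSpace

/-! ### A transport equation near the boundary -/

section Transport

variable {E : Type*} [NormedAddCommGroup E] [NormedSpace ℝ E] [FiniteDimensional ℝ E]
  {ℓ : E →L[ℝ] ℝ} {e : E}

/-- The equation `(e + V) u = g` with a field `V` tangent to the level sets of `ℓ` is solved, with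
`u = 0` on the boundary, by integrating `g` along the characteristics. The characteristic through
`y` is parametrized by the unit interval, so that it reaches the boundary at time one, and written
as `η - t ℓ(y) e`, where `η` stays on the level set of `y`. -/
theorem exists_transport (he : ℓ e = 1) {V : ℝ × E → E} {g : ℝ × E → ℝ} {Q : Set E}
    (hV : ContDiffOn ℝ ∞ V (Icc 0 1 ×ˢ halfSpace ℓ))
    (hVℓ : ∀ τ ∈ Icc (0 : ℝ) 1, ∀ y ∈ halfSpace ℓ, ℓ (V (τ, y)) = 0) (hQ : IsCompact Q)
    (hVQ : ∀ τ ∈ Icc (0 : ℝ) 1, ∀ y ∈ halfSpace ℓ, y ∉ Q → V (τ, y) = 0)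
    (hg : ContDiffOn ℝ ∞ g (Icc 0 1 ×ˢ halfSpace ℓ))
    (hgQ : ∀ τ ∈ Icc (0 : ℝ) 1, ∀ y ∈ halfSpace ℓ, y ∉ Q → g (τ, y) = 0) :
    ∃ u : ℝ × E → ℝ, ContDiffOn ℝ ∞ u (Icc 0 1 ×ˢ slab ℓ) ∧
      (∀ τ ∈ Icc (0 : ℝ) 1, ∀ y ∈ slab ℓ, ℓ y = 0 → u (τ, y) = 0) ∧
      (∃ M : ℝ, 0 ≤ M ∧ ∀ τ ∈ Icc (0 : ℝ) 1, ∀ y ∈ slab ℓ,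
        (∀ z ∈ halfSpace ℓ, ‖z - y‖ ≤ M * ℓ y → g (τ, z) = 0) → u (τ, y) = 0) ∧
      ∀ τ ∈ Icc (0 : ℝ) 1, ∀ y ∈ slab ℓ,
        spatialFDerivWithin u (slab ℓ) (τ, y) (e + V (τ, y)) = g (τ, y) := by
  set C : Set (ℝ × E) := Icc (0 : ℝ) 1 ×ˢ slab ℓ with hCdef
  have hCconv : Convex ℝ C := (convex_Icc 0 1).prod convex_slab
  have hCclosed : IsClosed C := isClosed_Icc.prod isClosed_slab
  have hCu : UniqueDiffOn ℝ C := (uniqueDiffOn_Icc zero_lt_one).prod (uniqueDiffOn_slab he)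
  obtain ⟨R, hR⟩ := exists_lipschitzWith_adjustAlong (ℓ := ℓ) (e := e) lipschitzWith_projIcc_coe
  -- position on the characteristic at time `t`
  let pos : ℝ × ℝ × E → ℝ × E := fun p ↦ (p.2.1, p.2.2 - (p.1 * ℓ p.2.2) • e)
  have hpos : ContDiff ℝ ∞ pos := by fun_prop
  have hposm : MapsTo pos (Icc 0 1 ×ˢ C) (Icc 0 1 ×ˢ halfSpace ℓ) := fun p hp ↦ by
    refine ⟨hp.2.1, ?_⟩
    have h1 := hp.1.2
    have h2 := hp.2.2.1
    simp only [halfSpace, mem_ofPred_eq, pos, map_sub, map_smul, he, smul_eq_mul, mul_one]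
    nlinarith
  let f : ℝ × ℝ × E → ℝ × E := fun p ↦ (0, -(ℓ p.2.2) • V (pos p))
  let h : ℝ × ℝ × E → ℝ := fun p ↦ ℓ p.2.2 * g (pos p)
  have hf : ContDiffOn ℝ ∞ f (Icc 0 1 ×ˢ C) :=
    contDiffOn_const.prodMk ((by fun_prop : ContDiffOn ℝ ∞ (fun p : ℝ × ℝ × E ↦ -(ℓ p.2.2))
      (Icc 0 1 ×ˢ C)).smul (hV.comp hpos.contDiffOn hposm))
  have hh : ContDiffOn ℝ ∞ h (Icc 0 1 ×ˢ C) :=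
    (by fun_prop : ContDiffOn ℝ ∞ (fun p : ℝ × ℝ × E ↦ ℓ p.2.2) (Icc 0 1 ×ˢ C)).mul
      (hg.comp hpos.contDiffOn hposm)
  have hℓf : ∀ p ∈ Icc (0 : ℝ) 1 ×ˢ C, ℓ (f p).2 = 0 := fun p hp ↦ by
    simp [f, hVℓ _ (hposm hp).1 _ (hposm hp).2]
  -- the points whose characteristic meets `Q` form a compact set
  let Q' : Set (ℝ × E) := Icc (0 : ℝ) 1 ×ˢ ((fun q : E × ℝ ↦ q.1 + q.2 • e) '' (Q ×ˢ Icc 0 1))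
  have hQ' : IsCompact Q' :=
    isCompact_Icc.prod ((hQ.prod isCompact_Icc).image (by fun_prop))
  have hzero : ∀ t ∈ Icc (0 : ℝ) 1, ∀ q ∈ C, q ∉ Q' → (f (t, q), h (t, q)) = 0 := fun t ht q hq hqQ ↦ by
    have hp := hposm (show (t, q) ∈ Icc (0 : ℝ) 1 ×ˢ C from ⟨ht, hq⟩)
    have hn : (pos (t, q)).2 ∉ Q := fun hmem ↦ hqQ ⟨hq.1, ⟨((pos (t, q)).2, t * ℓ q.2),
      ⟨hmem, mul_nonneg ht.1 hq.2.1, mul_le_one₀ ht.2 hq.2.1 hq.2.2⟩, by simp [pos]⟩⟩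
    have e1 := hVQ _ hp.1 _ hp.2 hn
    have e2 := hgQ _ hp.1 _ hp.2 hn
    simp only [Prod.mk.eta] at e1 e2
    simp [f, h, e1, e2]
  obtain ⟨L, K, hL, hK⟩ := exists_bound_and_lipschitzOnWith_of_eq_zero hCconv hCclosed hCu hQ'
    (hf.prodMk hh) hzero
  let r : ℝ × E → ℝ × E := fun q ↦ ((projIcc (0 : ℝ) 1 zero_le_one q.1 : ℝ),
    adjustAlong ℓ e (fun t : ℝ ↦ (projIcc (0 : ℝ) 1 zero_le_one t : ℝ)) q.2)
  have hrC : ∀ q, r q ∈ C := fun q ↦ ⟨Subtype.prop _, by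
    simp only [slab, mem_ofPred_eq, r, apply_adjustAlong he]
    exact Subtype.prop _⟩
  have hrid : ∀ q ∈ C, r q = q := fun q hq ↦ Prod.ext (by simp [r, projIcc_of_mem _ hq.1])
    (adjustAlong_of_eq (c := fun t : ℝ ↦ (projIcc (0 : ℝ) 1 zero_le_one t : ℝ)) (by
      have : ℓ q.2 ∈ Icc (0 : ℝ) 1 := hq.2
      simp only [projIcc_of_mem zero_le_one this]))
  -- both the parameter and the level of `ℓ` are conserved
  have hconst : ∀ α : ℝ → ℝ × E,
      (∀ t ∈ Icc (0 : ℝ) 1, ∃ q ∈ C, HasDerivWithinAt α (f (t, q)) (Icc 0 1) t) →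
      ∀ t ∈ Icc (0 : ℝ) 1, (α t).1 = (α 0).1 ∧ ℓ (α t).2 = ℓ (α 0).2 := fun α hα t ht ↦ by
    have d1 : ∀ t ∈ Icc (0 : ℝ) 1, HasDerivWithinAt (fun t ↦ (α t).1 - (α 0).1) 0 (Icc 0 1) t :=
      fun t ht ↦ by
        obtain ⟨q, hq, hd⟩ := hα t ht
        exact hd.prod_fst.sub_const _
    have d2 : ∀ t ∈ Icc (0 : ℝ) 1, HasDerivWithinAt (fun t ↦ ℓ (α t).2 - ℓ (α 0).2) 0 (Icc 0 1) t :=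
      fun t ht ↦ by
        obtain ⟨q, hq, hd⟩ := hα t ht
        have := (ℓ.hasFDerivAt.comp_hasDerivWithinAt t hd.prod_snd).sub_const (ℓ (α 0).2)
        rwa [hℓf (t, q) ⟨ht, hq⟩] at this
    have b1 := norm_le_add_mul_exp_of_deriv le_rfl le_rfl le_rfl d1 (by simp) (by simp) t ht
    have b2 := norm_le_add_mul_exp_of_deriv le_rfl le_rfl le_rfl d2 (by simp) (by simp) t ht
    simp only [add_zero, zero_mul, norm_le_zero_iff, sub_eq_zero] at b1 b2
    exact ⟨b1, b2⟩
  obtain ⟨φ, S, hφ, hS, hφC, hφ0, hS0, hφd, hSd⟩ := exists_contDiffOn_flow_and_integral hCconv hCu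
    ((lipschitzWith_projIcc_coe.comp LipschitzWith.prod_fst).prodMk
      (hR.comp LipschitzWith.prod_snd)) hrC hrid hf hh hL hK (fun α hα0 hα t ht ↦ by
      obtain ⟨h1, h2⟩ := hconst α (fun t ht ↦ ⟨_, hrC _, hα t ht⟩) t ht
      exact ⟨by rw [h1]; exact hα0.1, by simp only [slab, mem_ofPred_eq, h2]; exact hα0.2⟩)
  have hcons : ∀ q ∈ C, ∀ t ∈ Icc (0 : ℝ) 1, (φ (t, q)).1 = q.1 ∧ ℓ (φ (t, q)).2 = ℓ q.2 :=
    fun q hq t ht ↦ by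
      have := hconst (fun t ↦ φ (t, q)) (fun t ht ↦
        ⟨_, hφC (show (t, q) ∈ Icc (0 : ℝ) 1 ×ˢ C from ⟨ht, hq⟩), hφd q hq t ht⟩) t ht
      simpa only [hφ0 q hq] using this
  have hSzero : ∀ q ∈ C, (∀ t ∈ Icc (0 : ℝ) 1, h (t, φ (t, q)) = 0) → S (1, q) = 0 :=
    fun q hq hz ↦ by
      have := norm_le_add_mul_exp_of_deriv le_rfl le_rfl le_rfl (hSd q hq) (by simp [hS0 q hq])
        (fun t ht ↦ by simp [hz t ht]) 1 (by simp)
      simpa using this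
  have hu : ContDiffOn ℝ ∞ (fun q ↦ S (1, q)) C :=
    hS.comp (f := fun q : ℝ × E ↦ ((1 : ℝ), q)) (by fun_prop) fun q hq ↦ ⟨by simp, hq⟩
  obtain ⟨Lv, -, hLv, -⟩ := exists_bound_and_lipschitzOnWith_of_eq_zero convex_halfSpace
    isClosed_halfSpace (uniqueDiffOn_halfSpace he) hQ hV hVQ
  refine ⟨fun q ↦ S (1, q), hu, fun τ hτ y hy h0 ↦ hSzero (τ, y) ⟨hτ, hy⟩ fun t ht ↦ ?_,
    ⟨Lv * Real.exp 1 + ‖e‖, by positivity, fun τ hτ y hy hz ↦ hSzero (τ, y) ⟨hτ, hy⟩ fun t ht ↦ ?_⟩,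
    ?_⟩
  · simp [h, (hcons (τ, y) ⟨hτ, hy⟩ t ht).2, h0]
  · obtain ⟨h1, h2⟩ := hcons (τ, y) ⟨hτ, hy⟩ t ht
    have hy0 : 0 ≤ ℓ y := hy.1
    have hp : ∀ t ∈ Icc (0 : ℝ) 1, pos (t, φ (t, (τ, y))) ∈ Icc (0 : ℝ) 1 ×ˢ halfSpace ℓ :=
      fun t ht ↦ hposm (show (t, φ (t, (τ, y))) ∈ Icc (0 : ℝ) 1 ×ˢ C from
        ⟨ht, hφC (show (t, (τ, y)) ∈ Icc (0 : ℝ) 1 ×ˢ C from ⟨ht, hτ, hy⟩)⟩)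
    have hb := norm_le_add_mul_exp_of_deriv le_rfl le_rfl (mul_nonneg hy0 Lv.coe_nonneg)
      (fun t ht ↦ (hφd (τ, y) ⟨hτ, hy⟩ t ht).prod_snd.sub_const y)
      (by simp [hφ0 (τ, y) ⟨hτ, hy⟩]) (fun t ht ↦ by
        have hv := hLv _ (hp t ht).1 _ (hp t ht).2
        simp only [f, (hcons (τ, y) ⟨hτ, hy⟩ t ht).2, norm_smul, norm_neg,
          Real.norm_of_nonneg hy0]
        have := mul_le_mul_of_nonneg_left hv hy0
        have h3 : 0 ≤ ‖(φ (t, τ, y)).2 - y‖ := norm_nonneg _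
        change ℓ y * ‖V (pos (t, φ (t, τ, y)))‖ ≤ _
        change ℓ y * ‖V (pos (t, φ (t, τ, y)))‖ ≤ ℓ y * Lv at this
        simpa using by linarith) t ht
    have hgz := hz (pos (t, φ (t, (τ, y)))).2 (hp t ht).2 (by
      have e1 : (pos (t, φ (t, (τ, y)))).2 - y = ((φ (t, (τ, y))).2 - y) - (t * ℓ y) • e := by
        simp only [pos, h2]
        abel
      rw [e1]
      refine (norm_sub_le _ _).trans ?_
      rw [norm_smul, Real.norm_of_nonneg (mul_nonneg ht.1 hy0)]
      have : t * ℓ y * ‖e‖ ≤ 1 * ℓ y * ‖e‖ :=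
        mul_le_mul_of_nonneg_right (mul_le_mul_of_nonneg_right ht.2 hy0) (norm_nonneg _)
      simp only [zero_add] at hb
      linarith)
    have e2 : pos (t, φ (t, (τ, y))) = (τ, (pos (t, φ (t, (τ, y)))).2) :=
      Prod.ext (by simp [pos, h1]) rfl
    simp only [h]
    rw [e2, hgz, mul_zero]
  -- the characteristic through a point of a characteristic is a piece of the latter
  have hsemi : ∀ q ∈ C, ∀ σ ∈ Icc (0 : ℝ) 1,
      S (1, pos (σ, φ (σ, q))) = S (1, q) - S (σ, q) := fun q hq σ hσ ↦ by
    have hs : ∀ μ ∈ Icc (0 : ℝ) 1, σ + (1 - σ) * μ ∈ Icc (0 : ℝ) 1 := fun μ hμ ↦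
      ⟨by nlinarith [hσ.1, hσ.2, hμ.1], by nlinarith [hσ.1, hσ.2, hμ.2]⟩
    have hsd : ∀ μ, HasDerivWithinAt (fun μ : ℝ ↦ σ + (1 - σ) * μ) (1 - σ) (Icc 0 1) μ := fun μ ↦ by
      simpa using ((hasDerivWithinAt_id μ (Icc 0 1)).const_mul (1 - σ)).const_add σ
    have hy0 : 0 ≤ ℓ q.2 := hq.2.1
    let β : ℝ → ℝ × E := fun μ ↦ φ (σ + (1 - σ) * μ, q) - (0, (σ * ℓ q.2) • e)
    have hβℓ : ∀ μ ∈ Icc (0 : ℝ) 1, ℓ (β μ).2 = (1 - σ) * ℓ q.2 := fun μ hμ ↦ by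
      simp only [β, Prod.snd_sub, map_sub, (hcons q hq _ (hs μ hμ)).2, map_smul, he, smul_eq_mul]
      ring
    have hβC : ∀ μ ∈ Icc (0 : ℝ) 1, β μ ∈ C := fun μ hμ ↦ by
      refine ⟨?_, ?_⟩
      · simp only [β, Prod.fst_sub, (hcons q hq _ (hs μ hμ)).1, sub_zero]
        exact hq.1
      · have h1 : ℓ q.2 ≤ 1 := hq.2.2
        simp only [slab, mem_ofPred_eq, hβℓ μ hμ]
        exact ⟨mul_nonneg (by linarith [hσ.2]) hy0, mul_le_one₀ (by linarith [hσ.1]) hy0 h1⟩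
    have hβpos : ∀ μ ∈ Icc (0 : ℝ) 1,
        pos (μ, β μ) = pos (σ + (1 - σ) * μ, φ (σ + (1 - σ) * μ, q)) := fun μ hμ ↦ by
      refine Prod.ext (by simp [pos, β]) ?_
      simp only [pos, hβℓ μ hμ, (hcons q hq _ (hs μ hμ)).2]
      simp only [β, Prod.snd_sub, sub_sub, ← add_smul]
      congr 2
      ring
    have hβf : ∀ μ ∈ Icc (0 : ℝ) 1, f (μ, β μ) =
        (1 - σ) • f (σ + (1 - σ) * μ, φ (σ + (1 - σ) * μ, q)) := fun μ hμ ↦ by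
      simp only [f, hβpos μ hμ, hβℓ μ hμ, (hcons q hq _ (hs μ hμ)).2, Prod.smul_mk, smul_zero,
        smul_smul]
      congr 2
      ring
    have hβh : ∀ μ ∈ Icc (0 : ℝ) 1, h (μ, β μ) =
        (1 - σ) • h (σ + (1 - σ) * μ, φ (σ + (1 - σ) * μ, q)) := fun μ hμ ↦ by
      simp only [h, hβpos μ hμ, hβℓ μ hμ, (hcons q hq _ (hs μ hμ)).2, smul_eq_mul]
      ring
    have hβ0 : β 0 = pos (σ, φ (σ, q)) := by
      refine Prod.ext (by simp [β, pos]) ?_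
      simp [β, pos, (hcons q hq σ hσ).2]
    have hq' : pos (σ, φ (σ, q)) ∈ C := hβ0 ▸ hβC 0 (by simp)
    have heq : EqOn (fun μ ↦ φ (μ, pos (σ, φ (σ, q)))) β (Icc 0 1) :=
      eqOn_of_hasDerivWithinAt_of_lipschitzOnWith (f := f)
        (fun t ht ↦ LipschitzWith.prod_fst.comp_lipschitzOnWith (hK t ht))
        (hφd _ hq') (fun μ hμ ↦ by
          rw [hβf μ hμ]
          exact (((hφd q hq _ (hs μ hμ)).scomp μ (hsd μ) hs).sub_const _))
        (fun t ht ↦ hφC (show (t, pos (σ, φ (σ, q))) ∈ Icc (0 : ℝ) 1 ×ˢ C from ⟨ht, hq'⟩)) hβC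
        (t₀ := 0) (by simp) (by simp only [hφ0 _ hq', hβ0])
    have hd := norm_le_add_mul_exp_of_deriv le_rfl le_rfl le_rfl (fun μ hμ ↦
      (hSd _ hq' μ hμ).fun_sub (((hSd q hq _ (hs μ hμ)).scomp μ (hsd μ) hs).sub_const (S (σ, q))))
      (by simp [hS0 _ hq']) (fun μ hμ ↦ by
        have := heq hμ
        simp only at this
        rw [this, hβh μ hμ, sub_self, norm_zero]
        positivity) 1 (by simp)
    simp only [Function.comp_apply, mul_one, add_sub_cancel, add_zero, zero_mul,
      norm_le_zero_iff] at hd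
    linarith
  intro τ hτ
  have hDc : ContinuousOn (fun y ↦ spatialFDerivWithin (fun q ↦ S (1, q)) (slab ℓ) (τ, y)
      (e + V (τ, y))) (slab ℓ) := by
    have h1 := (contDiffOn_spatialFDerivWithin (k := 0) (uniqueDiffOn_slab he)
      (hu.of_le (by simp))).continuousOn
    refine (h1.comp (f := fun y : E ↦ (τ, y)) (by fun_prop) fun y hy ↦ ⟨hτ, hy⟩).clm_apply ?_
    exact continuousOn_const.add (hV.continuousOn.comp (f := fun y : E ↦ (τ, y)) (by fun_prop)
      fun y hy ↦ ⟨hτ, hy.1⟩)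
  have hgc : ContinuousOn (fun y ↦ g (τ, y)) (slab ℓ) :=
    hg.continuousOn.comp (f := fun y : E ↦ (τ, y)) (by fun_prop) fun y hy ↦ ⟨hτ, hy.1⟩
  refine EqOn.of_subset_closure (s := slab ℓ ∩ {y | 0 < ℓ y}) ?_ hDc hgc inter_subset_left ?_
  · rintro y ⟨hy, hypos : 0 < ℓ y⟩
    have hq : (τ, y) ∈ C := ⟨hτ, hy⟩
    have hI : (0 : ℝ) ∈ Icc (0 : ℝ) 1 := by simp
    have hD := hasFDerivWithinAt_spatialFDerivWithin (hu.differentiableOn (by simp)) hτ hy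
    -- the characteristic leaves `y` with velocity `-ℓ(y) (e + V)`
    have hcd : HasDerivWithinAt (fun σ ↦ (φ (σ, (τ, y))).2 - (σ * ℓ y) • e)
        (-(ℓ y) • (e + V (τ, y))) (Icc 0 1) 0 := by
      have h1 := (hφd _ hq 0 hI).prod_snd
      have h2 : HasDerivWithinAt (fun σ : ℝ ↦ (σ * ℓ y) • e) (ℓ y • e) (Icc 0 1) 0 := by
        simpa using ((hasDerivWithinAt_id (0 : ℝ) (Icc 0 1)).mul_const (ℓ y)).smul_const e
      have h3 := h1.fun_sub h2
      convert h3 using 1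
      simp only [f, pos, hφ0 _ hq, zero_mul, zero_smul, sub_zero, smul_add, neg_smul]
      abel
    have hcurve : ∀ σ ∈ Icc (0 : ℝ) 1,
        pos (σ, φ (σ, (τ, y))) = (τ, (φ (σ, (τ, y))).2 - (σ * ℓ y) • e) := fun σ hσ ↦ by
      simp [pos, hcons _ hq σ hσ]
    have hmem : MapsTo (fun σ ↦ (φ (σ, (τ, y))).2 - (σ * ℓ y) • e) (Icc 0 1) (slab ℓ) :=
      fun σ hσ ↦ by
        have h1 : ℓ y ≤ 1 := hy.2
        simp only [slab, mem_ofPred_eq, map_sub, (hcons _ hq σ hσ).2, map_smul, he, smul_eq_mul,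
          mul_one]
        constructor <;> nlinarith [hσ.1, hσ.2]
    have e0 : (φ ((0 : ℝ), (τ, y))).2 - ((0 : ℝ) * ℓ y) • e = y := by simp [hφ0 _ hq]
    have d1 := HasFDerivWithinAt.comp_hasDerivWithinAt (t := slab ℓ) (l := fun z ↦ S (1, (τ, z)))
      (l' := spatialFDerivWithin (fun q ↦ S (1, q)) (slab ℓ) (τ, y)) (0 : ℝ)
      (by rw [e0]; exact hD) hcd hmem
    have d2 := ((hSd _ hq 0 hI).const_sub (S (1, (τ, y))))
    have d3 : HasDerivWithinAt (fun σ ↦ S (1, (τ, y)) - S (σ, (τ, y)))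
        (spatialFDerivWithin (fun q ↦ S (1, q)) (slab ℓ) (τ, y) (-(ℓ y) • (e + V (τ, y))))
        (Icc 0 1) 0 :=
      d1.congr_of_mem (fun σ hσ ↦ by
        rw [← hsemi _ hq σ hσ, hcurve σ hσ, Function.comp_apply]) hI
    have := (uniqueDiffOn_Icc (zero_lt_one (α := ℝ)) 0 hI).eq_deriv _ d2 d3
    simp only [hφ0 _ hq, h, pos, zero_mul, zero_smul, sub_zero, map_smul, smul_eq_mul] at this
    have h4 : ℓ y * g (τ, y) = ℓ y * spatialFDerivWithin (fun q ↦ S (1, q)) (slab ℓ) (τ, y)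
      (e + V (τ, y)) := by linarith
    exact (mul_left_cancel₀ hypos.ne' h4).symm
  · intro y hy
    rcases hy.1.eq_or_lt with h0 | h0
    · have := map_mem_closure (f := fun s : ℝ ↦ y + s • e) (s := Ioc 0 1) (x := 0)
        (t := slab ℓ ∩ {y | 0 < ℓ y}) (by fun_prop)
        (by rw [closure_Ioc zero_ne_one]; simp) fun s hs ↦ by
          simp only [slab, mem_inter_iff, mem_ofPred_eq, map_add, map_smul, he, ← h0, smul_eq_mul,
            mul_one, zero_add]
          exact ⟨⟨hs.1.le, hs.2⟩, hs.1⟩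
      simpa using this
    · exact subset_closure ⟨hy, h0⟩

end Transport

/-! ### Cutoffs and extension by zero -/

theorem IsCompact.exists_contDiff_cutoff {E : Type*} [NormedAddCommGroup E] [NormedSpace ℝ E]
    [FiniteDimensional ℝ E] {K O : Set E} (hK : IsCompact K) (hO : IsOpen O) (hKO : K ⊆ O) :
    ∃ (κ : E → ℝ) (Q : Set E), ContDiff ℝ ∞ κ ∧ IsCompact Q ∧ Q ⊆ O ∧
      (∀ᶠ y in 𝓝ˢ K, κ y = 1) ∧ (∀ y ∉ Q, κ y = 0) ∧ ∀ y, κ y ∈ Icc (0 : ℝ) 1 := by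
  obtain ⟨Q, hQ, hKQ, hQO⟩ := exists_compact_between hK hO hKO
  obtain ⟨κ, h1, h0, h01⟩ := exists_contMDiffMap_one_nhds_of_subset_interior 𝓘(ℝ, E) (n := ⊤)
    hK.isClosed hKQ
  exact ⟨κ, Q, κ.contMDiff.contDiff, hQ, hQO, h1, h0, h01⟩

theorem exists_contDiff_step {a b : ℝ} (hab : a < b) :
    ∃ χ : ℝ → ℝ, ContDiff ℝ ∞ χ ∧ (∀ t ≤ a, χ t = 1) ∧ ∀ t, b ≤ t → χ t = 0 := by
  refine ⟨fun t ↦ Real.smoothTransition ((b - t) / (b - a)),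
    Real.smoothTransition.contDiff.comp (by fun_prop), fun t ht ↦ ?_, fun t ht ↦ ?_⟩
  · exact Real.smoothTransition.one_of_one_le (by rw [le_div_iff₀ (by linarith)]; linarith)
  · exact Real.smoothTransition.zero_of_nonpos (div_nonpos_of_nonpos_of_nonneg (by linarith)
      (by linarith))

/-- A function which is smooth on an open part of `S` and vanishes off a closed subset of that part
is smooth on `S`. -/
theorem ContDiffOn.of_eq_zero {E G : Type*} [NormedAddCommGroup E] [NormedSpace ℝ E]
    [NormedAddCommGroup G] [NormedSpace ℝ G] {n : WithTop ℕ∞} {f : E → G} {S A C : Set E}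
    (hf : ContDiffOn ℝ n f (S ∩ A)) (hA : IsOpen A) (hC : IsClosed C) (hCA : C ⊆ A)
    (h : ∀ x ∈ S, x ∉ C → f x = 0) : ContDiffOn ℝ n f S := fun x hx ↦ by
  by_cases hxC : x ∈ C
  · exact (hf x ⟨hx, hCA hxC⟩).mono_of_mem_nhdsWithin
      (inter_mem_nhdsWithin S (hA.mem_nhds (hCA hxC)))
  · refine (contDiffWithinAt_const (c := (0 : G))).congr_of_eventuallyEq ?_ (h x hx hxC)
    filter_upwards [self_mem_nhdsWithin,
      mem_nhdsWithin_of_mem_nhds (hC.isOpen_compl.mem_nhds hxC)] with z hz hzC using h z hz hzC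

theorem contDiffOn_Icc_prod_of_eq_zero {E G : Type*} [NormedAddCommGroup E] [NormedSpace ℝ E]
    [NormedAddCommGroup G] [NormedSpace ℝ G] {n : WithTop ℕ∞} {f : ℝ × E → G} {S O Q : Set E}
    (hO : IsOpen O) (hQ : IsClosed Q) (hQO : Q ⊆ O) (hf : ContDiffOn ℝ n f (Icc 0 1 ×ˢ (S ∩ O)))
    (h0 : ∀ p ∈ Icc (0 : ℝ) 1 ×ˢ S, p.2 ∉ Q → f p = 0) : ContDiffOn ℝ n f (Icc 0 1 ×ˢ S) := by
  refine ContDiffOn.of_eq_zero (A := univ ×ˢ O) (C := univ ×ˢ Q) ?_ (isOpen_univ.prod hO)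
    (isClosed_univ.prod hQ) (prod_mono_right hQO) fun p hp h ↦ h0 p hp fun h' ↦ h ⟨mem_univ _, h'⟩
  rwa [prod_inter_prod, inter_univ]

/-! ### Solving the transport equation with a zeroth order term -/

section Hamiltonian

variable {E : Type*} [NormedAddCommGroup E] [NormedSpace ℝ E] [FiniteDimensional ℝ E]
  {ℓ : E →L[ℝ] ℝ} {e : E}

theorem spatialFDerivWithin_eq {G : Type*} [NormedAddCommGroup G] [NormedSpace ℝ G]
    {f : ℝ × E → G} {C : Set E} {t : ℝ} {y : E} {f' : E →L[ℝ] G}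
    (hC : UniqueDiffOn ℝ C)
    (hf : DifferentiableOn ℝ f (Icc 0 1 ×ˢ C)) (ht : t ∈ Icc (0 : ℝ) 1) (hy : y ∈ C)
    (h : HasFDerivWithinAt (fun z ↦ f (t, z)) f' C y) : spatialFDerivWithin f C (t, y) = f' :=
  (hC y hy).eq (hasFDerivWithinAt_spatialFDerivWithin hf ht hy) h

theorem slab_mem_nhdsWithin {y : E} (h : ℓ y < 1) : slab ℓ ∈ 𝓝[halfSpace ℓ] y := by
  have : {z : E | ℓ z < 1} ∈ 𝓝 y := (isOpen_lt ℓ.continuous continuous_const).mem_nhds h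
  filter_upwards [self_mem_nhdsWithin, mem_nhdsWithin_of_mem_nhds this] with z h1 h2
    using ⟨h1, le_of_lt h2⟩

/-- A function vanishing on the boundary, with prescribed derivative zero along one transverse
direction, has zero derivative at the boundary. -/
theorem spatialFDerivWithin_eq_zero_of_boundary {K : ℝ × E → ℝ}
    (hK : DifferentiableOn ℝ K (Icc 0 1 ×ˢ halfSpace ℓ))
    (h0 : ∀ τ ∈ Icc (0 : ℝ) 1, ∀ y, ℓ y = 0 → K (τ, y) = 0) {τ : ℝ} (hτ : τ ∈ Icc (0 : ℝ) 1) {y z : E}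
    (hy : ℓ y = 0) (hz : ℓ z ≠ 0) (h : spatialFDerivWithin K (halfSpace ℓ) (τ, y) z = 0) :
    spatialFDerivWithin K (halfSpace ℓ) (τ, y) = 0 := by
  have hyH : y ∈ halfSpace ℓ := hy.ge
  have hD := hasFDerivWithinAt_spatialFDerivWithin hK hτ hyH
  have htan : ∀ w, ℓ w = 0 → spatialFDerivWithin K (halfSpace ℓ) (τ, y) w = 0 := fun w hw ↦ by
    have h1 : HasDerivAt (fun s : ℝ ↦ y + s • w) w 0 := by
      simpa using ((hasDerivAt_id (0 : ℝ)).smul_const w).const_add y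
    have h2 := HasFDerivWithinAt.comp_hasDerivAt_of_eq (0 : ℝ) (f := fun s : ℝ ↦ y + s • w) hD h1
      (Eventually.of_forall fun s ↦ by simp [halfSpace, hy, hw]) (by simp)
    have h3 : (fun z ↦ K (τ, z)) ∘ (fun s : ℝ ↦ y + s • w) = fun _ ↦ (0 : ℝ) := by
      funext s
      exact h0 τ hτ _ (by simp [hy, hw])
    rw [h3] at h2
    exact h2.unique (hasDerivAt_const _ _)
  ext w
  have h4 := htan (w - (ℓ w / ℓ z) • z) (by simp [hz])
  simpa [h] using h4

/-- For a field `Z` pointing out of the half-space, `Z K = K + G` is solved near the boundary by a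
function `K` vanishing to first order on the boundary. Writing `Z = ℓ(Z) (e + V)`, one solves
`(e + V) B = 1 / ℓ(Z)` and then `(e + V) u = exp (-B) G / ℓ(Z)`, and takes `K = exp B · u`. -/
theorem exists_solution_of_outward (he : ℓ e = 1) {O C : Set E} (hO : IsOpen O)
    {Z : ℝ × E → E} (hZ : ContDiffOn ℝ ∞ Z (Icc 0 1 ×ˢ (halfSpace ℓ ∩ O)))
    (hZℓ : ∀ τ ∈ Icc (0 : ℝ) 1, ∀ y ∈ halfSpace ℓ ∩ O, ℓ (Z (τ, y)) < 0)
    {G : E → ℝ} (hG : ContDiffOn ℝ ∞ G (halfSpace ℓ)) (hC : IsCompact C) (hCO : C ⊆ O)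
    (hGC : ∀ y ∈ halfSpace ℓ, y ∉ C → G y = 0) (hG0 : ∀ y, ℓ y = 0 → G y = 0) :
    ∃ (K : ℝ × E → ℝ) (Q : Set E) (δ : ℝ), ContDiffOn ℝ ∞ K (Icc 0 1 ×ˢ halfSpace ℓ) ∧
      IsCompact Q ∧ Q ⊆ O ∧ 0 < δ ∧
      (∀ τ ∈ Icc (0 : ℝ) 1, ∀ y ∈ halfSpace ℓ, y ∉ Q → K (τ, y) = 0) ∧
      (∀ τ ∈ Icc (0 : ℝ) 1, ∀ y, ℓ y = 0 →
        K (τ, y) = 0 ∧ spatialFDerivWithin K (halfSpace ℓ) (τ, y) = 0) ∧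
      ∀ τ ∈ Icc (0 : ℝ) 1, ∀ y ∈ halfSpace ℓ ∩ O, ℓ y < δ →
        spatialFDerivWithin K (halfSpace ℓ) (τ, y) (Z (τ, y)) = K (τ, y) + G y := by
  classical
  obtain ⟨r, hr, hrO⟩ := hC.exists_cthickening_subset_open hO hCO
  set C1 := cthickening r C with hC1
  have hC1c : IsCompact C1 := hC.cthickening
  obtain ⟨κ, Q1, hκ, hQ1, hQ1O, hκ1, hκ0, -⟩ := hC1c.exists_contDiff_cutoff hO hrO
  have hκ1' : ∀ y ∈ C1, κ y = 1 := fun y hy ↦ hκ1.self_of_nhdsSet y hy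
  have hHu := uniqueDiffOn_halfSpace he
  have hSu := uniqueDiffOn_slab he
  have hκc : ContDiffOn ℝ ∞ (fun p : ℝ × E ↦ κ p.2) (Icc 0 1 ×ˢ (halfSpace ℓ ∩ O)) :=
    (hκ.comp contDiff_snd).contDiffOn
  have hℓZ : ContDiffOn ℝ ∞ (fun p : ℝ × E ↦ (ℓ (Z p))⁻¹) (Icc 0 1 ×ˢ (halfSpace ℓ ∩ O)) :=
    (ℓ.contDiff.comp_contDiffOn hZ).inv fun p hp ↦ (hZℓ _ hp.1 _ hp.2).ne
  let V : ℝ × E → E := fun p ↦ κ p.2 • ((ℓ (Z p))⁻¹ • Z p - e)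
  let b : ℝ × E → ℝ := fun p ↦ κ p.2 * (ℓ (Z p))⁻¹
  have hV : ContDiffOn ℝ ∞ V (Icc 0 1 ×ˢ halfSpace ℓ) :=
    contDiffOn_Icc_prod_of_eq_zero hO hQ1.isClosed hQ1O
      (hκc.smul ((hℓZ.smul hZ).sub contDiffOn_const)) fun p _ hp ↦ by simp [V, hκ0 _ hp]
  have hb : ContDiffOn ℝ ∞ b (Icc 0 1 ×ˢ halfSpace ℓ) :=
    contDiffOn_Icc_prod_of_eq_zero hO hQ1.isClosed hQ1O (hκc.mul hℓZ) fun p _ hp ↦ by simp [b, hκ0 _ hp]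
  have hVQ : ∀ τ ∈ Icc (0 : ℝ) 1, ∀ y ∈ halfSpace ℓ, y ∉ Q1 → V (τ, y) = 0 :=
    fun τ _ y _ hy ↦ by simp [V, hκ0 _ hy]
  have hVℓ : ∀ τ ∈ Icc (0 : ℝ) 1, ∀ y ∈ halfSpace ℓ, ℓ (V (τ, y)) = 0 := fun τ hτ y hy ↦ by
    by_cases hyQ : y ∈ Q1
    · have := (hZℓ τ hτ y ⟨hy, hQ1O hyQ⟩).ne
      simp [V, he, this]
    · simp [hVQ τ hτ y hy hyQ]
  -- `B` solves the equation with right-hand side `b`, which equals `1 / ℓ(Z)` on `C1`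
  obtain ⟨B, hB, -, -, hBeq⟩ := exists_transport he hV hVℓ hQ1 hVQ hb
    fun τ _ y _ hy ↦ by simp [b, hκ0 _ hy]
  obtain ⟨χ₀, hχ₀, hχ₀1, hχ₀0⟩ := exists_contDiff_step (show (1 / 2 : ℝ) < 3 / 4 by norm_num)
  have slabext : ∀ {f : ℝ × E → ℝ} {c : ℝ}, c < 1 → ContDiffOn ℝ ∞ f (Icc 0 1 ×ˢ slab ℓ) →
      (∀ p ∈ Icc (0 : ℝ) 1 ×ˢ halfSpace ℓ, c < ℓ p.2 → f p = 0) →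
      ContDiffOn ℝ ∞ f (Icc 0 1 ×ˢ halfSpace ℓ) := fun {f c} hc hf h0 ↦ by
    refine ContDiffOn.of_eq_zero (A := {p | ℓ p.2 < 1}) (C := {p | ℓ p.2 ≤ c})
      (hf.mono ?_) (isOpen_lt (by fun_prop) continuous_const)
      (isClosed_le (by fun_prop) continuous_const) (fun p hp ↦ lt_of_le_of_lt hp hc)
      fun p hp h ↦ h0 p hp (not_le.1 h)
    rintro p ⟨⟨hp1, hp2⟩, hp3⟩
    exact ⟨hp1, hp2, le_of_lt hp3⟩
  let g : ℝ × E → ℝ := fun p ↦ χ₀ (ℓ p.2) * (Real.exp (-B p) * (b p * G p.2))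
  have hGp : ContDiffOn ℝ ∞ (fun p : ℝ × E ↦ G p.2) (Icc (0 : ℝ) 1 ×ˢ halfSpace ℓ) :=
    hG.comp contDiffOn_snd fun p hp ↦ hp.2
  have hsub : Icc (0 : ℝ) 1 ×ˢ slab ℓ ⊆ Icc (0 : ℝ) 1 ×ˢ halfSpace ℓ :=
    prod_mono_right slab_subset_halfSpace
  have hg : ContDiffOn ℝ ∞ g (Icc 0 1 ×ˢ halfSpace ℓ) := by
    refine slabext (c := 3 / 4) (by norm_num) ?_ fun p _ hp ↦ by simp [g, hχ₀0 _ hp.le]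
    exact ((hχ₀.comp (ℓ.contDiff.comp contDiff_snd)).contDiffOn).mul
      (hB.neg.exp.mul ((hb.mul hGp).mono hsub))
  have hgC : ∀ τ ∈ Icc (0 : ℝ) 1, ∀ y ∈ halfSpace ℓ, y ∉ C → g (τ, y) = 0 := fun τ _ y hy hyC ↦ by
    simp [g, hGC y hy hyC]
  have hCQ1 : C ⊆ Q1 := fun y hy ↦ by
    by_contra h
    have := hκ1' y (self_subset_cthickening C hy)
    rw [hκ0 y h] at this
    exact zero_ne_one this
  obtain ⟨u, hu, hu0, ⟨M, hM, huM⟩, hueq⟩ := exists_transport he hV hVℓ hQ1 hVQ hg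
    fun τ hτ y hy hyQ ↦ hgC τ hτ y hy fun h ↦ hyQ (hCQ1 h)
  -- the cutoff `χ` keeps the support of the solution within distance `r` of `C`
  set d : ℝ := min (1 / 2) (r / (M + 1)) with hd
  have hdpos : 0 < d := lt_min (by norm_num) (by positivity)
  have hd1 : d ≤ 1 / 2 := min_le_left _ _
  have hdM : M * d ≤ r := by
    have h1 : d * (M + 1) ≤ r := (le_div_iff₀ (by positivity)).1 (min_le_right _ _)
    nlinarith
  obtain ⟨χ, hχ, hχ1, hχ0⟩ := exists_contDiff_step (show d / 2 < d by linarith)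
  let K : ℝ × E → ℝ := fun p ↦ χ (ℓ p.2) * (Real.exp (B p) * u p)
  have hK : ContDiffOn ℝ ∞ K (Icc 0 1 ×ˢ halfSpace ℓ) := by
    refine slabext (c := d) (by linarith) ?_ fun p _ hp ↦ by simp [K, hχ0 _ hp.le]
    exact ((hχ.comp (ℓ.contDiff.comp contDiff_snd)).contDiffOn).mul (hB.exp.mul hu)
  have hKC : ∀ τ ∈ Icc (0 : ℝ) 1, ∀ y ∈ halfSpace ℓ, y ∉ C1 → K (τ, y) = 0 := fun τ hτ y hy hyC ↦ by
    by_cases hyd : d ≤ ℓ y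
    · simp [K, hχ0 _ hyd]
    · have hys : y ∈ slab ℓ := ⟨hy, by linarith⟩
      have : u (τ, y) = 0 := huM τ hτ y hys fun z hz hzy ↦ hgC τ hτ z hz fun hzC ↦ by
        refine hyC (mem_cthickening_of_dist_le y z r C hzC ?_)
        rw [dist_comm, dist_eq_norm]
        have : M * ℓ y ≤ M * d := mul_le_mul_of_nonneg_left (by linarith) hM
        linarith
      simp [K, this]
  have hK0 : ∀ τ ∈ Icc (0 : ℝ) 1, ∀ y, ℓ y = 0 → K (τ, y) = 0 := fun τ hτ y hy ↦ by
    simp [K, hu0 τ hτ y ⟨hy.ge, by linarith⟩ hy]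
  have hKd : DifferentiableOn ℝ K (Icc 0 1 ×ˢ halfSpace ℓ) := hK.differentiableOn (by simp)
  have hKD0 : ∀ τ ∈ Icc (0 : ℝ) 1, ∀ y ∈ halfSpace ℓ, y ∉ C1 →
      spatialFDerivWithin K (halfSpace ℓ) (τ, y) = 0 := fun τ hτ y hy hyC ↦ by
    refine spatialFDerivWithin_eq hHu hKd hτ hy ?_
    refine (hasFDerivWithinAt_const (0 : ℝ) y _).congr_of_eventuallyEq ?_ (hKC τ hτ y hy hyC)
    filter_upwards [self_mem_nhdsWithin, mem_nhdsWithin_of_mem_nhds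
      (hC1c.isClosed.isOpen_compl.mem_nhds hyC)] with z hz hzC using hKC τ hτ z hz hzC
  have hmain : ∀ τ ∈ Icc (0 : ℝ) 1, ∀ y ∈ halfSpace ℓ ∩ O, ℓ y < d / 2 →
      spatialFDerivWithin K (halfSpace ℓ) (τ, y) (Z (τ, y)) = K (τ, y) + G y := by
    intro τ hτ y hy hyd
    by_cases hyC : y ∈ C1
    swap
    · have h2 : y ∉ C := fun h ↦ hyC (self_subset_cthickening C h)
      simp [hKD0 τ hτ y hy.1 hyC, hKC τ hτ y hy.1 hyC, hGC y hy.1 h2]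
    have hys : y ∈ slab ℓ := ⟨hy.1, by linarith⟩
    have hBd := hasFDerivWithinAt_spatialFDerivWithin (hB.differentiableOn (by simp)) hτ hys
    have hud := hasFDerivWithinAt_spatialFDerivWithin (hu.differentiableOn (by simp)) hτ hys
    have hKs : HasFDerivWithinAt (fun z ↦ K (τ, z))
        (Real.exp (B (τ, y)) • spatialFDerivWithin u (slab ℓ) (τ, y) +
          u (τ, y) • Real.exp (B (τ, y)) • spatialFDerivWithin B (slab ℓ) (τ, y)) (slab ℓ) y := by
      refine (hBd.exp.mul hud).congr_of_eventuallyEq ?_ ?_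
      · filter_upwards [mem_nhdsWithin_of_mem_nhds
          ((isOpen_lt ℓ.continuous continuous_const).mem_nhds hyd)] with z hz
        simp [K, hχ1 _ (le_of_lt hz)]
      · simp [K, hχ1 _ hyd.le]
    rw [spatialFDerivWithin_eq hHu hKd hτ hy.1
      (hKs.mono_of_mem_nhdsWithin (slab_mem_nhdsWithin (by linarith)))]
    have hne := (hZℓ τ hτ y hy).ne
    have hZe : Z (τ, y) = ℓ (Z (τ, y)) • (e + V (τ, y)) := by
      simp [V, hκ1' y hyC, smul_smul, hne]
    have e1 := hBeq τ hτ y hys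
    have e2 := hueq τ hτ y hys
    rw [hZe]
    simp only [map_smul, add_apply, smul_apply, e1, e2,
      smul_eq_mul]
    simp only [b, g, K, hκ1' y hyC, hχ₀1 (ℓ y) (by linarith), hχ1 (ℓ y) hyd.le, Real.exp_neg]
    have := Real.exp_pos (B (τ, y))
    field_simp
    ring
  refine ⟨K, C1, d / 2, hK, hC1c, hrO, by positivity, hKC, fun τ hτ y hy ↦ ⟨hK0 τ hτ y hy, ?_⟩,
    hmain⟩
  have hyH : y ∈ halfSpace ℓ := hy.ge
  by_cases hyC : y ∈ C1
  · refine spatialFDerivWithin_eq_zero_of_boundary hKd hK0 hτ hy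
      (hZℓ τ hτ y ⟨hyH, hrO hyC⟩).ne ?_
    rw [hmain τ hτ y ⟨hyH, hrO hyC⟩ (by linarith), hK0 τ hτ y hy, hG0 y hy, zero_add]
  · exact hKD0 τ hτ y hyH hyC

end Hamiltonian

/-! ### One-forms on a vector space -/

section LinearForms

variable {E : Type*} [NormedAddCommGroup E] [NormedSpace ℝ E] [FiniteDimensional ℝ E]
  {ℓ : E →L[ℝ] ℝ} {e : E}

/-- The exterior derivative of a one-form on the subset `H` of a vector space, as a bilinear map. -/
noncomputable def oneFormDeriv (H : Set E) (θ : E → E →L[ℝ] ℝ) (y : E) : E →L[ℝ] E →L[ℝ] ℝ :=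
  fderivWithin ℝ θ H y - (fderivWithin ℝ θ H y).flip

theorem oneFormDeriv_apply (H : Set E) (θ : E → E →L[ℝ] ℝ) (y v w : E) :
    oneFormDeriv H θ y v w = fderivWithin ℝ θ H y v w - fderivWithin ℝ θ H y w v := by
  simp [oneFormDeriv]

theorem oneFormDeriv_self (H : Set E) (θ : E → E →L[ℝ] ℝ) (y v : E) :
    oneFormDeriv H θ y v v = 0 := by
  simp [oneFormDeriv_apply]

theorem oneFormDeriv_swap (H : Set E) (θ : E → E →L[ℝ] ℝ) (y v w : E) :
    oneFormDeriv H θ y v w = -oneFormDeriv H θ y w v := by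
  simp [oneFormDeriv_apply]

theorem subset_closure_interior_halfSpace (he : ℓ e = 1) :
    halfSpace ℓ ⊆ closure (interior (halfSpace ℓ)) := by
  rw [convex_halfSpace.closure_interior_eq_closure_of_nonempty_interior
    (nonempty_interior_halfSpace he)]
  exact subset_closure

theorem contDiffOn_fderivWithin_inter {G : Type*} [NormedAddCommGroup G] [NormedSpace ℝ G]
    {f : E → G} {H O : Set E} (hH : UniqueDiffOn ℝ H) (hO : IsOpen O)
    (hf : ContDiffOn ℝ ∞ f (H ∩ O)) : ContDiffOn ℝ ∞ (fderivWithin ℝ f H) (H ∩ O) :=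
  (hf.fderivWithin (m := ∞) (hH.inter hO) (by simp)).congr fun y hy ↦
    (fderivWithin_inter (hO.mem_nhds hy.2)).symm

theorem contDiffOn_oneFormDeriv {θ : E → E →L[ℝ] ℝ} {H O : Set E} (hH : UniqueDiffOn ℝ H)
    (hO : IsOpen O) (hθ : ContDiffOn ℝ ∞ θ (H ∩ O)) :
    ContDiffOn ℝ ∞ (oneFormDeriv H θ) (H ∩ O) := by
  have h := contDiffOn_fderivWithin_inter hH hO hθ
  refine h.sub (contDiffOn_clm_apply.2 fun v ↦ contDiffOn_clm_apply.2 fun w ↦ ?_)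
  exact (h.clm_apply contDiffOn_const).clm_apply contDiffOn_const

/-- Adding a differential to a one-form does not change its exterior derivative. -/
theorem oneFormDeriv_add_fderivWithin (he : ℓ e = 1) {θ : E → E →L[ℝ] ℝ} {O : Set E} (hO : IsOpen O)
    (hθ : ContDiffOn ℝ ∞ θ (halfSpace ℓ ∩ O)) {G : E → ℝ}
    (hG : ContDiffOn ℝ ∞ G (halfSpace ℓ ∩ O)) {y : E} (hy : y ∈ halfSpace ℓ ∩ O) :
    oneFormDeriv (halfSpace ℓ) (fun z ↦ θ z + fderivWithin ℝ G (halfSpace ℓ) z) y =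
      oneFormDeriv (halfSpace ℓ) θ y := by
  have hH := uniqueDiffOn_halfSpace he
  have hn : halfSpace ℓ ∩ O ∈ 𝓝[halfSpace ℓ] y := inter_mem_nhdsWithin _ (hO.mem_nhds hy.2)
  have h1 : DifferentiableWithinAt ℝ θ (halfSpace ℓ) y :=
    ((hθ.differentiableOn (by simp)) y hy).mono_of_mem_nhdsWithin hn
  have h2 : DifferentiableWithinAt ℝ (fderivWithin ℝ G (halfSpace ℓ)) (halfSpace ℓ) y :=
    (((contDiffOn_fderivWithin_inter hH hO hG).differentiableOn (by simp)) y
      hy).mono_of_mem_nhdsWithin hn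
  have h3 : IsSymmSndFDerivWithinAt ℝ G (halfSpace ℓ) y :=
    ((hG y hy).mono_of_mem_nhdsWithin hn).isSymmSndFDerivWithinAt
      (by simp only [minSmoothness_of_isRCLikeNormedField]; exact ENat.LEInfty.out) hH
      (subset_closure_interior_halfSpace he hy.1) hy.1
  ext v w
  have := h3.eq v w
  rw [oneFormDeriv_apply, oneFormDeriv_apply, fderivWithin_fun_add (hH y hy.1) h1 h2]
  simp only [add_apply, this]
  ring

/-- A nondegenerate bilinear form on a finite-dimensional space is an isomorphism onto the dual. -/
theorem exists_continuousLinearEquiv_of_nondegenerate {Ω : E →L[ℝ] E →L[ℝ] ℝ}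
    (h : ∀ v, (∀ w, Ω v w = 0) → v = 0) : ∃ Ψ : E ≃L[ℝ] (E →L[ℝ] ℝ), (Ψ : E →L[ℝ] E →L[ℝ] ℝ) = Ω := by
  have hinj : Function.Injective (Ω : E →ₗ[ℝ] (E →L[ℝ] ℝ)) := by
    rw [← LinearMap.ker_eq_bot, LinearMap.ker_eq_bot']
    exact fun v hv ↦ h v fun w ↦ by
      have : Ω v = 0 := hv
      simp [this]
  have hfr : Module.finrank ℝ E = Module.finrank ℝ (E →L[ℝ] ℝ) := by
    rw [← (LinearMap.toContinuousLinearMap (𝕜 := ℝ) (E := E) (F' := ℝ)).finrank_eq]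
    exact (Subspace.dual_finrank_eq (K := ℝ) (V := E)).symm
  refine ⟨(LinearMap.linearEquivOfInjective _ hinj hfr).toContinuousLinearEquiv, ?_⟩
  ext v w
  rfl

theorem inverse_apply_of_nondegenerate {Ω : E →L[ℝ] E →L[ℝ] ℝ}
    (h : ∀ v, (∀ w, Ω v w = 0) → v = 0) (a : E →L[ℝ] ℝ) : Ω (Ω.inverse a) = a := by
  obtain ⟨Ψ, rfl⟩ := exists_continuousLinearEquiv_of_nondegenerate h
  simp

theorem contDiffOn_inverse_of_nondegenerate {X : Type*} [NormedAddCommGroup X] [NormedSpace ℝ X]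
    {Ω : X → E →L[ℝ] E →L[ℝ] ℝ} {s : Set X} (hΩ : ContDiffOn ℝ ∞ Ω s)
    (h : ∀ x ∈ s, ∀ v, (∀ w, Ω x v w = 0) → v = 0) :
    ContDiffOn ℝ ∞ (fun x ↦ (Ω x).inverse) s := fun x hx ↦ by
  obtain ⟨Ψ, hΨ⟩ := exists_continuousLinearEquiv_of_nondegenerate (h x hx)
  have h1 : ContDiffAt ℝ ∞ ContinuousLinearMap.inverse (Ω x) := hΨ ▸ contDiffAt_map_inverse Ψ
  exact h1.comp_contDiffWithinAt x (hΩ x hx)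

theorem fderivWithin_halfSpace_eq_smul {G : E → ℝ} {O : Set E} (he : ℓ e = 1)
    (hG0 : ∀ y ∈ O, ℓ y = 0 → G y = 0) {y : E} (hyO : O ∈ 𝓝 y)
    (hG : DifferentiableWithinAt ℝ G (halfSpace ℓ) y) (hy : ℓ y = 0) (w : E) :
    fderivWithin ℝ G (halfSpace ℓ) y w = ℓ w * fderivWithin ℝ G (halfSpace ℓ) y e := by
  have h1 : HasDerivAt (fun s : ℝ ↦ y + s • (w - ℓ w • e)) (w - ℓ w • e) 0 := by
    simpa using ((hasDerivAt_id (0 : ℝ)).smul_const (w - ℓ w • e)).const_add y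
  have h2 := HasFDerivWithinAt.comp_hasDerivAt_of_eq (0 : ℝ) (f := fun s : ℝ ↦ y + s • (w - ℓ w • e))
    hG.hasFDerivWithinAt h1 (Eventually.of_forall fun s ↦ by simp [halfSpace, hy, he]) (by simp)
  have h3 : G ∘ (fun s : ℝ ↦ y + s • (w - ℓ w • e)) =ᶠ[𝓝 0] fun _ ↦ (0 : ℝ) := by
    filter_upwards [h1.continuousAt.preimage_mem_nhds (by simpa using hyO)] with s hs
    exact hG0 _ hs (by simp [hy, he])
  have h4 := (h2.congr_of_eventuallyEq h3.symm).unique (hasDerivAt_const _ _)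
  simpa [sub_eq_zero] using h4

/-- The transverse component at the boundary of the Liouville field does not change when the
differential of a function vanishing on the boundary is added to the one-form. -/
theorem apply_eq_of_antisymm {Ω : E →L[ℝ] E →L[ℝ] ℝ} (hself : ∀ v, Ω v v = 0)
    (hnd : ∀ v, (∀ w, Ω v w = 0) → v = 0) {z z' : E} {a : ℝ} (h : ∀ w, Ω z' w = Ω z w + a * ℓ w) :
    ℓ z' = ℓ z := by
  have h1 : a * ℓ (z' - z) = 0 := by
    have h2 := hself (z' - z)
    have h3 : Ω (z' - z) (z' - z) = a * ℓ (z' - z) := by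
      have h4 : Ω (z' - z) = Ω z' - Ω z := map_sub Ω z' z
      rw [h4, sub_apply, h]
      ring
    linarith
  rcases mul_eq_zero.1 h1 with ha | h4
  · have : z' - z = 0 := hnd _ fun w ↦ by simp [h, ha]
    rw [sub_eq_zero.1 this]
  · simpa [sub_eq_zero] using h4

end LinearForms

/-! ### Mixed partial derivatives -/

section Mixed

variable {E F : Type*} [NormedAddCommGroup E] [NormedSpace ℝ E]
  [NormedAddCommGroup F] [NormedSpace ℝ F]

/-- Symmetry of mixed partial derivatives: the time derivative of the spatial derivative is the
spatial derivative of the time derivative `W`. -/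
theorem hasDerivWithinAt_spatialFDerivWithin {f W : ℝ × E → F} {C : Set E}
    (hC : Convex ℝ C) (hCi : (interior C).Nonempty)
    (hf : ContDiffOn ℝ ∞ f (Icc 0 1 ×ˢ C))
    (hW : ∀ y ∈ C, ∀ t ∈ Icc (0 : ℝ) 1, HasDerivWithinAt (fun s ↦ f (s, y)) (W (t, y)) (Icc 0 1) t)
    {y : E} (hy : y ∈ C) {t : ℝ} (ht : t ∈ Icc (0 : ℝ) 1) (v : E) :
    HasDerivWithinAt (fun s ↦ spatialFDerivWithin f C (s, y) v)
      (spatialFDerivWithin W C (t, y) v) (Icc 0 1) t := by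
  set D : Set (ℝ × E) := Icc 0 1 ×ˢ C
  have hCu : UniqueDiffOn ℝ C := uniqueDiffOn_convex hC hCi
  have hDu : UniqueDiffOn ℝ D := uniqueDiffOn_Icc_prod hCu
  have hfd : DifferentiableOn ℝ f D := hf.differentiableOn (by simp)
  have hf' : ContDiffOn ℝ ∞ (fderivWithin ℝ f D) D := hf.fderivWithin hDu (by simp)
  have hf'd : DifferentiableOn ℝ (fderivWithin ℝ f D) D := hf'.differentiableOn (by simp)
  have hWeq : ∀ p ∈ D, W p = fderivWithin ℝ f D p (1, 0) := by
    rintro ⟨s, z⟩ hp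
    have h1 : HasDerivWithinAt (fun r : ℝ ↦ (r, z)) (1, 0) (Icc 0 1) s :=
      ((hasDerivAt_id s).prodMk (hasDerivAt_const s z)).hasDerivWithinAt
    have h2 := HasFDerivWithinAt.comp_hasDerivWithinAt (t := D) (f := fun r : ℝ ↦ (r, z)) s
      (hfd (s, z) hp).hasFDerivWithinAt h1 fun r hr ↦ ⟨hr, hp.2⟩
    exact ((uniqueDiffOn_Icc zero_lt_one) s hp.1).eq_deriv _ (hW z hp.2 s hp.1) h2
  have hWd : DifferentiableOn ℝ W D := (hf'd.clm_apply (differentiableOn_const (1, 0))).congr hWeq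
  have hp : (t, y) ∈ D := ⟨ht, hy⟩
  have hclosure : (t, y) ∈ closure (interior D) := by
    have h1 : Convex ℝ D := (convex_Icc 0 1).prod hC
    have h2 : (interior D).Nonempty := by
      rw [interior_prod_eq]
      exact (by simp : (interior (Icc (0 : ℝ) 1)).Nonempty).prod hCi
    rw [h1.closure_interior_eq_closure_of_nonempty_interior h2]
    exact subset_closure hp
  have hsymm : IsSymmSndFDerivWithinAt ℝ f D (t, y) :=
    (hf _ hp).isSymmSndFDerivWithinAt
      (by simp only [minSmoothness_of_isRCLikeNormedField]; exact ENat.LEInfty.out) hDu hclosure hp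
  have h1 : HasDerivWithinAt (fun r : ℝ ↦ (r, y)) (1, 0) (Icc 0 1) t :=
    ((hasDerivAt_id t).prodMk (hasDerivAt_const t y)).hasDerivWithinAt
  have h2 := HasFDerivWithinAt.comp_hasDerivWithinAt (t := D) (f := fun r : ℝ ↦ (r, y)) t
    (hf'd (t, y) hp).hasFDerivWithinAt h1 fun r hr ↦ ⟨hr, hy⟩
  have h3 := h2.clm_apply (hasDerivWithinAt_const t (Icc (0 : ℝ) 1) ((0, v) : ℝ × E))
  have h4 : spatialFDerivWithin W C (t, y) v =
      fderivWithin ℝ (fderivWithin ℝ f D) D (t, y) (1, 0) (0, v) := by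
    have h5 : HasFDerivWithinAt W (((fderivWithin ℝ (fderivWithin ℝ f D) D (t, y))).flip (1, 0))
        D (t, y) := by
      have := (hf'd (t, y) hp).hasFDerivWithinAt.clm_apply
        (hasFDerivWithinAt_const ((1, 0) : ℝ × E) (t, y) D)
      refine (this.congr_of_eventuallyEq ?_ (hWeq _ hp)).congr_fderiv ?_
      · filter_upwards [self_mem_nhdsWithin] with q hq using hWeq q hq
      · ext <;> simp
    simp only [spatialFDerivWithin]
    rw [h5.fderivWithin (hDu _ hp)]
    simpa using hsymm.eq (0, v) (1, 0)
  rw [h4]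
  simpa [spatialFDerivWithin, Function.comp_def] using h3

theorem eq_of_hasDerivWithinAt_zero {f : ℝ → F}
    (h : ∀ t ∈ Icc (0 : ℝ) 1, HasDerivWithinAt f 0 (Icc 0 1) t) {t : ℝ} (ht : t ∈ Icc (0 : ℝ) 1) :
    f t = f 0 := by
  have := (convex_Icc (0 : ℝ) 1).norm_image_sub_le_of_norm_hasDerivWithin_le (f' := fun _ ↦ 0)
    (C := 0) h (by simp) ⟨le_rfl, zero_le_one⟩ ht
  simpa [sub_eq_zero] using this

end Mixed

/-! ### Flows of compactly supported fields on a half-space -/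

section CompactFlow

variable {E : Type*} [NormedAddCommGroup E] [NormedSpace ℝ E] [FiniteDimensional ℝ E]
  {ℓ : E →L[ℝ] ℝ} {e : E}

/-- A field which vanishes on the boundary and off a compact set has a flow on the half-space. -/
theorem exists_flow_of_isCompact (he : ℓ e = 1) {X : ℝ × E → E} {h : ℝ × E → ℝ} {Q : Set E}
    (hQ : IsCompact Q) (hX : ContDiffOn ℝ ∞ X (Icc 0 1 ×ˢ halfSpace ℓ))
    (hh : ContDiffOn ℝ ∞ h (Icc 0 1 ×ˢ halfSpace ℓ))
    (hXQ : ∀ τ ∈ Icc (0 : ℝ) 1, ∀ y ∈ halfSpace ℓ, y ∉ Q → X (τ, y) = 0)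
    (hhQ : ∀ τ ∈ Icc (0 : ℝ) 1, ∀ y ∈ halfSpace ℓ, y ∉ Q → h (τ, y) = 0)
    (hX0 : ∀ τ ∈ Icc (0 : ℝ) 1, ∀ y, ℓ y = 0 → X (τ, y) = 0) :
    ∃ (φ : ℝ × E → E) (S : ℝ × E → ℝ), ContDiffOn ℝ ∞ φ (Icc 0 1 ×ˢ halfSpace ℓ) ∧
      ContDiffOn ℝ ∞ S (Icc 0 1 ×ˢ halfSpace ℓ) ∧ MapsTo φ (Icc 0 1 ×ˢ halfSpace ℓ) (halfSpace ℓ) ∧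
      (∀ y ∈ halfSpace ℓ, φ (0, y) = y) ∧ (∀ y ∈ halfSpace ℓ, S (0, y) = 0) ∧
      (∀ y ∈ halfSpace ℓ, ∀ t ∈ Icc (0 : ℝ) 1,
        HasDerivWithinAt (fun s ↦ φ (s, y)) (X (t, φ (t, y))) (Icc 0 1) t) ∧
      ∀ y ∈ halfSpace ℓ, ∀ t ∈ Icc (0 : ℝ) 1,
        HasDerivWithinAt (fun s ↦ S (s, y)) (h (t, φ (t, y))) (Icc 0 1) t := by
  obtain ⟨L, K, hL, hK⟩ := exists_bound_and_lipschitzOnWith_of_eq_zero convex_halfSpace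
    isClosed_halfSpace (uniqueDiffOn_halfSpace he) hQ (hX.prodMk hh)
    fun t ht y hy hyQ ↦ by simp [hXQ t ht y hy hyQ, hhQ t ht y hy hyQ]
  have hc : LipschitzWith 1 (fun t : ℝ ↦ max 0 t) := LipschitzWith.id.const_max 0
  obtain ⟨R, hR⟩ := exists_lipschitzWith_adjustAlong (ℓ := ℓ) (e := e) hc
  have hRC : ∀ y, adjustAlong ℓ e (fun t ↦ max 0 t) y ∈ halfSpace ℓ := fun y ↦ by
    simp [halfSpace, apply_adjustAlong he]
  have hKX : ∀ t ∈ Icc (0 : ℝ) 1, LipschitzOnWith K (fun y ↦ X (t, y)) (halfSpace ℓ) :=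
    fun t ht y hy z hz ↦ (le_max_left _ _).trans (hK t ht hy hz)
  refine exists_contDiffOn_flow_and_integral convex_halfSpace (uniqueDiffOn_halfSpace he) hR hRC
    (fun y hy ↦ adjustAlong_of_eq (max_eq_right hy)) hX hh hL hK ?_
  intro α hα0 hα t ht
  by_contra hneg
  have hneg' : ℓ (α t) < 0 := not_le.1 hneg
  -- a trajectory outside the half-space is constant
  have hX' : ∀ s ∈ Icc (0 : ℝ) 1, LipschitzOnWith (K * R)
      (fun y ↦ X (s, adjustAlong ℓ e (fun t ↦ max 0 t) y)) univ := fun s hs ↦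
    (hKX s hs).comp (hR.lipschitzOnWith (s := univ)) fun y _ ↦ hRC y
  have h0 : ∀ s ∈ Icc (0 : ℝ) 1, X (s, adjustAlong ℓ e (fun t ↦ max 0 t) (α t)) = 0 := fun s hs ↦
    hX0 s hs _ (by rw [apply_adjustAlong he, max_eq_left hneg'.le])
  have := eqOn_of_hasDerivWithinAt_of_lipschitzOnWith
    (f := fun p ↦ X (p.1, adjustAlong ℓ e (fun t ↦ max 0 t) p.2)) hX' (α := α) (β := fun _ ↦ α t)
    hα (fun s hs ↦ by simpa only [h0 s hs] using hasDerivWithinAt_const s (Icc (0 : ℝ) 1) (α t))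
    (fun _ _ ↦ mem_univ _) (fun _ _ ↦ mem_univ _) ht rfl
  have h1 := this ⟨le_rfl, zero_le_one⟩
  rw [h1] at hα0
  exact hneg hα0

theorem flow_reverse_apply {C : Set E} {f φ η : ℝ × E → E} {K : ℝ≥0}
    (hK : ∀ t ∈ Icc (0 : ℝ) 1, LipschitzOnWith K (fun y ↦ f (t, y)) C)
    (hφC : MapsTo φ (Icc 0 1 ×ˢ C) C) (hηC : MapsTo η (Icc 0 1 ×ˢ C) C)
    (hφ0 : ∀ y ∈ C, φ (0, y) = y) (hη0 : ∀ y ∈ C, η (0, y) = y)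
    (hφ : ∀ y ∈ C, ∀ t ∈ Icc (0 : ℝ) 1,
      HasDerivWithinAt (fun s ↦ φ (s, y)) (f (t, φ (t, y))) (Icc 0 1) t)
    (hη : ∀ y ∈ C, ∀ t ∈ Icc (0 : ℝ) 1,
      HasDerivWithinAt (fun s ↦ η (s, y)) (-f (1 - t, η (t, y))) (Icc 0 1) t)
    {y : E} (hy : y ∈ C) : η (1, φ (1, y)) = y := by
  have one_mem : (1 : ℝ) ∈ Icc (0 : ℝ) 1 := ⟨zero_le_one, le_rfl⟩
  have zero_mem : (0 : ℝ) ∈ Icc (0 : ℝ) 1 := ⟨le_rfl, zero_le_one⟩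
  have hm : MapsTo (fun t : ℝ ↦ 1 - t) (Icc 0 1) (Icc 0 1) := fun t ht ↦
    ⟨by linarith [ht.2], by linarith [ht.1]⟩
  have hK' : ∀ t ∈ Icc (0 : ℝ) 1, LipschitzOnWith K (fun y ↦ -f (1 - t, y)) C := fun t ht y hy z hz ↦ by
    simpa only [edist_neg_neg] using hK (1 - t) (hm ht) hy hz
  have hy1 : φ (1, y) ∈ C := hφC ⟨one_mem, hy⟩
  have := eqOn_of_hasDerivWithinAt_of_lipschitzOnWith (f := fun p ↦ -f (1 - p.1, p.2)) hK'
    (α := fun s ↦ η (s, φ (1, y))) (β := fun s ↦ φ (1 - s, y)) (hη _ hy1)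
    (fun t ht ↦ by
      have h1 : HasDerivWithinAt (fun s : ℝ ↦ 1 - s) (-1) (Icc 0 1) t :=
        ((hasDerivAt_id t).const_sub 1).hasDerivWithinAt
      simpa [Function.comp_def] using HasDerivWithinAt.scomp t (hφ y hy (1 - t) (hm ht)) h1 hm)
    (fun t ht ↦ hηC ⟨ht, hy1⟩) (fun t ht ↦ hφC ⟨hm ht, hy⟩) zero_mem
    (by simp [hη0 _ hy1])
  simpa [hφ0 y hy] using this one_mem

/-- The time `t` map of the flow has a smooth inverse, the time one map of the field
`-t X(t (1 - s), ·)`. -/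
theorem exists_inverse_of_flow (he : ℓ e = 1) {X φ : ℝ × E → E} {Q : Set E}
    (hQ : IsCompact Q) (hX : ContDiffOn ℝ ∞ X (Icc 0 1 ×ˢ halfSpace ℓ))
    (hXQ : ∀ τ ∈ Icc (0 : ℝ) 1, ∀ y ∈ halfSpace ℓ, y ∉ Q → X (τ, y) = 0)
    (hX0 : ∀ τ ∈ Icc (0 : ℝ) 1, ∀ y, ℓ y = 0 → X (τ, y) = 0)
    (hφC : MapsTo φ (Icc 0 1 ×ˢ halfSpace ℓ) (halfSpace ℓ))
    (hφ0 : ∀ y ∈ halfSpace ℓ, φ (0, y) = y)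
    (hφ : ∀ y ∈ halfSpace ℓ, ∀ t ∈ Icc (0 : ℝ) 1,
      HasDerivWithinAt (fun s ↦ φ (s, y)) (X (t, φ (t, y))) (Icc 0 1) t)
    {t : ℝ} (ht : t ∈ Icc (0 : ℝ) 1) :
    ∃ ψ : E → E, ContDiffOn ℝ ∞ ψ (halfSpace ℓ) ∧ MapsTo ψ (halfSpace ℓ) (halfSpace ℓ) ∧
      (∀ y ∈ halfSpace ℓ, ψ (φ (t, y)) = y) ∧ ∀ y ∈ halfSpace ℓ, φ (t, ψ y) = y := by
  have one_mem : (1 : ℝ) ∈ Icc (0 : ℝ) 1 := ⟨zero_le_one, le_rfl⟩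
  have m1 : MapsTo (fun s : ℝ ↦ t * s) (Icc 0 1) (Icc 0 1) := fun s hs ↦
    ⟨mul_nonneg ht.1 hs.1, mul_le_one₀ ht.2 hs.1 hs.2⟩
  have hm : MapsTo (fun t : ℝ ↦ 1 - t) (Icc 0 1) (Icc 0 1) := fun t ht ↦
    ⟨by linarith [ht.2], by linarith [ht.1]⟩
  let f : ℝ × E → E := fun p ↦ t • X (t * p.1, p.2)
  have hf : ContDiffOn ℝ ∞ f (Icc 0 1 ×ˢ halfSpace ℓ) :=
    contDiffOn_const.smul (hX.comp (by fun_prop : ContDiffOn ℝ ∞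
      (fun p : ℝ × E ↦ (t * p.1, p.2)) _) fun p hp ↦ ⟨m1 hp.1, hp.2⟩)
  have hg : ContDiffOn ℝ ∞ (fun p : ℝ × E ↦ -f (1 - p.1, p.2)) (Icc 0 1 ×ˢ halfSpace ℓ) :=
    (hf.comp (by fun_prop : ContDiffOn ℝ ∞
      (fun p : ℝ × E ↦ (1 - p.1, p.2)) _) fun p hp ↦ ⟨hm hp.1, hp.2⟩).neg
  obtain ⟨η, -, hη, -, hηC, hη0, -, hηode, -⟩ := exists_flow_of_isCompact he hQ hg
    (contDiffOn_const (c := (0 : ℝ)))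
    (fun τ hτ y hy hyQ ↦ by simp [f, hXQ _ (m1 (hm hτ)) y hy hyQ]) (fun _ _ _ _ _ ↦ rfl)
    (fun τ hτ y hy ↦ by simp [f, hX0 _ (m1 (hm hτ)) y hy])
  obtain ⟨-, K, -, hK⟩ := exists_bound_and_lipschitzOnWith_of_eq_zero convex_halfSpace
    isClosed_halfSpace (uniqueDiffOn_halfSpace he) hQ hf
    fun s hs y hy hyQ ↦ by simp [f, hXQ _ (m1 hs) y hy hyQ]
  have hK' : ∀ s ∈ Icc (0 : ℝ) 1, LipschitzOnWith K (fun y ↦ -f (1 - s, y)) (halfSpace ℓ) :=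
    fun s hs y hy z hz ↦ by simpa only [edist_neg_neg] using hK (1 - s) (hm hs) hy hz
  let φ' : ℝ × E → E := fun p ↦ φ (t * p.1, p.2)
  have hφ'C : MapsTo φ' (Icc 0 1 ×ˢ halfSpace ℓ) (halfSpace ℓ) := fun p hp ↦ hφC ⟨m1 hp.1, hp.2⟩
  have hφ'0 : ∀ y ∈ halfSpace ℓ, φ' (0, y) = y := fun y hy ↦ by simp [φ', hφ0 y hy]
  have hφ'ode : ∀ y ∈ halfSpace ℓ, ∀ s ∈ Icc (0 : ℝ) 1,
      HasDerivWithinAt (fun s ↦ φ' (s, y)) (f (s, φ' (s, y))) (Icc 0 1) s := fun y hy s hs ↦ by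
    have h1 : HasDerivWithinAt (fun s : ℝ ↦ t * s) t (Icc 0 1) s := by
      simpa using ((hasDerivAt_id s).const_mul t).hasDerivWithinAt
    exact HasDerivWithinAt.scomp s (hφ y hy (t * s) (m1 hs)) h1 m1
  refine ⟨fun y ↦ η (1, y), hη.comp (by fun_prop : ContDiffOn ℝ ∞ (fun y : E ↦ ((1 : ℝ), y)) _)
    fun y hy ↦ ⟨one_mem, hy⟩, fun y hy ↦ hηC ⟨one_mem, hy⟩, fun y hy ↦ ?_, fun y hy ↦ ?_⟩
  · simpa [φ'] using flow_reverse_apply hK hφ'C hηC hφ'0 hη0 hφ'ode hηode hy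
  · simpa [φ'] using flow_reverse_apply (f := fun p ↦ -f (1 - p.1, p.2)) hK' hηC hφ'C hη0 hφ'0 hηode
      (fun y hy s hs ↦ by simpa using hφ'ode y hy s hs) hy

end CompactFlow

/-! ### The local theorem on a half-space -/

section Local

variable {E : Type*} [NormedAddCommGroup E] [NormedSpace ℝ E] [FiniteDimensional ℝ E]
  {ℓ : E →L[ℝ] ℝ} {e : E}

/-- Along the one-forms `θ + (1 - τ) dG`, whose Liouville fields all point outwards, there are
Hamiltonians `K` with `dK(Z_τ) = K + G` near the boundary. -/
theorem exists_hamiltonian (he : ℓ e = 1) {O C : Set E} (hO : IsOpen O)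
    {θ : E → E →L[ℝ] ℝ} (hθ : ContDiffOn ℝ ∞ θ (halfSpace ℓ ∩ O))
    (hnd : ∀ y ∈ halfSpace ℓ ∩ O, ∀ v, (∀ w, oneFormDeriv (halfSpace ℓ) θ y v w = 0) → v = 0)
    (hout : ∀ y ∈ O, ℓ y = 0 → ∀ z, oneFormDeriv (halfSpace ℓ) θ y z = θ y → ℓ z < 0)
    {G : E → ℝ} (hG : ContDiffOn ℝ ∞ G (halfSpace ℓ)) (hC : IsCompact C) (hCO : C ⊆ O)
    (hGC : ∀ y ∈ halfSpace ℓ, y ∉ C → G y = 0) (hG0 : ∀ y, ℓ y = 0 → G y = 0) :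
    ∃ (K : ℝ × E → ℝ) (Q : Set E) (δ : ℝ), ContDiffOn ℝ ∞ K (Icc 0 1 ×ˢ halfSpace ℓ) ∧
      IsCompact Q ∧ Q ⊆ O ∧ 0 < δ ∧
      (∀ τ ∈ Icc (0 : ℝ) 1, ∀ y ∈ halfSpace ℓ, y ∉ Q → K (τ, y) = 0) ∧
      (∀ τ ∈ Icc (0 : ℝ) 1, ∀ y, ℓ y = 0 →
        K (τ, y) = 0 ∧ spatialFDerivWithin K (halfSpace ℓ) (τ, y) = 0) ∧
      ∀ τ ∈ Icc (0 : ℝ) 1, ∀ y ∈ halfSpace ℓ ∩ O, ℓ y < δ →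
        ∀ z, oneFormDeriv (halfSpace ℓ) θ y z =
          θ y + (1 - τ) • fderivWithin ℝ G (halfSpace ℓ) y →
        spatialFDerivWithin K (halfSpace ℓ) (τ, y) z = K (τ, y) + G y := by
  have hH := uniqueDiffOn_halfSpace he
  set ω' := oneFormDeriv (halfSpace ℓ) θ with hω'
  have hωs : ContDiffOn ℝ ∞ ω' (halfSpace ℓ ∩ O) := contDiffOn_oneFormDeriv hH hO hθ
  have hGd : DifferentiableOn ℝ G (halfSpace ℓ) := hG.differentiableOn (by simp)
  have hDG : ContDiffOn ℝ ∞ (fderivWithin ℝ G (halfSpace ℓ)) (halfSpace ℓ) :=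
    hG.fderivWithin hH (by simp)
  let Z : ℝ × E → E := fun p ↦
    (ω' p.2).inverse (θ p.2 + (1 - p.1) • fderivWithin ℝ G (halfSpace ℓ) p.2)
  have hm : MapsTo Prod.snd (Icc (0 : ℝ) 1 ×ˢ (halfSpace ℓ ∩ O)) (halfSpace ℓ ∩ O) := fun p hp ↦ hp.2
  have hZ : ContDiffOn ℝ ∞ Z (Icc 0 1 ×ˢ (halfSpace ℓ ∩ O)) := by
    refine ContDiffOn.clm_apply ((contDiffOn_inverse_of_nondegenerate hωs hnd).comp
      contDiffOn_snd hm) ((hθ.comp contDiffOn_snd hm).add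
        ((by fun_prop : ContDiffOn ℝ ∞ (fun p : ℝ × E ↦ 1 - p.1) _).smul ((hDG.mono inter_subset_left).comp contDiffOn_snd hm)))
  have hZeq : ∀ τ, ∀ y ∈ halfSpace ℓ ∩ O,
      ω' y (Z (τ, y)) = θ y + (1 - τ) • fderivWithin ℝ G (halfSpace ℓ) y :=
    fun τ y hy ↦ inverse_apply_of_nondegenerate (hnd y hy) _
  have hZ0 : ∀ τ, ∀ y ∈ O, ℓ y = 0 → ℓ (Z (τ, y)) < 0 := fun τ y hyO hy ↦ by
    have hyH : y ∈ halfSpace ℓ ∩ O := ⟨hy.ge, hyO⟩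
    have h1 := inverse_apply_of_nondegenerate (hnd y hyH) (θ y)
    rw [apply_eq_of_antisymm (fun v ↦ oneFormDeriv_self _ _ _ v) (hnd y hyH)
      (z := (ω' y).inverse (θ y)) (z' := Z (τ, y))
      (a := (1 - τ) * fderivWithin ℝ G (halfSpace ℓ) y e)]
    · exact hout y hyO hy _ h1
    · intro w
      have h2 := hZeq τ y hyH
      rw [hω'] at h1 h2 ⊢
      rw [h1, h2]
      simp only [add_apply, smul_apply, smul_eq_mul]
      rw [fderivWithin_halfSpace_eq_smul he (fun y _ ↦ hG0 y) univ_mem (hGd y hyH.1) hy w]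
      ring
  -- the part of `O` on which all fields point outwards
  let P : Set E := {y | y ∈ O ∧ (y ∈ halfSpace ℓ → ∀ τ ∈ Icc (0 : ℝ) 1, ℓ (Z (τ, y)) < 0)}
  have hP : ∀ y ∈ O, ℓ y = 0 → y ∈ interior P := fun y hyO hy ↦ by
    have h1 : ContinuousOn (fun p : E × ℝ ↦ ℓ (Z (p.2, p.1))) ((halfSpace ℓ ∩ O) ×ˢ Icc 0 1) :=
      ℓ.continuous.comp_continuousOn (hZ.continuousOn.comp continuous_swap.continuousOn
        fun p hp ↦ ⟨hp.2, hp.1⟩)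
    have h2 := eventually_forall_mem_lt_of_continuousOn h1 isCompact_Icc ⟨hy.ge, hyO⟩
      fun τ _ ↦ hZ0 τ y hyO hy
    rw [eventually_nhdsWithin_iff] at h2
    rw [mem_interior_iff_mem_nhds]
    filter_upwards [h2, hO.mem_nhds hyO] with z hz hzO
    exact ⟨hzO, fun hzH τ hτ ↦ hz ⟨hzH, hzO⟩ τ hτ⟩
  have hPO : interior P ⊆ O := fun y hy ↦ (interior_subset hy).1
  -- near the boundary the support of `G` lies in this part
  obtain ⟨ε, hε, hεP⟩ : ∃ ε > 0, ∀ y ∈ C, 0 ≤ ℓ y → ℓ y < ε → y ∈ interior P := by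
    have hcomp : IsCompact (C ∩ (halfSpace ℓ \ interior P)) := hC.inter_right
      (isClosed_halfSpace.sdiff isOpen_interior)
    rcases (C ∩ (halfSpace ℓ \ interior P)).eq_empty_or_nonempty with h | h
    · refine ⟨1, one_pos, fun y hy h0 _ ↦ by_contra fun hyP ↦ ?_⟩
      have : y ∈ C ∩ (halfSpace ℓ \ interior P) := ⟨hy, h0, hyP⟩
      rw [h] at this
      exact this
    · obtain ⟨x, hx, hmin⟩ := hcomp.exists_isMinOn h ℓ.continuous.continuousOn
      refine ⟨ℓ x, lt_of_le_of_ne hx.2.1 fun h0 ↦ hx.2.2 (hP x (hCO hx.1) h0.symm),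
        fun y hy h0 hyx ↦ by_contra fun hyP ↦ ?_⟩
      exact absurd (hmin (show y ∈ C ∩ (halfSpace ℓ \ interior P) from ⟨hy, h0, hyP⟩)) (not_le.2 hyx)
  obtain ⟨χ, hχ, hχ1, hχ0⟩ := exists_contDiff_step (show ε / 4 < ε / 2 by linarith)
  obtain ⟨K, Q, δ, hK, hQ, hQP, hδ, hKQ, hK0, hKeq⟩ := exists_solution_of_outward he
    (C := C ∩ {y | ℓ y ∈ Icc 0 (ε / 2)}) (G := fun y ↦ χ (ℓ y) * G y) isOpen_interior
    (hZ.mono (prod_mono_right (inter_subset_inter_right _ hPO)))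
    (fun τ hτ y hy ↦ (interior_subset hy.2).2 hy.1 τ hτ)
    ((hχ.comp ℓ.contDiff).contDiffOn.mul hG) (hC.inter_right (isClosed_Icc.preimage ℓ.continuous))
    (fun y hy ↦ hεP y hy.1 hy.2.1 (by linarith [hy.2.2]))
    (fun y hy hyC ↦ by
      by_cases h1 : y ∈ C
      · have : ε / 2 ≤ ℓ y := by
          by_contra h2
          exact hyC ⟨h1, hy, (not_le.1 h2).le⟩
        simp [hχ0 _ this]
      · simp [hGC y hy h1])
    (fun y hy ↦ by simp [hG0 y hy])
  refine ⟨K, Q, min δ (ε / 4), hK, hQ, hQP.trans hPO, lt_min hδ (by linarith), hKQ, hK0, ?_⟩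
  intro τ hτ y hy hyδ z hz
  have hy1 : ℓ y < δ := hyδ.trans_le (min_le_left _ _)
  have hy2 : ℓ y < ε / 4 := hyδ.trans_le (min_le_right _ _)
  have hzZ : z = Z (τ, y) := by
    rw [← sub_eq_zero]
    refine hnd y hy _ fun w ↦ ?_
    have h2 := hZeq τ y hy
    rw [hω'] at h2
    rw [map_sub, hz, h2, sub_self]
    rfl
  by_cases hyP : y ∈ interior P
  · rw [hzZ, hKeq τ hτ y ⟨hy.1, hyP⟩ hy1, hχ1 _ hy2.le, one_mul]
  · have hyQ : y ∉ Q := fun h ↦ hyP (hQP h)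
    have hyC : y ∉ C := fun h ↦ hyP (hεP y h hy.1 (by linarith))
    have h3 : spatialFDerivWithin K (halfSpace ℓ) (τ, y) = 0 := by
      refine spatialFDerivWithin_eq hH (hK.differentiableOn (by simp)) hτ hy.1 ?_
      refine (hasFDerivWithinAt_const (0 : ℝ) y _).congr_of_eventuallyEq ?_ (hKQ τ hτ y hy.1 hyQ)
      filter_upwards [self_mem_nhdsWithin, mem_nhdsWithin_of_mem_nhds
        (hQ.isClosed.isOpen_compl.mem_nhds hyQ)] with z hz hzC using hKQ τ hτ z hz hzC
    rw [h3, hKQ τ hτ y hy.1 hyQ, hGC y hy.1 hyC]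
    simp

end Local

section Local

variable {E : Type*} [NormedAddCommGroup E] [NormedSpace ℝ E] [FiniteDimensional ℝ E]
  {ℓ : E →L[ℝ] ℝ} {e : E}

theorem spatialFDerivWithin_apply_apply {F G : Type*} [NormedAddCommGroup F] [NormedSpace ℝ F]
    [NormedAddCommGroup G] [NormedSpace ℝ G] {C : Set E} (hC : UniqueDiffOn ℝ C)
    {C' : Set F} {f : ℝ × F → G} {φ : ℝ × E → F} {t : ℝ} (ht : t ∈ Icc (0 : ℝ) 1) {y : E} (hy : y ∈ C)
    {f' : F →L[ℝ] G} {g : ℝ × E → G} (hg : DifferentiableOn ℝ g (Icc 0 1 ×ˢ C))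
    (hgf : ∀ z ∈ C, g (t, z) = f (t, φ (t, z)))
    (hf : HasFDerivWithinAt (fun z ↦ f (t, z)) f' C' (φ (t, y)))
    (hφ : DifferentiableOn ℝ φ (Icc 0 1 ×ˢ C)) (hm : ∀ z ∈ C, φ (t, z) ∈ C') :
    spatialFDerivWithin g C (t, y) = f'.comp (spatialFDerivWithin φ C (t, y)) := by
  refine spatialFDerivWithin_eq hC hg ht hy ?_
  have h1 := HasFDerivWithinAt.comp (t := C') (g := fun z ↦ f (t, z)) (f := fun z ↦ φ (t, z)) y
    hf (hasFDerivWithinAt_spatialFDerivWithin hφ ht hy) hm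
  exact h1.congr (fun z hz ↦ hgf z hz) (hgf y hy)

/-- The flow `φ` of the Hamiltonian fields of `K` satisfies `φ_τ^* θ = θ + dS_τ`, where `S` is the
integral of `θ(X) - K` along the trajectories: both sides have the same derivative in `τ`. -/
theorem pullback_flow_eq (he : ℓ e = 1) {O : Set E} (hO : IsOpen O)
    {θ : E → E →L[ℝ] ℝ} (hθ : ContDiffOn ℝ ∞ θ (halfSpace ℓ ∩ O)) {X φ : ℝ × E → E}
    {K h S : ℝ × E → ℝ}
    (hX : ContDiffOn ℝ ∞ X (Icc 0 1 ×ˢ halfSpace ℓ))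
    (hK : ContDiffOn ℝ ∞ K (Icc 0 1 ×ˢ halfSpace ℓ))
    (hh : ContDiffOn ℝ ∞ h (Icc 0 1 ×ˢ halfSpace ℓ))
    (hφs : ContDiffOn ℝ ∞ φ (Icc 0 1 ×ˢ halfSpace ℓ))
    (hSs : ContDiffOn ℝ ∞ S (Icc 0 1 ×ˢ halfSpace ℓ))
    (hXK : ∀ τ ∈ Icc (0 : ℝ) 1, ∀ y ∈ halfSpace ℓ ∩ O, ∀ w,
      oneFormDeriv (halfSpace ℓ) θ y (X (τ, y)) w = -spatialFDerivWithin K (halfSpace ℓ) (τ, y) w)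
    (hhX : ∀ τ ∈ Icc (0 : ℝ) 1, ∀ y ∈ halfSpace ℓ ∩ O, h (τ, y) = θ y (X (τ, y)) - K (τ, y))
    (hφC : MapsTo φ (Icc 0 1 ×ˢ halfSpace ℓ) (halfSpace ℓ))
    (hφO : ∀ τ ∈ Icc (0 : ℝ) 1, ∀ y ∈ halfSpace ℓ ∩ O, φ (τ, y) ∈ O)
    (hφ0 : ∀ y ∈ halfSpace ℓ, φ (0, y) = y) (hS0 : ∀ y ∈ halfSpace ℓ, S (0, y) = 0)
    (hφ : ∀ y ∈ halfSpace ℓ, ∀ t ∈ Icc (0 : ℝ) 1,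
      HasDerivWithinAt (fun s ↦ φ (s, y)) (X (t, φ (t, y))) (Icc 0 1) t)
    (hS : ∀ y ∈ halfSpace ℓ, ∀ t ∈ Icc (0 : ℝ) 1,
      HasDerivWithinAt (fun s ↦ S (s, y)) (h (t, φ (t, y))) (Icc 0 1) t)
    {t : ℝ} (ht : t ∈ Icc (0 : ℝ) 1) {y : E} (hy : y ∈ halfSpace ℓ ∩ O) (v : E) :
    θ (φ (t, y)) (spatialFDerivWithin φ (halfSpace ℓ) (t, y) v) =
      θ y v + spatialFDerivWithin S (halfSpace ℓ) (t, y) v := by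
  have hH := uniqueDiffOn_halfSpace he
  have hHi := nonempty_interior_halfSpace he
  have zero_mem : (0 : ℝ) ∈ Icc (0 : ℝ) 1 := ⟨le_rfl, zero_le_one⟩
  have hφd : DifferentiableOn ℝ φ (Icc 0 1 ×ˢ halfSpace ℓ) := hφs.differentiableOn (by simp)
  have hSd : DifferentiableOn ℝ S (Icc 0 1 ×ˢ halfSpace ℓ) := hSs.differentiableOn (by simp)
  have hXd : DifferentiableOn ℝ X (Icc 0 1 ×ˢ halfSpace ℓ) := hX.differentiableOn (by simp)
  have hKd : DifferentiableOn ℝ K (Icc 0 1 ×ˢ halfSpace ℓ) := hK.differentiableOn (by simp)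
  have hhd : DifferentiableOn ℝ h (Icc 0 1 ×ˢ halfSpace ℓ) := hh.differentiableOn (by simp)
  have mφ : MapsTo (fun p : ℝ × E ↦ (p.1, φ p)) (Icc (0 : ℝ) 1 ×ˢ halfSpace ℓ)
      (Icc (0 : ℝ) 1 ×ˢ halfSpace ℓ) := fun p hp ↦ ⟨hp.1, hφC hp⟩
  have hpair : DifferentiableOn ℝ (fun p : ℝ × E ↦ (p.1, φ p)) (Icc 0 1 ×ˢ halfSpace ℓ) :=
    differentiableOn_fst.prodMk hφd
  suffices hd : ∀ s ∈ Icc (0 : ℝ) 1, HasDerivWithinAt (fun s ↦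
      θ (φ (s, y)) (spatialFDerivWithin φ (halfSpace ℓ) (s, y) v) -
        spatialFDerivWithin S (halfSpace ℓ) (s, y) v) 0 (Icc 0 1) s by
    have h1 := eq_of_hasDerivWithinAt_zero hd ht
    have h2 : spatialFDerivWithin φ (halfSpace ℓ) (0, y) = ContinuousLinearMap.id ℝ E :=
      spatialFDerivWithin_eq hH hφd zero_mem hy.1
        ((hasFDerivWithinAt_id y _).congr (fun z hz ↦ hφ0 z hz) (hφ0 y hy.1))
    have h3 : spatialFDerivWithin S (halfSpace ℓ) (0, y) = 0 :=
      spatialFDerivWithin_eq hH hSd zero_mem hy.1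
        ((hasFDerivWithinAt_const 0 y _).congr (fun z hz ↦ hS0 z hz) (hS0 y hy.1))
    simp only [h2, h3, hφ0 y hy.1, ContinuousLinearMap.id_apply, zero_apply, sub_zero] at h1
    linarith
  intro s hs
  set z := φ (s, y) with hz
  have hzH : z ∈ halfSpace ℓ := hφC ⟨hs, hy.1⟩
  have hzO : z ∈ O := hφO s hs y hy
  set w := spatialFDerivWithin φ (halfSpace ℓ) (s, y) v with hw
  have hθd : HasFDerivWithinAt θ (fderivWithin ℝ θ (halfSpace ℓ) z) (halfSpace ℓ) z :=
    (((hθ.differentiableOn (by simp)) z ⟨hzH, hzO⟩).mono_of_mem_nhdsWithin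
      (inter_mem_nhdsWithin _ (hO.mem_nhds hzO))).hasFDerivWithinAt
  have hXz := hasFDerivWithinAt_spatialFDerivWithin hXd hs hzH
  have hKz := hasFDerivWithinAt_spatialFDerivWithin hKd hs hzH
  have hhz := hasFDerivWithinAt_spatialFDerivWithin hhd hs hzH
  have d1 : HasDerivWithinAt (fun s ↦ θ (φ (s, y)))
      (fderivWithin ℝ θ (halfSpace ℓ) z (X (s, z))) (Icc 0 1) s :=
    HasFDerivWithinAt.comp_hasDerivWithinAt (f := fun s ↦ φ (s, y)) s hθd (hφ y hy.1 s hs)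
      fun r hr ↦ hφC ⟨hr, hy.1⟩
  have d2 := hasDerivWithinAt_spatialFDerivWithin (W := fun p ↦ X (p.1, φ p)) convex_halfSpace hHi
    hφs hφ hy.1 hs v
  rw [spatialFDerivWithin_apply_apply hH hs hy.1 (g := fun p ↦ X (p.1, φ p)) (f := X) (φ := φ) (hXd.comp hpair mφ)
    (fun _ _ ↦ rfl) hXz hφd fun q hq ↦ hφC ⟨hs, hq⟩] at d2
  have d3 := hasDerivWithinAt_spatialFDerivWithin (W := fun p ↦ h (p.1, φ p)) convex_halfSpace hHi
    hSs hS hy.1 hs v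
  rw [spatialFDerivWithin_apply_apply hH hs hy.1 (g := fun p ↦ h (p.1, φ p)) (f := h) (φ := φ) (hhd.comp hpair mφ)
    (fun _ _ ↦ rfl) hhz hφd fun q hq ↦ hφC ⟨hs, hq⟩] at d3
  have e1 : spatialFDerivWithin h (halfSpace ℓ) (s, z) w =
      fderivWithin ℝ θ (halfSpace ℓ) z w (X (s, z)) +
        θ z (spatialFDerivWithin X (halfSpace ℓ) (s, z) w) -
        spatialFDerivWithin K (halfSpace ℓ) (s, z) w := by
    have h5 := (hθd.clm_apply hXz).sub hKz
    have h6 : (fun q ↦ h (s, q)) =ᶠ[𝓝[halfSpace ℓ] z] fun q ↦ θ q (X (s, q)) - K (s, q) := by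
      filter_upwards [self_mem_nhdsWithin, mem_nhdsWithin_of_mem_nhds (hO.mem_nhds hzO)]
        with q hq hqO using hhX s hs q ⟨hq, hqO⟩
    rw [spatialFDerivWithin_eq hH hhd hs hzH
      (h5.congr_of_eventuallyEq h6 (hhX s hs z ⟨hzH, hzO⟩))]
    simp [add_comm]
  have e2 := hXK s hs z ⟨hzH, hzO⟩ w
  rw [oneFormDeriv_apply] at e2
  refine ((d1.clm_apply d2).sub d3).congr_deriv ?_
  simp only [ContinuousLinearMap.comp_apply, ← hw, ← hz, e1]
  linarith

/-- The local theorem on a half-space. For a one-form `θ` whose Liouville field points outwards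
along the boundary, and a function `G` with compact support, vanishing on the boundary, there is a
compactly supported Hamiltonian isotopy `φ`, fixing the boundary, such that `φ_1^* θ = θ + dS`
where `S = G` near the boundary. -/
theorem exists_local_isotopy (he : ℓ e = 1) {O C : Set E} (hO : IsOpen O)
    {θ : E → E →L[ℝ] ℝ} (hθ : ContDiffOn ℝ ∞ θ (halfSpace ℓ ∩ O))
    (hnd : ∀ y ∈ halfSpace ℓ ∩ O, ∀ v, (∀ w, oneFormDeriv (halfSpace ℓ) θ y v w = 0) → v = 0)
    (hout : ∀ y ∈ O, ℓ y = 0 → ∀ z, oneFormDeriv (halfSpace ℓ) θ y z = θ y → ℓ z < 0)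
    {G : E → ℝ} (hG : ContDiffOn ℝ ∞ G (halfSpace ℓ)) (hC : IsCompact C) (hCO : C ⊆ O)
    (hGC : ∀ y ∈ halfSpace ℓ, y ∉ C → G y = 0) (hG0 : ∀ y, ℓ y = 0 → G y = 0) :
    ∃ (φ X : ℝ × E → E) (K : ℝ × E → ℝ) (S : E → ℝ) (Q : Set E), IsCompact Q ∧ Q ⊆ O ∧
      ContDiffOn ℝ ∞ φ (Icc 0 1 ×ˢ halfSpace ℓ) ∧ ContDiffOn ℝ ∞ K (Icc 0 1 ×ˢ halfSpace ℓ) ∧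
      ContDiffOn ℝ ∞ S (halfSpace ℓ) ∧ MapsTo φ (Icc 0 1 ×ˢ halfSpace ℓ) (halfSpace ℓ) ∧
      (∀ t ∈ Icc (0 : ℝ) 1, ∃ ψ : E → E, ContDiffOn ℝ ∞ ψ (halfSpace ℓ) ∧
        MapsTo ψ (halfSpace ℓ) (halfSpace ℓ) ∧ (∀ y ∈ halfSpace ℓ, ψ (φ (t, y)) = y) ∧
        ∀ y ∈ halfSpace ℓ, φ (t, ψ y) = y) ∧
      (∀ y ∈ halfSpace ℓ, φ (0, y) = y) ∧
      (∀ t ∈ Icc (0 : ℝ) 1, ∀ y, ℓ y = 0 → φ (t, y) = y) ∧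
      (∀ t ∈ Icc (0 : ℝ) 1, ∀ y ∈ halfSpace ℓ, y ∉ Q → φ (t, y) = y) ∧
      (∀ t ∈ Icc (0 : ℝ) 1, ∀ y ∈ halfSpace ℓ, y ∉ Q → K (t, y) = 0) ∧
      (∀ y ∈ halfSpace ℓ, y ∉ Q → S y = 0) ∧
      (∀ y ∈ halfSpace ℓ, ∀ t ∈ Icc (0 : ℝ) 1,
        HasDerivWithinAt (fun s ↦ φ (s, y)) (X (t, φ (t, y))) (Icc 0 1) t) ∧
      (∀ t ∈ Icc (0 : ℝ) 1, ∀ y ∈ halfSpace ℓ ∩ O, ∀ w,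
        oneFormDeriv (halfSpace ℓ) θ y (X (t, y)) w =
          -spatialFDerivWithin K (halfSpace ℓ) (t, y) w) ∧
      (∀ y ∈ halfSpace ℓ ∩ O, ∀ v, θ (φ (1, y)) (fderivWithin ℝ (fun z ↦ φ (1, z)) (halfSpace ℓ) y v) =
        θ y v + fderivWithin ℝ S (halfSpace ℓ) y v) ∧
      ∀ y, ℓ y = 0 → ∀ᶠ z in 𝓝[halfSpace ℓ] y, S z = G z := by
  have hH := uniqueDiffOn_halfSpace he
  have one_mem : (1 : ℝ) ∈ Icc (0 : ℝ) 1 := ⟨zero_le_one, le_rfl⟩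
  obtain ⟨K, Q, δ, hK, hQ, hQO, hδ, hKQ, hK0, hKeq⟩ :=
    exists_hamiltonian he hO hθ hnd hout hG hC hCO hGC hG0
  have hωs := contDiffOn_oneFormDeriv hH hO hθ
  have hKd : DifferentiableOn ℝ K (Icc 0 1 ×ˢ halfSpace ℓ) := hK.differentiableOn (by simp)
  have hGd : DifferentiableOn ℝ G (halfSpace ℓ) := hG.differentiableOn (by simp)
  have hDK : ContDiffOn ℝ ∞ (spatialFDerivWithin K (halfSpace ℓ)) (Icc 0 1 ×ˢ halfSpace ℓ) :=
    contDiffOn_spatialFDerivWithin hH (by simpa using hK)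
  have hDKQ : ∀ τ ∈ Icc (0 : ℝ) 1, ∀ y ∈ halfSpace ℓ, y ∉ Q →
      spatialFDerivWithin K (halfSpace ℓ) (τ, y) = 0 := fun τ hτ y hy hyQ ↦ by
    refine spatialFDerivWithin_eq hH hKd hτ hy ?_
    refine (hasFDerivWithinAt_const (0 : ℝ) y _).congr_of_eventuallyEq ?_ (hKQ τ hτ y hy hyQ)
    filter_upwards [self_mem_nhdsWithin, mem_nhdsWithin_of_mem_nhds
      (hQ.isClosed.isOpen_compl.mem_nhds hyQ)] with z hz hzC using hKQ τ hτ z hz hzC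
  have hm : MapsTo Prod.snd (Icc (0 : ℝ) 1 ×ˢ (halfSpace ℓ ∩ O)) (halfSpace ℓ ∩ O) := fun p hp ↦ hp.2
  have hsub : Icc (0 : ℝ) 1 ×ˢ (halfSpace ℓ ∩ O) ⊆ Icc (0 : ℝ) 1 ×ˢ halfSpace ℓ :=
    prod_mono_right inter_subset_left
  let X : ℝ × E → E := fun p ↦
    (oneFormDeriv (halfSpace ℓ) θ p.2).inverse (-spatialFDerivWithin K (halfSpace ℓ) p)
  have hXQ : ∀ τ ∈ Icc (0 : ℝ) 1, ∀ y ∈ halfSpace ℓ, y ∉ Q → X (τ, y) = 0 :=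
    fun τ hτ y hy hyQ ↦ by simp [X, hDKQ τ hτ y hy hyQ]
  have hXO : ContDiffOn ℝ ∞ X (Icc 0 1 ×ˢ (halfSpace ℓ ∩ O)) :=
    ((contDiffOn_inverse_of_nondegenerate hωs hnd).comp contDiffOn_snd hm).clm_apply
      (hDK.mono hsub).neg
  have hX : ContDiffOn ℝ ∞ X (Icc 0 1 ×ˢ halfSpace ℓ) :=
    contDiffOn_Icc_prod_of_eq_zero hO hQ.isClosed hQO hXO fun p hp h ↦ hXQ p.1 hp.1 p.2 hp.2 h
  have hX0 : ∀ τ ∈ Icc (0 : ℝ) 1, ∀ y, ℓ y = 0 → X (τ, y) = 0 :=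
    fun τ hτ y hy ↦ by simp [X, (hK0 τ hτ y hy).2]
  have hXK : ∀ τ ∈ Icc (0 : ℝ) 1, ∀ y ∈ halfSpace ℓ ∩ O, oneFormDeriv (halfSpace ℓ) θ y (X (τ, y)) =
      -spatialFDerivWithin K (halfSpace ℓ) (τ, y) :=
    fun τ _ y hy ↦ inverse_apply_of_nondegenerate (hnd y hy) _
  let h : ℝ × E → ℝ := fun p ↦ θ p.2 (X p) - K p
  have hhQ : ∀ τ ∈ Icc (0 : ℝ) 1, ∀ y ∈ halfSpace ℓ, y ∉ Q → h (τ, y) = 0 :=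
    fun τ hτ y hy hyQ ↦ by simp [h, hXQ τ hτ y hy hyQ, hKQ τ hτ y hy hyQ]
  have hh : ContDiffOn ℝ ∞ h (Icc 0 1 ×ˢ halfSpace ℓ) :=
    contDiffOn_Icc_prod_of_eq_zero hO hQ.isClosed hQO
      (((hθ.comp contDiffOn_snd hm).clm_apply hXO).sub (hK.mono hsub))
      fun p hp hpQ ↦ hhQ p.1 hp.1 p.2 hp.2 hpQ
  obtain ⟨φ, S, hφs, hSs, hφC, hφ0, hS0, hφ, hS⟩ := exists_flow_of_isCompact he hQ hX hh hXQ hhQ hX0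
  obtain ⟨-, k, -, hk⟩ := exists_bound_and_lipschitzOnWith_of_eq_zero convex_halfSpace
    isClosed_halfSpace hH hQ hX hXQ
  -- zeros of the field are fixed points of the flow
  have hfix : ∀ z ∈ halfSpace ℓ, (∀ τ ∈ Icc (0 : ℝ) 1, X (τ, z) = 0) → ∀ y ∈ halfSpace ℓ,
      ∀ s ∈ Icc (0 : ℝ) 1, φ (s, y) = z → ∀ t ∈ Icc (0 : ℝ) 1, φ (t, y) = z := by
    intro z hz hXz y hy s hs hsz t ht
    exact eqOn_of_hasDerivWithinAt_of_lipschitzOnWith hk (hφ y hy) (β := fun _ ↦ z)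
      (fun r hr ↦ by simpa only [hXz r hr] using hasDerivWithinAt_const r (Icc (0 : ℝ) 1) z)
      (fun r hr ↦ hφC ⟨hr, hy⟩) (fun _ _ ↦ hz) hs hsz ht
  have zero_mem : (0 : ℝ) ∈ Icc (0 : ℝ) 1 := ⟨le_rfl, zero_le_one⟩
  have hφQ : ∀ t ∈ Icc (0 : ℝ) 1, ∀ y ∈ halfSpace ℓ, y ∉ Q → φ (t, y) = y := fun t ht y hy hyQ ↦
    hfix y hy (fun τ hτ ↦ hXQ τ hτ y hy hyQ) y hy 0 zero_mem (hφ0 y hy) t ht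
  have hφO : ∀ τ ∈ Icc (0 : ℝ) 1, ∀ y ∈ halfSpace ℓ ∩ O, φ (τ, y) ∈ O := fun τ hτ y hy ↦ by
    by_cases hyQ : φ (τ, y) ∈ Q
    · exact hQO hyQ
    · have := hfix _ (hφC ⟨hτ, hy.1⟩) (fun s hs ↦ hXQ s hs _ (hφC ⟨hτ, hy.1⟩) hyQ) y hy.1 τ hτ rfl
        0 zero_mem
      rw [hφ0 y hy.1] at this
      rw [← this]
      exact hy.2
  have hSQ : ∀ t ∈ Icc (0 : ℝ) 1, ∀ y ∈ halfSpace ℓ, y ∉ Q → S (t, y) = 0 := fun t ht y hy hyQ ↦ by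
    rw [eq_of_hasDerivWithinAt_zero (f := fun t ↦ S (t, y)) (fun s hs ↦ ?_) ht, hS0 y hy]
    have := hS y hy s hs
    rwa [hφQ s hs y hy hyQ, hhQ s hs y hy hyQ] at this
  have hmk : ContDiff ℝ ∞ (fun y : E ↦ ((1 : ℝ), y)) := by fun_prop
  have hmk' : MapsTo (fun y : E ↦ ((1 : ℝ), y)) (halfSpace ℓ) (Icc (0 : ℝ) 1 ×ˢ halfSpace ℓ) :=
    fun y hy ↦ ⟨one_mem, hy⟩
  have hS1 : ContDiffOn ℝ ∞ (fun y ↦ S (1, y)) (halfSpace ℓ) := hSs.comp hmk.contDiffOn hmk'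
  have hφb : ∀ t ∈ Icc (0 : ℝ) 1, ∀ y, ℓ y = 0 → φ (t, y) = y := fun t ht y hy ↦
    hfix y hy.ge (fun τ hτ ↦ hX0 τ hτ y hy) y hy.ge 0 zero_mem (hφ0 y hy.ge) t ht
  have hXKw : ∀ t ∈ Icc (0 : ℝ) 1, ∀ y ∈ halfSpace ℓ ∩ O, ∀ w,
      oneFormDeriv (halfSpace ℓ) θ y (X (t, y)) w =
        -spatialFDerivWithin K (halfSpace ℓ) (t, y) w := fun t ht y hy w ↦ by
    rw [hXK t ht y hy]
    rfl
  refine ⟨φ, X, K, fun y ↦ S (1, y), Q, hQ, hQO, hφs, hK, hS1, hφC,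
    fun t ht ↦ exists_inverse_of_flow he hQ hX hXQ hX0 hφC hφ0 hφ ht, hφ0, hφb, hφQ, hKQ,
    hSQ 1 one_mem, hφ, hXKw, fun y hy v ↦ ?_, fun y hy ↦ ?_⟩
  · rw [(hasFDerivWithinAt_spatialFDerivWithin (hφs.differentiableOn (by simp)) one_mem
      hy.1).fderivWithin (hH y hy.1), (hasFDerivWithinAt_spatialFDerivWithin
      (hSs.differentiableOn (by simp)) one_mem hy.1).fderivWithin (hH y hy.1)]
    exact pullback_flow_eq he hO hθ hX hK hh hφs hSs hXKw (fun _ _ _ _ ↦ rfl) hφC hφO hφ0 hS0 hφ hS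
      one_mem hy v
  -- near a boundary point the trajectories stay in the region where `dK(Z_τ) = K + G`
  have hyH : y ∈ halfSpace ℓ := hy.ge
  by_cases hyO : y ∈ O
  swap
  · filter_upwards [self_mem_nhdsWithin, mem_nhdsWithin_of_mem_nhds
      (hQ.isClosed.isOpen_compl.mem_nhds fun h ↦ hyO (hQO h)), mem_nhdsWithin_of_mem_nhds
      (hC.isClosed.isOpen_compl.mem_nhds fun h ↦ hyO (hCO h))] with z hz hzQ hzC
    rw [hSQ 1 one_mem z hz hzQ, hGC z hz hzC]
  have hnear : ∀ᶠ z in 𝓝[halfSpace ℓ] y, ∀ t ∈ Icc (0 : ℝ) 1, ℓ (φ (t, z)) < δ := by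
    refine eventually_forall_mem_lt_of_continuousOn (g := fun p : E × ℝ ↦ ℓ (φ (p.2, p.1)))
      (ℓ.continuous.comp_continuousOn (hφs.continuousOn.comp continuous_swap.continuousOn
        fun p hp ↦ ⟨hp.2, hp.1⟩)) isCompact_Icc hyH fun t ht ↦ ?_
    simpa [hφb t ht y hy, hy] using hδ
  filter_upwards [self_mem_nhdsWithin, mem_nhdsWithin_of_mem_nhds (hO.mem_nhds hyO), hnear]
    with z hz hzO hzδ
  have hd : ∀ t ∈ Icc (0 : ℝ) 1,
      HasDerivWithinAt (fun t ↦ S (t, z) + (1 - t) * G (φ (t, z))) 0 (Icc 0 1) t := fun t ht ↦ by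
    set q := φ (t, z) with hq
    have hqH : q ∈ halfSpace ℓ ∩ O := ⟨hφC ⟨ht, hz⟩, hφO t ht z ⟨hz, hzO⟩⟩
    have d1 : HasDerivWithinAt (fun s ↦ G (φ (s, z)))
        (fderivWithin ℝ G (halfSpace ℓ) q (X (t, q))) (Icc 0 1) t :=
      HasFDerivWithinAt.comp_hasDerivWithinAt (f := fun s ↦ φ (s, z)) t
        (hGd q hqH.1).hasFDerivWithinAt (hφ z hz t ht) fun r hr ↦ hφC ⟨hr, hz⟩
    have d2 : HasDerivWithinAt (fun s : ℝ ↦ 1 - s) (-1) (Icc 0 1) t :=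
      ((hasDerivAt_id t).const_sub 1).hasDerivWithinAt
    refine ((hS z hz t ht).add (d2.mul d1)).congr_deriv ?_
    have h1 := inverse_apply_of_nondegenerate (hnd q hqH)
      (θ q + (1 - t) • fderivWithin ℝ G (halfSpace ℓ) q)
    set Z := (oneFormDeriv (halfSpace ℓ) θ q).inverse
      (θ q + (1 - t) • fderivWithin ℝ G (halfSpace ℓ) q) with hZ
    have h2 := hKeq t ht q hqH (hzδ t ht) Z h1
    have h3 : oneFormDeriv (halfSpace ℓ) θ q Z (X (t, q)) =
        θ q (X (t, q)) + (1 - t) * fderivWithin ℝ G (halfSpace ℓ) q (X (t, q)) := by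
      rw [h1]
      rfl
    rw [oneFormDeriv_swap, hXKw t ht q hqH, neg_neg] at h3
    simp only [h, ← hq]
    linarith
  have h1 := eq_of_hasDerivWithinAt_zero hd one_mem
  simpa [hS0 z hz, hφ0 z hz] using h1

end Local

/-! ### Exterior derivatives and pullbacks in coordinates -/

section Pullback

variable {E E' : Type*} [NormedAddCommGroup E] [NormedSpace ℝ E]
  [FiniteDimensional ℝ E] [NormedAddCommGroup E'] [NormedSpace ℝ E'] [FiniteDimensional ℝ E']

/-- The exterior derivative commutes with pullback. -/
theorem oneFormDeriv_pullback {H : Set E} {H' : Set E'} {T : E' → E} {θ : E → E →L[ℝ] ℝ}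
    {θ' : E' → E' →L[ℝ] ℝ} {y : E'} (hH' : UniqueDiffOn ℝ H') (hy : y ∈ H')
    (hyc : y ∈ closure (interior H')) (hT : ContDiffWithinAt ℝ ∞ T H' y)
    (hTH : ∀ᶠ z in 𝓝[H'] y, T z ∈ H) (hθ : DifferentiableWithinAt ℝ θ H (T y))
    (hθ' : ∀ᶠ z in 𝓝[H'] y, θ' z = (θ (T z)).comp (fderivWithin ℝ T H' z)) (v w : E') :
    oneFormDeriv H' θ' y v w =
      oneFormDeriv H θ (T y) (fderivWithin ℝ T H' y v) (fderivWithin ℝ T H' y w) := by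
  have hTd : HasFDerivWithinAt T (fderivWithin ℝ T H' y) H' y :=
    (hT.differentiableWithinAt (by simp)).hasFDerivWithinAt
  have hDT : DifferentiableWithinAt ℝ (fderivWithin ℝ T H') H' y :=
    (hT.fderivWithin_right (m := 1) hH' (by simp only [one_add_one_eq_two]; exact ENat.LEInfty.out)
      hy).differentiableWithinAt (by simp)
  have h1 : HasFDerivWithinAt (fun z ↦ θ (T z))
      ((fderivWithin ℝ θ H (T y)).comp (fderivWithin ℝ T H' y)) H' y := by
    refine (HasFDerivWithinAt.comp (t := H) (g := θ) (f := T) (s := H' ∩ {z | T z ∈ H}) y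
      hθ.hasFDerivWithinAt (hTd.mono inter_subset_left) fun z hz ↦ hz.2).mono_of_mem_nhdsWithin ?_
    filter_upwards [self_mem_nhdsWithin, hTH] with z h1 h2 using ⟨h1, h2⟩
  have h2 := (h1.clm_comp hDT.hasFDerivWithinAt).congr_of_eventuallyEq hθ' (hθ'.self_of_nhdsWithin hy)
  have hs : IsSymmSndFDerivWithinAt ℝ T H' y :=
    hT.isSymmSndFDerivWithinAt
      (by simp only [minSmoothness_of_isRCLikeNormedField]; exact ENat.LEInfty.out) hH' hyc hy
  rw [oneFormDeriv_apply, oneFormDeriv_apply, h2.fderivWithin (hH' y hy)]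
  have h3 := hs.eq v w
  simp [h3]

end Pullback

section Charts

variable {m : ℕ} [NeZero m]

/-- The functional defining the model half-space. -/
noncomputable def firstCoord (m : ℕ) [NeZero m] : EuclideanSpace ℝ (Fin m) →L[ℝ] ℝ :=
  EuclideanSpace.proj 0

@[simp] theorem firstCoord_apply (y : EuclideanSpace ℝ (Fin m)) : firstCoord m y = y 0 := rfl

theorem firstCoord_single : firstCoord m (EuclideanSpace.single 0 1) = 1 := by simp

theorem range_model : range (𝓡∂ m) = halfSpace (firstCoord m) :=
  range_modelWithCornersEuclideanHalfSpace m

theorem uniqueDiffOn_range_model : UniqueDiffOn ℝ (range (𝓡∂ m)) :=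
  range_model (m := m) ▸ uniqueDiffOn_halfSpace firstCoord_single

theorem subset_closure_interior_range_model : range (𝓡∂ m) ⊆ closure (interior (range (𝓡∂ m))) :=
  range_model (m := m) ▸ subset_closure_interior_halfSpace firstCoord_single

variable {M : Type*} [TopologicalSpace M] [ChartedSpace (EuclideanHalfSpace m) M]

/-- The open subset of the coordinate space whose trace on the half-space is the target of the
preferred chart at `x`. -/
def chartOpen (x : M) : Set (EuclideanSpace ℝ (Fin m)) :=
  (𝓡∂ m).symm ⁻¹' (chartAt (EuclideanHalfSpace m) x).target

theorem isOpen_chartOpen (x : M) : IsOpen (chartOpen (m := m) x) :=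
  (chartAt (EuclideanHalfSpace m) x).open_target.preimage (𝓡∂ m).continuous_symm

theorem extChartAt_target_eq (x : M) :
    (extChartAt (𝓡∂ m) x).target = halfSpace (firstCoord m) ∩ chartOpen x := by
  rw [extChartAt_target, range_model, inter_comm]
  rfl

variable [IsManifold (𝓡∂ m) ∞ M]

theorem mem_boundary_iff_of_mem_source (x₀ : M) {x : M} (hx : x ∈ (extChartAt (𝓡∂ m) x₀).source) :
    x ∈ (𝓡∂ m).boundary M ↔ firstCoord m (extChartAt (𝓡∂ m) x₀ x) = 0 := by
  have h := ModelWithCorners.isInteriorPoint_iff_of_mem_atlas (I := 𝓡∂ m) (n := ∞) (by simp)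
    (chart_mem_atlas (EuclideanHalfSpace m) x₀) (x := x) (by simpa using hx)
  change _ ↔ extChartAt (𝓡∂ m) x₀ x ∈ interior (extChartAt (𝓡∂ m) x₀).target at h
  have ht := (extChartAt (𝓡∂ m) x₀).map_source hx
  rw [extChartAt_target_eq, interior_inter, (isOpen_chartOpen x₀).interior_eq, ← range_model,
    interior_range_modelWithCornersEuclideanHalfSpace] at h
  rw [extChartAt_target_eq] at ht
  rw [← ModelWithCorners.compl_interior, mem_compl_iff, ModelWithCorners.interior, mem_ofPred_eq, h]
  have h0 : 0 ≤ firstCoord m (extChartAt (𝓡∂ m) x₀ x) := ht.1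
  have : firstCoord m (extChartAt (𝓡∂ m) x₀ x) = extChartAt (𝓡∂ m) x₀ x 0 := rfl
  simp only [mem_inter_iff, mem_ofPred_eq, ht.2, and_true, ← this, not_lt]
  exact ⟨fun h ↦ le_antisymm h h0, fun h ↦ h.le⟩

variable {m' : ℕ} [NeZero m'] {N : Type*} [TopologicalSpace N]
  [ChartedSpace (EuclideanHalfSpace m') N] [IsManifold (𝓡∂ m') ∞ N]

/-- The coordinate expression of a map in the preferred charts at `p` and `x`. -/
noncomputable def coordMap (x : M) (p : N) (f : N → M) : EuclideanSpace ℝ (Fin m') → EuclideanSpace ℝ (Fin m) :=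
  extChartAt (𝓡∂ m) x ∘ f ∘ (extChartAt (𝓡∂ m') p).symm

theorem fderivWithin_coordMap {x : M} {p : N} {f : N → M} {y : EuclideanSpace ℝ (Fin m')}
    (hy : y ∈ (extChartAt (𝓡∂ m') p).target)
    (hf : MDifferentiableAt (𝓡∂ m') (𝓡∂ m) f ((extChartAt (𝓡∂ m') p).symm y))
    (hx : f ((extChartAt (𝓡∂ m') p).symm y) ∈ (extChartAt (𝓡∂ m) x).source)
    (v : EuclideanSpace ℝ (Fin m')) :
    fderivWithin ℝ (coordMap x p f) (range (𝓡∂ m')) y v =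
      mfderiv (𝓡∂ m) 𝓘(ℝ, EuclideanSpace ℝ (Fin m)) (extChartAt (𝓡∂ m) x)
        (f ((extChartAt (𝓡∂ m') p).symm y))
        (mfderiv (𝓡∂ m') (𝓡∂ m) f ((extChartAt (𝓡∂ m') p).symm y)
          (mfderivWithin 𝓘(ℝ, EuclideanSpace ℝ (Fin m')) (𝓡∂ m') (extChartAt (𝓡∂ m') p).symm
            (range (𝓡∂ m')) y v)) := by
  have hu : UniqueMDiffWithinAt 𝓘(ℝ, EuclideanSpace ℝ (Fin m')) (range (𝓡∂ m')) y :=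
    (𝓡∂ m').uniqueMDiffOn y (extChartAt_target_subset_range p hy)
  rw [← mfderivWithin_eq_fderivWithin, coordMap]
  have h1 := mdifferentiableAt_extChartAt (I := 𝓡∂ m) (x := x) (by simpa using hx)
  have h2 := mdifferentiableWithinAt_extChartAt_symm (I := 𝓡∂ m') hy
  have h3 := (h1.hasMFDerivAt.comp _ hf.hasMFDerivAt).comp_hasMFDerivWithinAt
    (f := (extChartAt (𝓡∂ m') p).symm) _ h2.hasMFDerivWithinAt
  have h4 := h3.mfderivWithin hu
  rw [Function.comp_assoc] at h4
  rw [h4]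
  rfl

theorem inChart_apply_mfderiv (θ : OneForm m M) {x₀ x : M}
    (hx : x ∈ (extChartAt (𝓡∂ m) x₀).source) (v : TangentSpace (𝓡∂ m) x) :
    θ.inChart x₀ (extChartAt (𝓡∂ m) x₀ x)
      (mfderiv (𝓡∂ m) 𝓘(ℝ, EuclideanSpace ℝ (Fin m)) (extChartAt (𝓡∂ m) x₀) x v) = θ x v := by
  have h := mfderivWithin_extChartAt_symm_comp_mfderiv_extChartAt' hx
  have h' := congrArg (fun A ↦ A v) h
  have e := (extChartAt (𝓡∂ m) x₀).left_inv hx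
  have key : ∀ x' (u : EuclideanSpace ℝ (Fin m)), x' = x →
      (θ x' : EuclideanSpace ℝ (Fin m) →L[ℝ] ℝ) u = (θ x : EuclideanSpace ℝ (Fin m) →L[ℝ] ℝ) u := by
    rintro _ _ rfl
    rfl
  refine (key _ _ e).trans ?_
  exact congrArg (θ x) h'

/-- In coordinates, the pullback of `θ` by `f`. -/
theorem inChart_comp_fderivWithin (θ : OneForm m M) {x : M} {p : N} {f : N → M}
    {y : EuclideanSpace ℝ (Fin m')} (hy : y ∈ (extChartAt (𝓡∂ m') p).target)
    (hf : MDifferentiableAt (𝓡∂ m') (𝓡∂ m) f ((extChartAt (𝓡∂ m') p).symm y))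
    (hx : f ((extChartAt (𝓡∂ m') p).symm y) ∈ (extChartAt (𝓡∂ m) x).source)
    (v : EuclideanSpace ℝ (Fin m')) :
    θ.inChart x (coordMap x p f y) (fderivWithin ℝ (coordMap x p f) (range (𝓡∂ m')) y v) =
      θ (f ((extChartAt (𝓡∂ m') p).symm y))
        (mfderiv (𝓡∂ m') (𝓡∂ m) f ((extChartAt (𝓡∂ m') p).symm y)
          (mfderivWithin 𝓘(ℝ, EuclideanSpace ℝ (Fin m')) (𝓡∂ m') (extChartAt (𝓡∂ m') p).symm
            (range (𝓡∂ m')) y v)) := by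
  rw [fderivWithin_coordMap hy hf hx]
  exact inChart_apply_mfderiv θ hx _

theorem contDiffOn_inChart (θ : OneForm m M) (x₀ : M) :
    ContDiffOn ℝ ∞ (θ.inChart x₀) (halfSpace (firstCoord m) ∩ chartOpen x₀) := by
  rw [← extChartAt_target_eq, ← contMDiffOn_iff_contDiffOn]
  have h1 := θ.contMDiff.contMDiffOn (s := (chartAt (EuclideanHalfSpace m) x₀).source)
  rw [Bundle.Trivialization.contMDiffOn_section_iff (trivializationAt (EuclideanSpace ℝ (Fin m) →L[ℝ] ℝ)
    (fun x : M => TangentSpace (𝓡∂ m) x →L[ℝ] ℝ) x₀) (chartAt _ x₀).open_source (by simp)] at h1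
  have h2 := h1.comp (contMDiffOn_extChartAt_symm (I := 𝓡∂ m) (n := ∞) x₀) (fun y hy ↦ by
    simpa using (extChartAt (𝓡∂ m) x₀).map_target hy)
  refine h2.congr fun y hy ↦ ?_
  have hy' := (extChartAt (𝓡∂ m) x₀).map_target hy
  rw [extChartAt_source] at hy'
  have := TangentBundle.symmL_trivializationAt (I := 𝓡∂ m) hy'
  rw [(extChartAt (𝓡∂ m) x₀).right_inv hy] at this
  simp only [Function.comp_apply]
  rw [hom_trivializationAt_apply, OneForm.inChart, ContinuousLinearMap.inCoordinates, this]
  ext v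
  simp

end Charts

theorem oneFormDeriv_fderivWithin {E : Type*} [NormedAddCommGroup E] [NormedSpace ℝ E]
    [FiniteDimensional ℝ E] {H : Set E} {F : E → ℝ} {y : E} (hH : UniqueDiffOn ℝ H) (hy : y ∈ H)
    (hyc : y ∈ closure (interior H)) (hF : ContDiffWithinAt ℝ ∞ F H y) (v w : E) :
    oneFormDeriv H (fderivWithin ℝ F H) y v w = 0 := by
  have hs : IsSymmSndFDerivWithinAt ℝ F H y :=
    hF.isSymmSndFDerivWithinAt
      (by simp only [minSmoothness_of_isRCLikeNormedField]; exact ENat.LEInfty.out) hH hyc hy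
  rw [oneFormDeriv_apply, hs.eq v w, sub_self]

section Charts

variable {m : ℕ} [NeZero m] {M : Type*} [TopologicalSpace M]
  [ChartedSpace (EuclideanHalfSpace m) M] [IsManifold (𝓡∂ m) ∞ M]
  {m' : ℕ} [NeZero m'] {N : Type*} [TopologicalSpace N]
  [ChartedSpace (EuclideanHalfSpace m') N] [IsManifold (𝓡∂ m') ∞ N]

theorem differentiableWithinAt_inChart (θ : OneForm m M) (x₀ : M) {y : EuclideanSpace ℝ (Fin m)}
    (hy : y ∈ (extChartAt (𝓡∂ m) x₀).target) :
    DifferentiableWithinAt ℝ (θ.inChart x₀) (range (𝓡∂ m)) y := by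
  have h := (contDiffOn_inChart θ x₀).differentiableOn (by simp)
  rw [← extChartAt_target_eq] at h
  exact (h y hy).mono_of_mem_nhdsWithin (extChartAt_target_mem_nhdsWithin_of_mem hy)

theorem eventually_coordMap_mem {x : M} {p : N} {f : N → M} {y : EuclideanSpace ℝ (Fin m')}
    (hy : y ∈ (extChartAt (𝓡∂ m') p).target)
    (hf : ContinuousAt f ((extChartAt (𝓡∂ m') p).symm y))
    (hx : f ((extChartAt (𝓡∂ m') p).symm y) ∈ (extChartAt (𝓡∂ m) x).source) :
    ∀ᶠ z in 𝓝[range (𝓡∂ m')] y, z ∈ (extChartAt (𝓡∂ m') p).target ∧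
      f ((extChartAt (𝓡∂ m') p).symm z) ∈ (extChartAt (𝓡∂ m) x).source := by
  have h1 : ContinuousWithinAt (f ∘ (extChartAt (𝓡∂ m') p).symm) (range (𝓡∂ m')) y :=
    hf.comp_continuousWithinAt (mdifferentiableWithinAt_extChartAt_symm hy).continuousWithinAt
  filter_upwards [extChartAt_target_mem_nhdsWithin_of_mem hy,
    h1 ((isOpen_extChartAt_source x).mem_nhds hx)] with z hz hz' using ⟨hz, hz'⟩

theorem contDiffWithinAt_coordMap {x : M} {p : N} {f : N → M} {y : EuclideanSpace ℝ (Fin m')}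
    (hy : y ∈ (extChartAt (𝓡∂ m') p).target)
    (hf : ContMDiffAt (𝓡∂ m') (𝓡∂ m) ∞ f ((extChartAt (𝓡∂ m') p).symm y))
    (hx : f ((extChartAt (𝓡∂ m') p).symm y) ∈ (extChartAt (𝓡∂ m) x).source) :
    ContDiffWithinAt ℝ ∞ (coordMap (m := m) x p f) (range (𝓡∂ m')) y := by
  rw [← contMDiffWithinAt_iff_contDiffWithinAt]
  have h1 : ContMDiffWithinAt 𝓘(ℝ, EuclideanSpace ℝ (Fin m')) (𝓡∂ m') ∞
      (extChartAt (𝓡∂ m') p).symm (range (𝓡∂ m')) y :=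
    (contMDiffOn_extChartAt_symm p y hy).mono_of_mem_nhdsWithin
      (extChartAt_target_mem_nhdsWithin_of_mem hy)
  have h2 : ContMDiffAt (𝓡∂ m) 𝓘(ℝ, EuclideanSpace ℝ (Fin m)) ∞ (extChartAt (𝓡∂ m) x)
      (f ((extChartAt (𝓡∂ m') p).symm y)) := contMDiffAt_extChartAt' (by simpa using hx)
  exact h2.comp_contMDiffWithinAt y (hf.comp_contMDiffWithinAt y h1)

/-- The exterior derivative can be computed in any preferred chart. -/
theorem d_eq_oneFormDeriv (θ : OneForm m M) {x₀ x : M}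
    (hx : x ∈ (extChartAt (𝓡∂ m) x₀).source) (v w : EuclideanSpace ℝ (Fin m)) :
    θ.d x v w = oneFormDeriv (halfSpace (firstCoord m)) (θ.inChart x₀) (extChartAt (𝓡∂ m) x₀ x)
      (mfderiv (𝓡∂ m) 𝓘(ℝ, EuclideanSpace ℝ (Fin m)) (extChartAt (𝓡∂ m) x₀) x v)
      (mfderiv (𝓡∂ m) 𝓘(ℝ, EuclideanSpace ℝ (Fin m)) (extChartAt (𝓡∂ m) x₀) x w) := by
  set y := extChartAt (𝓡∂ m) x x with hy
  have hyt : y ∈ (extChartAt (𝓡∂ m) x).target := mem_extChartAt_target x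
  have hsy : (extChartAt (𝓡∂ m) x).symm y = x := extChartAt_to_inv x
  have hyr : y ∈ range (𝓡∂ m) := extChartAt_target_subset_range x hyt
  have hx' : id ((extChartAt (𝓡∂ m) x).symm y) ∈ (extChartAt (𝓡∂ m) x₀).source := by
    rwa [hsy]
  have hT : coordMap x₀ x id y = extChartAt (𝓡∂ m) x₀ x := by
    simp only [coordMap, Function.comp_apply, id, hsy]
  -- the definition, unfolded in the preferred chart at `x`
  have h1 : θ.d x v w = oneFormDeriv (range (𝓡∂ m)) (θ.inChart x) y v w := by
    have hd := differentiableWithinAt_inChart θ x hyt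
    have hu := uniqueDiffOn_range_model (m := m) y hyr
    let L := ContinuousAlternatingMap.ofSubsingletonLIE (𝕜 := ℝ) (E := EuclideanSpace ℝ (Fin m)) (F := ℝ) (0 : Fin 1)
    have hL : DifferentiableWithinAt ℝ (fun z ↦ L (θ.inChart x z)) (range (𝓡∂ m)) y :=
      L.toContinuousLinearEquiv.differentiableAt.comp_differentiableWithinAt y hd
    have h2 := extDerivWithin_apply hL hu ![v, w]
    refine h2.trans ?_
    rw [Fin.sum_univ_two, oneFormDeriv_apply]
    have e : ∀ (u u' : EuclideanSpace ℝ (Fin m)),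
        fderivWithin ℝ (fun z ↦ θ.inChart x z u) (range (𝓡∂ m)) y u' =
          fderivWithin ℝ (θ.inChart x) (range (𝓡∂ m)) y u' u := fun u u' ↦ by
      rw [(hd.hasFDerivWithinAt.clm_apply (hasFDerivWithinAt_const u y _)).fderivWithin hu]
      simp
    have e0 : ∀ z, L (θ.inChart x z) (Fin.removeNth 0 ![v, w]) = θ.inChart x z w := fun _ ↦ rfl
    have e1 : ∀ z, L (θ.inChart x z) (Fin.removeNth 1 ![v, w]) = θ.inChart x z v := fun _ ↦ rfl
    simp only [e0, e1, e]
    simp [sub_eq_add_neg]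
  rw [h1]
  have h2 := oneFormDeriv_pullback (T := coordMap x₀ x id) (θ := θ.inChart x₀) (θ' := θ.inChart x)
    (H := range (𝓡∂ m)) uniqueDiffOn_range_model hyr (subset_closure_interior_range_model hyr)
    (contDiffWithinAt_coordMap hyt contMDiffAt_id hx') ?_ ?_ ?_ v w
  · have e : ∀ u : EuclideanSpace ℝ (Fin m), fderivWithin ℝ (coordMap x₀ x id) (range (𝓡∂ m)) y u =
        mfderiv (𝓡∂ m) 𝓘(ℝ, EuclideanSpace ℝ (Fin m)) (extChartAt (𝓡∂ m) x₀) x u := fun u ↦ by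
      have h3 := fderivWithin_coordMap hyt (mdifferentiableAt_id (I := 𝓡∂ m)) hx' u
      rw [mfderivWithin_range_extChartAt_symm] at h3
      rw [mfderiv_id] at h3
      have key : ∀ q, q = x → ∀ u : EuclideanSpace ℝ (Fin m),
          (mfderiv (𝓡∂ m) 𝓘(ℝ, EuclideanSpace ℝ (Fin m)) (extChartAt (𝓡∂ m) x₀) q :
            EuclideanSpace ℝ (Fin m) →L[ℝ] EuclideanSpace ℝ (Fin m)) u =
          (mfderiv (𝓡∂ m) 𝓘(ℝ, EuclideanSpace ℝ (Fin m)) (extChartAt (𝓡∂ m) x₀) x :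
            EuclideanSpace ℝ (Fin m) →L[ℝ] EuclideanSpace ℝ (Fin m)) u := by
        rintro _ rfl _
        rfl
      exact h3.trans (key _ hsy u)
    rw [h2, e, e, hT, range_model]
  · filter_upwards [eventually_coordMap_mem hyt continuousAt_id hx'] with z hz
    exact extChartAt_target_subset_range x₀ ((extChartAt (𝓡∂ m) x₀).map_source hz.2)
  · rw [hT]
    exact differentiableWithinAt_inChart θ x₀ ((extChartAt (𝓡∂ m) x₀).map_source hx)
  · filter_upwards [eventually_coordMap_mem hyt continuousAt_id hx'] with z hz
    ext u
    rw [ContinuousLinearMap.comp_apply, inChart_comp_fderivWithin θ hz.1 mdifferentiableAt_id hz.2,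
      mfderiv_id]
    rfl

/-- In coordinates, the differential of a function. -/
theorem fderivWithin_comp_extChartAt_symm {x₀ x : M} {F : M → ℝ}
    (hx : x ∈ (extChartAt (𝓡∂ m) x₀).source) (hF : MDifferentiableAt (𝓡∂ m) 𝓘(ℝ, ℝ) F x)
    (v : TangentSpace (𝓡∂ m) x) :
    fderivWithin ℝ (F ∘ (extChartAt (𝓡∂ m) x₀).symm) (range (𝓡∂ m)) (extChartAt (𝓡∂ m) x₀ x)
      (mfderiv (𝓡∂ m) 𝓘(ℝ, EuclideanSpace ℝ (Fin m)) (extChartAt (𝓡∂ m) x₀) x v) =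
      mfderiv (𝓡∂ m) 𝓘(ℝ, ℝ) F x v := by
  have hyt := (extChartAt (𝓡∂ m) x₀).map_source hx
  have e := (extChartAt (𝓡∂ m) x₀).left_inv hx
  have hu : UniqueMDiffWithinAt 𝓘(ℝ, EuclideanSpace ℝ (Fin m)) (range (𝓡∂ m))
      (extChartAt (𝓡∂ m) x₀ x) :=
    (𝓡∂ m).uniqueMDiffOn _ (extChartAt_target_subset_range x₀ hyt)
  rw [← mfderivWithin_eq_fderivWithin, mfderiv_comp_mfderivWithin_of_eq hF
    (mdifferentiableWithinAt_extChartAt_symm hyt) hu e]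
  have h := mfderivWithin_extChartAt_symm_comp_mfderiv_extChartAt' hx
  have h' := congrArg (fun A ↦ A v) h
  exact congrArg (mfderiv (𝓡∂ m) 𝓘(ℝ, ℝ) F x) h'

theorem contDiffOn_comp_extChartAt_symm {x₀ : M} {F : M → ℝ} (hF : ContMDiff (𝓡∂ m) 𝓘(ℝ, ℝ) ∞ F) :
    ContDiffOn ℝ ∞ (F ∘ (extChartAt (𝓡∂ m) x₀).symm) (extChartAt (𝓡∂ m) x₀).target := by
  rw [← contMDiffOn_iff_contDiffOn]
  exact hF.comp_contMDiffOn (contMDiffOn_extChartAt_symm x₀)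

/-- If the pullback of `θ` by `f` is exact, then the pullback of `dθ` is zero. -/
theorem d_mfderiv_eq_zero_of_exact (θ : OneForm m M) {f : N → M} {F : N → ℝ}
    (hf : ContMDiff (𝓡∂ m') (𝓡∂ m) ∞ f) (hF : ContMDiff (𝓡∂ m') 𝓘(ℝ, ℝ) ∞ F)
    (h : ∀ (p : N) (v : TangentSpace (𝓡∂ m') p),
      θ (f p) (mfderiv (𝓡∂ m') (𝓡∂ m) f p v) = mfderiv (𝓡∂ m') 𝓘(ℝ, ℝ) F p v)
    (p : N) (v w : TangentSpace (𝓡∂ m') p) :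
    θ.d (f p) (mfderiv (𝓡∂ m') (𝓡∂ m) f p v) (mfderiv (𝓡∂ m') (𝓡∂ m) f p w) = 0 := by
  set x := f p with hxdef
  set y := extChartAt (𝓡∂ m') p p with hy
  have hyt : y ∈ (extChartAt (𝓡∂ m') p).target := mem_extChartAt_target p
  have hsy : (extChartAt (𝓡∂ m') p).symm y = p := extChartAt_to_inv p
  have hyr : y ∈ range (𝓡∂ m') := extChartAt_target_subset_range p hyt
  have hx' : f ((extChartAt (𝓡∂ m') p).symm y) ∈ (extChartAt (𝓡∂ m) x).source := by
    rw [hsy]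
    exact mem_extChartAt_source x
  have hT : coordMap x p f y = extChartAt (𝓡∂ m) x x := by
    simp only [coordMap, Function.comp_apply, hsy, hxdef]
  have h2 := oneFormDeriv_pullback (T := coordMap x p f) (θ := θ.inChart x)
    (θ' := fderivWithin ℝ (F ∘ (extChartAt (𝓡∂ m') p).symm) (range (𝓡∂ m')))
    (H := range (𝓡∂ m)) uniqueDiffOn_range_model hyr (subset_closure_interior_range_model hyr)
    (contDiffWithinAt_coordMap hyt hf.contMDiffAt hx') ?_ ?_ ?_ v w
  rotate_left
  · filter_upwards [eventually_coordMap_mem hyt hf.continuous.continuousAt hx'] with z hz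
    exact extChartAt_target_subset_range x ((extChartAt (𝓡∂ m) x).map_source hz.2)
  · rw [hT]
    exact differentiableWithinAt_inChart θ x (mem_extChartAt_target x)
  · filter_upwards [eventually_coordMap_mem hyt hf.continuous.continuousAt hx'] with z hz
    ext u
    rw [ContinuousLinearMap.comp_apply, inChart_comp_fderivWithin θ hz.1
      (hf.mdifferentiableAt (by simp)) hz.2, h]
    rw [← mfderivWithin_eq_fderivWithin, mfderiv_comp_mfderivWithin_of_eq
      (hF.mdifferentiableAt (by simp)) (mdifferentiableWithinAt_extChartAt_symm hz.1)
      ((𝓡∂ m').uniqueMDiffOn z (extChartAt_target_subset_range p hz.1)) rfl]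
    rfl
  have e : ∀ u : EuclideanSpace ℝ (Fin m'),
      fderivWithin ℝ (coordMap x p f) (range (𝓡∂ m')) y u =
        mfderiv (𝓡∂ m) 𝓘(ℝ, EuclideanSpace ℝ (Fin m)) (extChartAt (𝓡∂ m) x) (f p)
          (mfderiv (𝓡∂ m') (𝓡∂ m) f p u) := fun u ↦ by
    have h3 := fderivWithin_coordMap hyt (hf.mdifferentiableAt (by simp)) hx' u
    rw [mfderivWithin_range_extChartAt_symm] at h3
    have key : ∀ q, q = p → ∀ u : EuclideanSpace ℝ (Fin m'),
        (mfderiv (𝓡∂ m) 𝓘(ℝ, EuclideanSpace ℝ (Fin m)) (extChartAt (𝓡∂ m) x) (f q)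
          (mfderiv (𝓡∂ m') (𝓡∂ m) f q u) : EuclideanSpace ℝ (Fin m)) =
        mfderiv (𝓡∂ m) 𝓘(ℝ, EuclideanSpace ℝ (Fin m)) (extChartAt (𝓡∂ m) x) (f p)
          (mfderiv (𝓡∂ m') (𝓡∂ m) f p u) := by
      rintro _ rfl _
      rfl
    exact h3.trans (key _ hsy u)
  have hFs : ContDiffWithinAt ℝ ∞ (F ∘ (extChartAt (𝓡∂ m') p).symm) (range (𝓡∂ m')) y :=
    (contDiffOn_comp_extChartAt_symm hF y hyt).mono_of_mem_nhdsWithin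
      (extChartAt_target_mem_nhdsWithin_of_mem hyt)
  have h0 := oneFormDeriv_fderivWithin uniqueDiffOn_range_model hyr
    (subset_closure_interior_range_model hyr) hFs v w
  replace h2 := h2.symm.trans h0
  rw [hT, range_model (m := m)] at h2
  refine (d_eq_oneFormDeriv θ (mem_extChartAt_source x) _ _).trans (Eq.trans ?_ h2)
  exact congrArg₂ (fun a b ↦ oneFormDeriv (halfSpace (firstCoord m)) (θ.inChart x)
    (extChartAt (𝓡∂ m) x x) a b) (e v).symm (e w).symm

end Charts

/-! ### Derivatives of maps at the boundary -/

/-- The derivative at a boundary point of a map between half-spaces preserving the boundary point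
multiplies the transverse coordinate by a nonnegative factor. -/
theorem exists_nonneg_apply_eq_mul {E E' : Type*} [NormedAddCommGroup E] [NormedSpace ℝ E]
    [NormedAddCommGroup E'] [NormedSpace ℝ E'] {ℓ : E →L[ℝ] ℝ} {ℓ' : E' →L[ℝ] ℝ} {e' : E'}
    (he' : ℓ' e' = 1) {T : E' → E} {T' : E' →L[ℝ] E} {y : E'}
    (hT : HasFDerivWithinAt T T' (halfSpace ℓ') y) (hy : ℓ' y = 0) (hTy : ℓ (T y) = 0)
    (hTH : ∀ᶠ z in 𝓝[halfSpace ℓ'] y, 0 ≤ ℓ (T z)) :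
    ∃ a, 0 ≤ a ∧ ∀ v, ℓ (T' v) = a * ℓ' v := by
  have hd : HasFDerivWithinAt (fun z ↦ ℓ (T z)) (ℓ.comp T') (halfSpace ℓ') y :=
    ℓ.hasFDerivAt.comp_hasFDerivWithinAt y hT
  have hmin : IsLocalMinOn (fun z ↦ ℓ (T z)) (halfSpace ℓ') y := by
    filter_upwards [hTH] with z hz
    rwa [hTy]
  have hnn : ∀ v, 0 ≤ ℓ' v → 0 ≤ ℓ (T' v) := fun v hv ↦ by
    refine hmin.hasFDerivWithinAt_nonneg hd (mem_posTangentConeAt_of_segment_subset ?_)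
    exact (convex_halfSpace (ℓ := ℓ')).segment_subset hy.ge (by simpa [halfSpace, hy] using hv)
  refine ⟨ℓ (T' e'), hnn _ (by rw [he']; exact zero_le_one), fun v ↦ ?_⟩
  have h1 := hnn (v - ℓ' v • e') (by simp [he'])
  have h2 := hnn (-(v - ℓ' v • e')) (by simp [he'])
  simp only [map_sub, map_neg, map_smul, smul_eq_mul] at h1 h2
  linarith

section Boundary

variable {m : ℕ} [NeZero m] {M : Type*} [TopologicalSpace M]
  [ChartedSpace (EuclideanHalfSpace m) M] [IsManifold (𝓡∂ m) ∞ M]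
  {m' : ℕ} [NeZero m'] {N : Type*} [TopologicalSpace N]
  [ChartedSpace (EuclideanHalfSpace m') N] [IsManifold (𝓡∂ m') ∞ N]

theorem exists_nonneg_firstCoord_mfderiv {f : N → M} {p : N}
    (hf : MDifferentiableAt (𝓡∂ m') (𝓡∂ m) f p) (hp : p ∈ (𝓡∂ m').boundary N)
    (hfp : f p ∈ (𝓡∂ m).boundary M) :
    ∃ a, 0 ≤ a ∧ ∀ v : EuclideanSpace ℝ (Fin m'),
      firstCoord m (mfderiv (𝓡∂ m') (𝓡∂ m) f p v) = a * firstCoord m' v := by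
  have h := hf.hasMFDerivAt.2
  rw [range_model] at h
  rw [mem_boundary_iff_of_mem_source p (mem_extChartAt_source p)] at hp
  rw [mem_boundary_iff_of_mem_source (f p) (mem_extChartAt_source (f p))] at hfp
  refine exists_nonneg_apply_eq_mul firstCoord_single h hp (by
    simpa only [writtenInExtChartAt, Function.comp_apply, extChartAt_to_inv] using hfp) ?_
  filter_upwards with z
  have : (writtenInExtChartAt (𝓡∂ m') (𝓡∂ m) p f z) ∈ range (𝓡∂ m) := mem_range_self _
  rwa [range_model] at this

/-- The derivative at `x` of the preferred chart at `x₀`, as a map of the coordinate space; the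
tangent space at `x` is the coordinate space of the preferred chart at `x`. -/
noncomputable def chartDeriv (x₀ x : M) : EuclideanSpace ℝ (Fin m) →L[ℝ] EuclideanSpace ℝ (Fin m) :=
  mfderiv (𝓡∂ m) 𝓘(ℝ, EuclideanSpace ℝ (Fin m)) (extChartAt (𝓡∂ m) x₀) x

/-- The inverse of `chartDeriv`, at the point with coordinates `y`. -/
noncomputable def chartDerivSymm (x₀ : M) (y : EuclideanSpace ℝ (Fin m)) :
    EuclideanSpace ℝ (Fin m) →L[ℝ] EuclideanSpace ℝ (Fin m) :=
  mfderivWithin 𝓘(ℝ, EuclideanSpace ℝ (Fin m)) (𝓡∂ m) (extChartAt (𝓡∂ m) x₀).symm (range (𝓡∂ m)) y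

theorem chartDeriv_chartDerivSymm {x₀ : M} {y : EuclideanSpace ℝ (Fin m)}
    (hy : y ∈ (extChartAt (𝓡∂ m) x₀).target) (v : EuclideanSpace ℝ (Fin m)) :
    chartDeriv x₀ ((extChartAt (𝓡∂ m) x₀).symm y) (chartDerivSymm x₀ y v) = v :=
  congrArg (fun A ↦ A v) (mfderiv_extChartAt_comp_mfderivWithin_extChartAt_symm hy)

theorem chartDerivSymm_chartDeriv {x₀ : M} {y : EuclideanSpace ℝ (Fin m)}
    (hy : y ∈ (extChartAt (𝓡∂ m) x₀).target) (v : EuclideanSpace ℝ (Fin m)) :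
    chartDerivSymm x₀ y (chartDeriv x₀ ((extChartAt (𝓡∂ m) x₀).symm y) v) = v :=
  congrArg (fun A ↦ A v) (mfderivWithin_extChartAt_symm_comp_mfderiv_extChartAt hy)

theorem exists_pos_firstCoord_chartDeriv {x₀ : M} {y : EuclideanSpace ℝ (Fin m)}
    (hy : y ∈ (extChartAt (𝓡∂ m) x₀).target) (hy0 : firstCoord m y = 0) :
    ∃ a, 0 < a ∧ ∀ v : EuclideanSpace ℝ (Fin m),
      firstCoord m (chartDeriv x₀ ((extChartAt (𝓡∂ m) x₀).symm y) v) = a * firstCoord m v := by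
  set x := (extChartAt (𝓡∂ m) x₀).symm y with hxdef
  have hx : x ∈ (extChartAt (𝓡∂ m) x₀).source := (extChartAt (𝓡∂ m) x₀).map_target hy
  have hcx : extChartAt (𝓡∂ m) x₀ x = y := (extChartAt (𝓡∂ m) x₀).right_inv hy
  have hxb : firstCoord m (extChartAt (𝓡∂ m) x x) = 0 := by
    rw [← mem_boundary_iff_of_mem_source x (mem_extChartAt_source x),
      mem_boundary_iff_of_mem_source x₀ hx, hcx, hy0]
  have h := (mdifferentiableAt_extChartAt (I := 𝓡∂ m) (x := x₀) (y := x)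
    (by simpa using hx)).hasMFDerivAt.2
  rw [range_model] at h
  obtain ⟨a, ha, hav⟩ := exists_nonneg_apply_eq_mul (ℓ := firstCoord m) firstCoord_single h hxb (by
    change firstCoord m (extChartAt (𝓡∂ m) x₀ ((extChartAt (𝓡∂ m) x).symm (extChartAt (𝓡∂ m) x x))) = 0
    rw [extChartAt_to_inv, hcx, hy0]) (by
    filter_upwards with z
    have : extChartAt (𝓡∂ m) x₀ ((extChartAt (𝓡∂ m) x).symm z) ∈ range (𝓡∂ m) := mem_range_self _
    rwa [range_model] at this)
  refine ⟨a, lt_of_le_of_ne ha ?_, hav⟩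
  rintro rfl
  have h1 := hav (chartDerivSymm x₀ y (EuclideanSpace.single 0 1))
  have h2 := chartDeriv_chartDerivSymm hy (EuclideanSpace.single 0 1)
  rw [zero_mul] at h1
  have h3 : firstCoord m (chartDeriv x₀ x (chartDerivSymm x₀ y (EuclideanSpace.single 0 1))) = 0 := h1
  rw [h2, firstCoord_single] at h3
  exact one_ne_zero h3

end Boundary

/-! ### Transplanting maps and functions from a chart -/

section Transplant

variable {m : ℕ} [NeZero m] {M : Type*} [TopologicalSpace M]
  [ChartedSpace (EuclideanHalfSpace m) M]

open Classical in
/-- The map of `M` which is `f` in the preferred chart at `x₀` and the identity outside. -/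
noncomputable def transplant (x₀ : M) (f : EuclideanSpace ℝ (Fin m) → EuclideanSpace ℝ (Fin m))
    (x : M) : M :=
  if x ∈ (extChartAt (𝓡∂ m) x₀).source then
    (extChartAt (𝓡∂ m) x₀).symm (f (extChartAt (𝓡∂ m) x₀ x)) else x

open Classical in
/-- The function on `M` which is `k` in the preferred chart at `x₀` and zero outside. -/
noncomputable def chartExtend (x₀ : M) (k : EuclideanSpace ℝ (Fin m) → ℝ) (x : M) : ℝ :=
  if x ∈ (extChartAt (𝓡∂ m) x₀).source then k (extChartAt (𝓡∂ m) x₀ x) else 0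

variable {x₀ x : M} {f g : EuclideanSpace ℝ (Fin m) → EuclideanSpace ℝ (Fin m)}
  {y : EuclideanSpace ℝ (Fin m)}

theorem transplant_of_notMem (hx : x ∉ (extChartAt (𝓡∂ m) x₀).source) : transplant x₀ f x = x :=
  if_neg hx

theorem chartExtend_of_notMem {k : EuclideanSpace ℝ (Fin m) → ℝ}
    (hx : x ∉ (extChartAt (𝓡∂ m) x₀).source) : chartExtend x₀ k x = 0 :=
  if_neg hx

theorem transplant_of_mem (hx : x ∈ (extChartAt (𝓡∂ m) x₀).source) :
    transplant x₀ f x = (extChartAt (𝓡∂ m) x₀).symm (f (extChartAt (𝓡∂ m) x₀ x)) :=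
  if_pos hx

theorem chartExtend_of_mem {k : EuclideanSpace ℝ (Fin m) → ℝ}
    (hx : x ∈ (extChartAt (𝓡∂ m) x₀).source) : chartExtend x₀ k x = k (extChartAt (𝓡∂ m) x₀ x) :=
  if_pos hx

theorem transplant_symm (hy : y ∈ (extChartAt (𝓡∂ m) x₀).target) :
    transplant x₀ f ((extChartAt (𝓡∂ m) x₀).symm y) = (extChartAt (𝓡∂ m) x₀).symm (f y) := by
  rw [transplant_of_mem ((extChartAt (𝓡∂ m) x₀).map_target hy), (extChartAt (𝓡∂ m) x₀).right_inv hy]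

theorem chartExtend_symm {k : EuclideanSpace ℝ (Fin m) → ℝ}
    (hy : y ∈ (extChartAt (𝓡∂ m) x₀).target) :
    chartExtend x₀ k ((extChartAt (𝓡∂ m) x₀).symm y) = k y := by
  rw [chartExtend_of_mem ((extChartAt (𝓡∂ m) x₀).map_target hy),
    (extChartAt (𝓡∂ m) x₀).right_inv hy]

theorem exists_eq_symm (hx : x ∈ (extChartAt (𝓡∂ m) x₀).source) :
    ∃ y ∈ (extChartAt (𝓡∂ m) x₀).target, (extChartAt (𝓡∂ m) x₀).symm y = x :=
  ⟨_, (extChartAt (𝓡∂ m) x₀).map_source hx, (extChartAt (𝓡∂ m) x₀).left_inv hx⟩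

theorem transplant_transplant
    (hf : MapsTo f (extChartAt (𝓡∂ m) x₀).target (extChartAt (𝓡∂ m) x₀).target)
    (hgf : ∀ y ∈ (extChartAt (𝓡∂ m) x₀).target, g (f y) = y) (x : M) :
    transplant x₀ g (transplant x₀ f x) = x := by
  by_cases hx : x ∈ (extChartAt (𝓡∂ m) x₀).source
  · obtain ⟨y, hy, rfl⟩ := exists_eq_symm hx
    rw [transplant_symm hy, transplant_symm (hf hy), hgf y hy]
  · rw [transplant_of_notMem (f := f) hx, transplant_of_notMem hx]

/-- The points of the chart at `x₀` with coordinates in `Q`. -/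
def chartImage (x₀ : M) (Q : Set (EuclideanSpace ℝ (Fin m))) : Set M :=
  (extChartAt (𝓡∂ m) x₀).symm '' (halfSpace (firstCoord m) ∩ Q)

variable {Q : Set (EuclideanSpace ℝ (Fin m))}

theorem symm_notMem_chartImage (hy : y ∈ (extChartAt (𝓡∂ m) x₀).target)
    (h : (extChartAt (𝓡∂ m) x₀).symm y ∉ chartImage x₀ Q) : y ∉ Q := fun hyQ ↦ by
  rw [extChartAt_target_eq] at hy
  exact h (mem_image_of_mem _ ⟨hy.1, hyQ⟩)

variable [IsManifold (𝓡∂ m) ∞ M] [T2Space M]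

theorem isClosed_chartImage (hQ : IsCompact Q) (hQO : Q ⊆ chartOpen x₀) :
    IsClosed (chartImage x₀ Q) := by
  refine IsCompact.isClosed ((hQ.inter_left isClosed_halfSpace).image_of_continuousOn ?_)
  refine (continuousOn_extChartAt_symm x₀).mono ?_
  rw [extChartAt_target_eq]
  exact inter_subset_inter_right _ hQO

theorem chartImage_subset_source (hQO : Q ⊆ chartOpen x₀) :
    chartImage x₀ Q ⊆ (extChartAt (𝓡∂ m) x₀).source := by
  rintro _ ⟨y, hy, rfl⟩
  refine (extChartAt (𝓡∂ m) x₀).map_target ?_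
  rw [extChartAt_target_eq]
  exact ⟨hy.1, hQO hy.2⟩

theorem source_union_compl_chartImage (hQO : Q ⊆ chartOpen x₀) :
    (extChartAt (𝓡∂ m) x₀).source ∪ (chartImage x₀ Q)ᶜ = univ := by
  rw [union_comm, ← compl_subset_iff_union, compl_compl]
  exact chartImage_subset_source hQO

theorem transplant_of_notMem_chartImage
    (hf : ∀ y ∈ (extChartAt (𝓡∂ m) x₀).target, y ∉ Q → f y = y) (hx : x ∉ chartImage x₀ Q) :
    transplant x₀ f x = x := by
  by_cases hxs : x ∈ (extChartAt (𝓡∂ m) x₀).source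
  · obtain ⟨y, hy, rfl⟩ := exists_eq_symm hxs
    rw [transplant_symm hy, hf y hy (symm_notMem_chartImage hy hx)]
  · exact transplant_of_notMem hxs

theorem chartExtend_of_notMem_chartImage {k : EuclideanSpace ℝ (Fin m) → ℝ}
    (hk : ∀ y ∈ (extChartAt (𝓡∂ m) x₀).target, y ∉ Q → k y = 0)
    (hx : x ∉ chartImage x₀ Q) : chartExtend x₀ k x = 0 := by
  by_cases hxs : x ∈ (extChartAt (𝓡∂ m) x₀).source
  · obtain ⟨y, hy, rfl⟩ := exists_eq_symm hxs
    rw [chartExtend_symm hy, hk y hy (symm_notMem_chartImage hy hx)]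
  · exact chartExtend_of_notMem hxs

theorem contMDiffOn_prod_extChartAt : ContMDiffOn (𝓘(ℝ, ℝ).prod (𝓡∂ m))
    𝓘(ℝ, ℝ × EuclideanSpace ℝ (Fin m)) ∞ (fun p : ℝ × M ↦ (p.1, extChartAt (𝓡∂ m) x₀ p.2))
    (univ ×ˢ (extChartAt (𝓡∂ m) x₀).source) := by
  refine ContMDiffOn.prodMk_space contMDiff_fst.contMDiffOn ?_
  have h := contMDiffOn_extChartAt (I := 𝓡∂ m) (n := ∞) (x := x₀)
  rw [← extChartAt_source (𝓡∂ m)] at h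
  exact h.comp contMDiff_snd.contMDiffOn fun p hp ↦ hp.2

theorem contMDiff_transplant {F : ℝ × EuclideanSpace ℝ (Fin m) → EuclideanSpace ℝ (Fin m)}
    (hQ : IsCompact Q) (hQO : Q ⊆ chartOpen x₀)
    (hF : ContDiffOn ℝ ∞ F (univ ×ˢ (extChartAt (𝓡∂ m) x₀).target))
    (hFm : MapsTo F (univ ×ˢ (extChartAt (𝓡∂ m) x₀).target) (extChartAt (𝓡∂ m) x₀).target)
    (hFQ : ∀ t, ∀ y ∈ (extChartAt (𝓡∂ m) x₀).target, y ∉ Q → F (t, y) = y) :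
    ContMDiff (𝓘(ℝ, ℝ).prod (𝓡∂ m)) (𝓡∂ m) ∞
      (fun p : ℝ × M ↦ transplant x₀ (fun y ↦ F (p.1, y)) p.2) := by
  have hm : MapsTo (fun p : ℝ × M ↦ (p.1, extChartAt (𝓡∂ m) x₀ p.2))
      (univ ×ˢ (extChartAt (𝓡∂ m) x₀).source) (univ ×ˢ (extChartAt (𝓡∂ m) x₀).target) :=
    fun p hp ↦ ⟨hp.1, (extChartAt (𝓡∂ m) x₀).map_source hp.2⟩
  refine contMDiff_of_contMDiffOn_union_of_isOpen
    (s := univ ×ˢ (extChartAt (𝓡∂ m) x₀).source) (t := univ ×ˢ (chartImage x₀ Q)ᶜ) ?_ ?_ ?_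
    (isOpen_univ.prod (isOpen_extChartAt_source x₀))
    (isOpen_univ.prod (isClosed_chartImage hQ hQO).isOpen_compl)
  · refine ((contMDiffOn_extChartAt_symm x₀).comp (hF.contMDiffOn.comp contMDiffOn_prod_extChartAt
      hm) fun p hp ↦ hFm (hm hp)).congr fun p hp ↦ ?_
    exact transplant_of_mem hp.2
  · exact contMDiff_snd.contMDiffOn.congr fun p hp ↦
      transplant_of_notMem_chartImage (hFQ p.1) hp.2
  · rw [← prod_union, source_union_compl_chartImage hQO, univ_prod_univ]

theorem contMDiff_chartExtend {K : ℝ × EuclideanSpace ℝ (Fin m) → ℝ}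
    (hQ : IsCompact Q) (hQO : Q ⊆ chartOpen x₀)
    (hK : ContDiffOn ℝ ∞ K (univ ×ˢ (extChartAt (𝓡∂ m) x₀).target))
    (hKQ : ∀ t, ∀ y ∈ (extChartAt (𝓡∂ m) x₀).target, y ∉ Q → K (t, y) = 0) :
    ContMDiff (𝓘(ℝ, ℝ).prod (𝓡∂ m)) 𝓘(ℝ, ℝ) ∞
      (fun p : ℝ × M ↦ chartExtend x₀ (fun y ↦ K (p.1, y)) p.2) := by
  have hm : MapsTo (fun p : ℝ × M ↦ (p.1, extChartAt (𝓡∂ m) x₀ p.2))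
      (univ ×ˢ (extChartAt (𝓡∂ m) x₀).source) (univ ×ˢ (extChartAt (𝓡∂ m) x₀).target) :=
    fun p hp ↦ ⟨hp.1, (extChartAt (𝓡∂ m) x₀).map_source hp.2⟩
  refine contMDiff_of_contMDiffOn_union_of_isOpen
    (s := univ ×ˢ (extChartAt (𝓡∂ m) x₀).source) (t := univ ×ˢ (chartImage x₀ Q)ᶜ) ?_ ?_ ?_
    (isOpen_univ.prod (isOpen_extChartAt_source x₀))
    (isOpen_univ.prod (isClosed_chartImage hQ hQO).isOpen_compl)
  · exact (hK.contMDiffOn.comp contMDiffOn_prod_extChartAt hm).congr fun p hp ↦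
      chartExtend_of_mem hp.2
  · exact (contMDiff_const (c := (0 : ℝ))).contMDiffOn.congr fun p hp ↦
      chartExtend_of_notMem_chartImage (hKQ p.1) hp.2
  · rw [← prod_union, source_union_compl_chartImage hQO, univ_prod_univ]

end Transplant

/-! ### The isotopy of the manifold given by the local theorem in a chart -/

section ChartIsotopy

variable {m : ℕ} [NeZero m] {M : Type*} [TopologicalSpace M]
  [ChartedSpace (EuclideanHalfSpace m) M] [IsManifold (𝓡∂ m) ∞ M]
  {x₀ : M} {y : EuclideanSpace ℝ (Fin m)}

theorem chartDeriv_mfderiv {f : EuclideanSpace ℝ (Fin m) → EuclideanSpace ℝ (Fin m)} {Ψ : M → M}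
    (hΨ : ContMDiff (𝓡∂ m) (𝓡∂ m) ∞ Ψ)
    (hf : MapsTo f (extChartAt (𝓡∂ m) x₀).target (extChartAt (𝓡∂ m) x₀).target)
    (hΨf : ∀ z ∈ (extChartAt (𝓡∂ m) x₀).target,
      Ψ ((extChartAt (𝓡∂ m) x₀).symm z) = (extChartAt (𝓡∂ m) x₀).symm (f z))
    (hy : y ∈ (extChartAt (𝓡∂ m) x₀).target)
    (w : TangentSpace (𝓡∂ m) ((extChartAt (𝓡∂ m) x₀).symm y)) :
    chartDeriv x₀ (Ψ ((extChartAt (𝓡∂ m) x₀).symm y))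
      (mfderiv (𝓡∂ m) (𝓡∂ m) Ψ ((extChartAt (𝓡∂ m) x₀).symm y) w) =
    fderivWithin ℝ f (halfSpace (firstCoord m)) y
      (chartDeriv x₀ ((extChartAt (𝓡∂ m) x₀).symm y) w) := by
  have hx : Ψ ((extChartAt (𝓡∂ m) x₀).symm y) ∈ (extChartAt (𝓡∂ m) x₀).source := by
    rw [hΨf y hy]
    exact (extChartAt (𝓡∂ m) x₀).map_target (hf hy)
  have h1 := fderivWithin_coordMap hy (hΨ.mdifferentiableAt (by simp)) hx
    (chartDeriv x₀ ((extChartAt (𝓡∂ m) x₀).symm y) w)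
  have h2 : fderivWithin ℝ (coordMap x₀ x₀ Ψ) (range (𝓡∂ m)) y =
      fderivWithin ℝ f (halfSpace (firstCoord m)) y := by
    rw [range_model]
    have h3 : ∀ z ∈ (extChartAt (𝓡∂ m) x₀).target, coordMap x₀ x₀ Ψ z = f z := fun z hz ↦ by
      simp only [coordMap, Function.comp_apply, hΨf z hz]
      exact (extChartAt (𝓡∂ m) x₀).right_inv (hf hz)
    refine Filter.EventuallyEq.fderivWithin_eq ?_ (h3 y hy)
    rw [← range_model]
    filter_upwards [extChartAt_target_mem_nhdsWithin_of_mem hy] with z hz using h3 z hz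
  rw [← h2, h1]
  exact congrArg (fun v : EuclideanSpace ℝ (Fin m) ↦ (chartDeriv x₀ (Ψ ((extChartAt (𝓡∂ m) x₀).symm y))
    (mfderiv (𝓡∂ m) (𝓡∂ m) Ψ ((extChartAt (𝓡∂ m) x₀).symm y) v) : EuclideanSpace ℝ (Fin m)))
    (chartDerivSymm_chartDeriv hy w).symm

/-- The differential of the real function `A` at `x`, as a covector on the coordinate space. -/
noncomputable def differential (A : M → ℝ) (x : M) : EuclideanSpace ℝ (Fin m) →L[ℝ] ℝ :=
  mfderiv (𝓡∂ m) 𝓘(ℝ, ℝ) A x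

/-- In the preferred chart at `x₀`, the one-form `θ + dA`. -/
noncomputable def inChartAdd (θ : OneForm m M) (A : M → ℝ) (x₀ : M)
    (y : EuclideanSpace ℝ (Fin m)) : EuclideanSpace ℝ (Fin m) →L[ℝ] ℝ :=
  θ.inChart x₀ y + fderivWithin ℝ (A ∘ (extChartAt (𝓡∂ m) x₀).symm) (halfSpace (firstCoord m)) y

variable {A : M → ℝ}

theorem contDiffOn_comp_symm_halfSpace (hA : ContMDiff (𝓡∂ m) 𝓘(ℝ, ℝ) ∞ A) :
    ContDiffOn ℝ ∞ (A ∘ (extChartAt (𝓡∂ m) x₀).symm) (halfSpace (firstCoord m) ∩ chartOpen x₀) :=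
  extChartAt_target_eq (m := m) x₀ ▸ contDiffOn_comp_extChartAt_symm hA

theorem contDiffOn_inChartAdd (θ : OneForm m M) (hA : ContMDiff (𝓡∂ m) 𝓘(ℝ, ℝ) ∞ A) :
    ContDiffOn ℝ ∞ (inChartAdd θ A x₀) (halfSpace (firstCoord m) ∩ chartOpen x₀) :=
  (contDiffOn_inChart θ x₀).add (contDiffOn_fderivWithin_inter
    (uniqueDiffOn_halfSpace firstCoord_single) (isOpen_chartOpen x₀) (contDiffOn_comp_symm_halfSpace hA))

theorem oneFormDeriv_inChartAdd (θ : OneForm m M) (hA : ContMDiff (𝓡∂ m) 𝓘(ℝ, ℝ) ∞ A)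
    (hy : y ∈ (extChartAt (𝓡∂ m) x₀).target) :
    oneFormDeriv (halfSpace (firstCoord m)) (inChartAdd θ A x₀) y =
      oneFormDeriv (halfSpace (firstCoord m)) (θ.inChart x₀) y := by
  rw [extChartAt_target_eq] at hy
  exact oneFormDeriv_add_fderivWithin firstCoord_single (isOpen_chartOpen x₀)
    (contDiffOn_inChart θ x₀) (contDiffOn_comp_symm_halfSpace hA) hy

theorem inChartAdd_chartDeriv (θ : OneForm m M) (hA : ContMDiff (𝓡∂ m) 𝓘(ℝ, ℝ) ∞ A) {x : M}
    (hx : x ∈ (extChartAt (𝓡∂ m) x₀).source) (v : TangentSpace (𝓡∂ m) x) :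
    inChartAdd θ A x₀ (extChartAt (𝓡∂ m) x₀ x) (chartDeriv x₀ x v) =
      θ x v + differential A x v := by
  have h1 := inChart_apply_mfderiv θ hx v
  have h2 := fderivWithin_comp_extChartAt_symm hx (hA.mdifferentiableAt (by simp)) v
  rw [range_model] at h2
  exact congrArg₂ (· + ·) h1 h2

theorem d_symm_eq_oneFormDeriv (θ : OneForm m M) (hy : y ∈ (extChartAt (𝓡∂ m) x₀).target)
    (v w : EuclideanSpace ℝ (Fin m)) :
    θ.d ((extChartAt (𝓡∂ m) x₀).symm y) v w =
      oneFormDeriv (halfSpace (firstCoord m)) (θ.inChart x₀) y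
        (chartDeriv x₀ ((extChartAt (𝓡∂ m) x₀).symm y) v)
        (chartDeriv x₀ ((extChartAt (𝓡∂ m) x₀).symm y) w) := by
  have h := d_eq_oneFormDeriv θ ((extChartAt (𝓡∂ m) x₀).map_target hy) v w
  rwa [(extChartAt (𝓡∂ m) x₀).right_inv hy] at h

theorem oneFormDeriv_inChart_nondegenerate {θ : OneForm m M} (hθ : IsLiouvilleForm θ)
    (hy : y ∈ (extChartAt (𝓡∂ m) x₀).target) (v : EuclideanSpace ℝ (Fin m))
    (hv : ∀ w, oneFormDeriv (halfSpace (firstCoord m)) (θ.inChart x₀) y v w = 0) : v = 0 := by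
  have h := hθ.nondegenerate ((extChartAt (𝓡∂ m) x₀).symm y) (chartDerivSymm x₀ y v) fun w ↦ by
    refine (d_symm_eq_oneFormDeriv θ hy _ w).trans ?_
    rw [chartDeriv_chartDerivSymm hy, hv]
  rw [← chartDeriv_chartDerivSymm hy v]
  exact (congrArg (chartDeriv x₀ ((extChartAt (𝓡∂ m) x₀).symm y)) h).trans (map_zero _)

/-- The Liouville field of `θ + dA` points outwards along the boundary if `A` vanishes there. -/
theorem firstCoord_neg_of_isLiouvilleForm {θ : OneForm m M} (hθ : IsLiouvilleForm θ)
    (hA : ContMDiff (𝓡∂ m) 𝓘(ℝ, ℝ) ∞ A) (hA0 : ∀ x ∈ (𝓡∂ m).boundary M, A x = 0)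
    (hy : y ∈ chartOpen x₀) (hy0 : firstCoord m y = 0) {z : EuclideanSpace ℝ (Fin m)}
    (hz : oneFormDeriv (halfSpace (firstCoord m)) (θ.inChart x₀) y z = inChartAdd θ A x₀ y) :
    firstCoord m z < 0 := by
  have hyt : y ∈ (extChartAt (𝓡∂ m) x₀).target := by
    rw [extChartAt_target_eq]
    exact ⟨hy0.ge, hy⟩
  set x := (extChartAt (𝓡∂ m) x₀).symm y with hx
  have hxs : x ∈ (extChartAt (𝓡∂ m) x₀).source := (extChartAt (𝓡∂ m) x₀).map_target hyt
  have hcx : extChartAt (𝓡∂ m) x₀ x = y := (extChartAt (𝓡∂ m) x₀).right_inv hyt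
  obtain ⟨Z, hZ, hZout⟩ := hθ.outward
  have hxb : x ∈ (𝓡∂ m).boundary M := by rw [mem_boundary_iff_of_mem_source x₀ hxs, hcx, hy0]
  obtain ⟨a, ha, hav⟩ := exists_pos_firstCoord_chartDeriv hyt hy0
  set z₀ := chartDeriv x₀ x (Z x) with hz₀
  have hneg : firstCoord m z₀ < 0 :=
    lt_of_eq_of_lt (hav (Z x)) (mul_neg_of_pos_of_neg ha (hZout x hxb))
  have hz₀eq : ∀ w, oneFormDeriv (halfSpace (firstCoord m)) (θ.inChart x₀) y z₀ w =
      θ.inChart x₀ y w := fun w ↦ by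
    have h1 := (d_symm_eq_oneFormDeriv θ hyt (Z x) (chartDerivSymm x₀ y w)).symm.trans
      (hZ x (chartDerivSymm x₀ y w))
    have h2 := inChart_apply_mfderiv θ hxs (chartDerivSymm x₀ y w)
    rw [hcx] at h2
    have h3 := h1.trans h2.symm
    rw [chartDeriv_chartDerivSymm hyt] at h3
    refine h3.trans ?_
    exact congrArg (θ.inChart x₀ y) (chartDeriv_chartDerivSymm hyt w)
  have hA0' : ∀ z ∈ chartOpen x₀, firstCoord m z = 0 →
      (A ∘ (extChartAt (𝓡∂ m) x₀).symm) z = 0 := fun z hzO hz0 ↦ by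
    have hzt : z ∈ (extChartAt (𝓡∂ m) x₀).target := by
      rw [extChartAt_target_eq]
      exact ⟨hz0.ge, hzO⟩
    refine hA0 _ ?_
    rw [mem_boundary_iff_of_mem_source x₀ ((extChartAt (𝓡∂ m) x₀).map_target hzt),
      (extChartAt (𝓡∂ m) x₀).right_inv hzt, hz0]
  rw [apply_eq_of_antisymm (fun v ↦ oneFormDeriv_self _ _ _ v)
    (oneFormDeriv_inChart_nondegenerate hθ hyt) (z := z₀) (z' := z)
    (a := fderivWithin ℝ (A ∘ (extChartAt (𝓡∂ m) x₀).symm) (halfSpace (firstCoord m)) y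
      (EuclideanSpace.single 0 1))]
  · exact hneg
  · intro w
    rw [hz, hz₀eq]
    simp only [inChartAdd, add_apply]
    rw [fderivWithin_halfSpace_eq_smul firstCoord_single hA0'
      ((isOpen_chartOpen x₀).mem_nhds hy)
      (((contDiffOn_comp_symm_halfSpace hA).differentiableOn (by simp) y ⟨hy0.ge, hy⟩).mono_of_mem_nhdsWithin
        (inter_mem_nhdsWithin _ ((isOpen_chartOpen x₀).mem_nhds hy))) hy0 w]
    ring

end ChartIsotopy

section ChartIsotopy

variable {m : ℕ} [NeZero m] {M : Type*} [TopologicalSpace M]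
  [ChartedSpace (EuclideanHalfSpace m) M] [IsManifold (𝓡∂ m) ∞ M]
  {x₀ : M} {y : EuclideanSpace ℝ (Fin m)} {A : M → ℝ}

/-- The Hamiltonian equation of a curve in `M` can be checked in any preferred chart. -/
theorem d_mfderiv_curve_eq_of_chart (θ : OneForm m M) {γ : ℝ → M} {t : ℝ} {F : M → ℝ}
    {V : EuclideanSpace ℝ (Fin m)} (hγ : MDifferentiableAt 𝓘(ℝ, ℝ) (𝓡∂ m) γ t)
    (hF : MDifferentiableAt (𝓡∂ m) 𝓘(ℝ, ℝ) F (γ t))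
    (hγt : γ t ∈ (extChartAt (𝓡∂ m) x₀).source)
    (hV : HasDerivAt (extChartAt (𝓡∂ m) x₀ ∘ γ) V t)
    (h : ∀ w, oneFormDeriv (halfSpace (firstCoord m)) (θ.inChart x₀) (extChartAt (𝓡∂ m) x₀ (γ t))
      V w = -fderivWithin ℝ (F ∘ (extChartAt (𝓡∂ m) x₀).symm) (halfSpace (firstCoord m))
        (extChartAt (𝓡∂ m) x₀ (γ t)) w) (w : TangentSpace (𝓡∂ m) (γ t)) :
    θ.d (γ t) (mfderiv 𝓘(ℝ, ℝ) (𝓡∂ m) γ t (1 : ℝ)) w =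
      -(mfderiv (𝓡∂ m) 𝓘(ℝ, ℝ) F (γ t) w : ℝ) := by
  have hv : chartDeriv x₀ (γ t) (mfderiv 𝓘(ℝ, ℝ) (𝓡∂ m) γ t (1 : ℝ)) = V := by
    have h1 := (mdifferentiableAt_extChartAt (I := 𝓡∂ m) (x := x₀) (y := γ t)
      (by simpa using hγt)).hasMFDerivAt.comp t hγ.hasMFDerivAt
    have h2 := h1.mfderiv.symm.trans (mfderiv_eq_fderiv (f := extChartAt (𝓡∂ m) x₀ ∘ γ) (x := t))
    exact (congrArg (fun B : ℝ →L[ℝ] EuclideanSpace ℝ (Fin m) ↦ B 1) h2).trans hV.deriv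
  have h1 := fderivWithin_comp_extChartAt_symm hγt hF w
  rw [range_model] at h1
  refine (d_eq_oneFormDeriv θ hγt (mfderiv 𝓘(ℝ, ℝ) (𝓡∂ m) γ t (1 : ℝ)) w).trans ?_
  refine (congrArg (fun u ↦ oneFormDeriv (halfSpace (firstCoord m)) (θ.inChart x₀)
    (extChartAt (𝓡∂ m) x₀ (γ t)) u (chartDeriv x₀ (γ t) w)) hv).trans ((h _).trans ?_)
  exact congrArg (fun r : ℝ ↦ -r) h1

theorem apply_mfderiv_of_eventuallyEq_id (θ : OneForm m M) {Ψ : M → M} {x : M}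
    (h : Ψ =ᶠ[𝓝 x] id) (w : TangentSpace (𝓡∂ m) x) :
    θ (Ψ x) (mfderiv (𝓡∂ m) (𝓡∂ m) Ψ x w) = θ x w := by
  have h1 : mfderiv (𝓡∂ m) (𝓡∂ m) Ψ x = _ := h.mfderiv_eq
  have h2 : (mfderiv (𝓡∂ m) (𝓡∂ m) Ψ x w : EuclideanSpace ℝ (Fin m)) = w :=
    congrArg (fun B : EuclideanSpace ℝ (Fin m) →L[ℝ] EuclideanSpace ℝ (Fin m) ↦ B w)
      (h1.trans mfderiv_id)
  exact congrArg₂ (fun (z : M) (u : EuclideanSpace ℝ (Fin m)) ↦ (θ z u : ℝ)) h.eq_of_nhds h2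

theorem differential_mfderiv_of_eventuallyEq_id {Ψ : M → M} {x : M}
    (h : Ψ =ᶠ[𝓝 x] id) (w : TangentSpace (𝓡∂ m) x) :
    differential A (Ψ x) (mfderiv (𝓡∂ m) (𝓡∂ m) Ψ x w) = differential A x w := by
  have h1 : mfderiv (𝓡∂ m) (𝓡∂ m) Ψ x = _ := h.mfderiv_eq
  have h2 : (mfderiv (𝓡∂ m) (𝓡∂ m) Ψ x w : EuclideanSpace ℝ (Fin m)) = w :=
    congrArg (fun B : EuclideanSpace ℝ (Fin m) →L[ℝ] EuclideanSpace ℝ (Fin m) ↦ B w)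
      (h1.trans mfderiv_id)
  exact congrArg₂ (fun (z : M) (u : EuclideanSpace ℝ (Fin m)) ↦ (differential A z u : ℝ))
    h.eq_of_nhds h2

theorem differential_eq_zero_of_eventuallyEq {x : M} (h : A =ᶠ[𝓝 x] fun _ ↦ 0) :
    differential (m := m) A x = 0 :=
  (h.mfderiv_eq (I := 𝓡∂ m) (I' := 𝓘(ℝ, ℝ))).trans mfderiv_const

theorem eventually_extChartAt_mem {x : M} (hx : x ∈ (extChartAt (𝓡∂ m) x₀).source)
    {P : EuclideanSpace ℝ (Fin m) → Prop}
    (h : ∀ᶠ z in 𝓝[halfSpace (firstCoord m)] (extChartAt (𝓡∂ m) x₀ x), P z) :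
    ∀ᶠ z in 𝓝 x, z ∈ (extChartAt (𝓡∂ m) x₀).source ∧ P (extChartAt (𝓡∂ m) x₀ z) := by
  have h1 : Tendsto (extChartAt (𝓡∂ m) x₀) (𝓝 x)
      (𝓝[halfSpace (firstCoord m)] (extChartAt (𝓡∂ m) x₀ x)) := by
    refine tendsto_nhdsWithin_iff.2 ⟨continuousAt_extChartAt' hx, .of_forall fun z ↦ ?_⟩
    rw [← range_model]
    exact mem_range_self _
  filter_upwards [(isOpen_extChartAt_source x₀).mem_nhds hx, h1.eventually h] with z hz hz'
    using ⟨hz, hz'⟩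

variable [T2Space M] {Q : Set (EuclideanSpace ℝ (Fin m))}
  {f g : EuclideanSpace ℝ (Fin m) → EuclideanSpace ℝ (Fin m)}

/-- An injective map of the half-space which is the identity outside of `Q` preserves the target of a
chart if this target contains the points of `Q`. -/
theorem mapsTo_target_of_eq_off (hQO : Q ⊆ chartOpen x₀)
    (hfH : MapsTo f (halfSpace (firstCoord m)) (halfSpace (firstCoord m)))
    (hgf : ∀ y ∈ halfSpace (firstCoord m), g (f y) = y)
    (hfQ : ∀ y ∈ halfSpace (firstCoord m), y ∉ Q → f y = y) :
    MapsTo f (extChartAt (𝓡∂ m) x₀).target (extChartAt (𝓡∂ m) x₀).target := fun y hy ↦ by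
  rw [extChartAt_target_eq] at hy ⊢
  refine ⟨hfH hy.1, ?_⟩
  by_cases h : f y ∈ Q
  · exact hQO h
  · have h1 := hfQ _ (hfH hy.1) h
    -- `f` is injective, so that `f y` is equal to `y`
    have h2 : f y = y := by rw [← hgf _ (hfH hy.1), h1, hgf _ hy.1]
    exact h2.symm ▸ hy.2

/-- The diffeomorphism of `M` which is `f`, with inverse `g`, in the preferred chart at `x₀` and the
identity outside of that chart. -/
noncomputable def transplantDiffeomorph (x₀ : M) (hQ : IsCompact Q) (hQO : Q ⊆ chartOpen x₀)
    (hf : ContDiffOn ℝ ∞ f (halfSpace (firstCoord m)))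
    (hg : ContDiffOn ℝ ∞ g (halfSpace (firstCoord m)))
    (hfH : MapsTo f (halfSpace (firstCoord m)) (halfSpace (firstCoord m)))
    (hgH : MapsTo g (halfSpace (firstCoord m)) (halfSpace (firstCoord m)))
    (hgf : ∀ y ∈ halfSpace (firstCoord m), g (f y) = y)
    (hfg : ∀ y ∈ halfSpace (firstCoord m), f (g y) = y)
    (hfQ : ∀ y ∈ halfSpace (firstCoord m), y ∉ Q → f y = y) : M ≃ₘ^∞⟮𝓡∂ m, 𝓡∂ m⟯ M :=
  have hgQ : ∀ y ∈ halfSpace (firstCoord m), y ∉ Q → g y = y := fun y hy hyQ ↦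
    (congrArg g (hfQ y hy hyQ)).symm.trans (hgf y hy)
  have hT : (extChartAt (𝓡∂ m) x₀).target ⊆ halfSpace (firstCoord m) :=
    extChartAt_target_eq (m := m) x₀ ▸ inter_subset_left
  { toFun := transplant x₀ f
    invFun := transplant x₀ g
    left_inv := transplant_transplant (mapsTo_target_of_eq_off hQO hfH hgf hfQ)
      fun y hy ↦ hgf y (hT hy)
    right_inv := transplant_transplant (mapsTo_target_of_eq_off hQO hgH hfg hgQ)
      fun y hy ↦ hfg y (hT hy)
    contMDiff_toFun := (contMDiff_transplant (F := fun p ↦ f p.2) hQ hQO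
      (hf.comp contDiff_snd.contDiffOn fun _ hp ↦ hT hp.2)
      (fun _ hp ↦ mapsTo_target_of_eq_off hQO hfH hgf hfQ hp.2) fun _ y hy ↦ hfQ y (hT hy)).comp
        (contMDiff_const (c := (0 : ℝ)).prodMk contMDiff_id)
    contMDiff_invFun := (contMDiff_transplant (F := fun p ↦ g p.2) hQ hQO
      (hg.comp contDiff_snd.contDiffOn fun _ hp ↦ hT hp.2)
      (fun _ hp ↦ mapsTo_target_of_eq_off hQO hgH hfg hgQ hp.2) fun _ y hy ↦ hgQ y (hT hy)).comp
        (contMDiff_const (c := (0 : ℝ)).prodMk contMDiff_id) }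

/-- The local theorem on the manifold: by an isotopy supported in a chart, the form `θ + dA` is changed
by the differential of a function which is equal to `G` near the boundary. -/
theorem exists_isotopy_of_chart {θ : OneForm m M} (hθ : IsLiouvilleForm θ)
    (hA : ContMDiff (𝓡∂ m) 𝓘(ℝ, ℝ) ∞ A) (hA0 : ∀ x ∈ (𝓡∂ m).boundary M, A x = 0) (x₀ : M)
    {G : EuclideanSpace ℝ (Fin m) → ℝ} {C : Set (EuclideanSpace ℝ (Fin m))}
    (hG : ContDiffOn ℝ ∞ G (halfSpace (firstCoord m))) (hC : IsCompact C) (hCO : C ⊆ chartOpen x₀)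
    (hGC : ∀ y ∈ halfSpace (firstCoord m), y ∉ C → G y = 0)
    (hG0 : ∀ y, firstCoord m y = 0 → G y = 0) :
    ∃ Ψ : ℝ → M ≃ₘ^∞⟮𝓡∂ m, 𝓡∂ m⟯ M, IsHamiltonianIsotopyRelBoundary θ Ψ ∧
      ∃ S : M → ℝ, ContMDiff (𝓡∂ m) 𝓘(ℝ, ℝ) ∞ S ∧
        (∀ (x : M) (w : TangentSpace (𝓡∂ m) x),
          θ (Ψ 1 x) (mfderiv (𝓡∂ m) (𝓡∂ m) (Ψ 1) x w) +
            differential A (Ψ 1 x) (mfderiv (𝓡∂ m) (𝓡∂ m) (Ψ 1) x w) =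
          θ x w + differential A x w + differential S x w) ∧
        ∀ x ∈ (𝓡∂ m).boundary M, ∀ᶠ z in 𝓝 x, S z = chartExtend x₀ G z := by
  have hTeq : (extChartAt (𝓡∂ m) x₀).target = halfSpace (firstCoord m) ∩ chartOpen x₀ :=
    extChartAt_target_eq x₀
  have hT : (extChartAt (𝓡∂ m) x₀).target ⊆ halfSpace (firstCoord m) := hTeq ▸ inter_subset_left
  have hod : ∀ y ∈ halfSpace (firstCoord m) ∩ chartOpen x₀,
      oneFormDeriv (halfSpace (firstCoord m)) (inChartAdd θ A x₀) y =
        oneFormDeriv (halfSpace (firstCoord m)) (θ.inChart x₀) y := fun y hy ↦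
    oneFormDeriv_inChartAdd θ hA (hTeq ▸ hy)
  obtain ⟨φ, X, K, s, Q, hQ, hQO, hφ, hK, hs, hφH, hφinv, hφ0, hφb, hφQ, hKQ, hsQ, hφd, hXK, hpull,
      hsG⟩ :=
    exists_local_isotopy (firstCoord_single (m := m)) (isOpen_chartOpen x₀)
      (contDiffOn_inChartAdd θ hA)
      (fun y hy v hv ↦ oneFormDeriv_inChart_nondegenerate hθ (hTeq ▸ hy) v fun w ↦ by
        rw [← hod y hy]
        exact hv w)
      (fun y hy hy0 z hz ↦ firstCoord_neg_of_isLiouvilleForm hθ hA hA0 hy hy0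
        (by rwa [hod y ⟨hy0.ge, hy⟩] at hz))
      hG hC hCO hGC hG0
  have hφH' : ∀ t ∈ Icc (0 : ℝ) 1, MapsTo (fun y ↦ φ (t, y)) (halfSpace (firstCoord m))
      (halfSpace (firstCoord m)) := fun t ht y hy ↦ hφH ⟨ht, hy⟩
  have hφs : ∀ t ∈ Icc (0 : ℝ) 1, ContDiffOn ℝ ∞ (fun y ↦ φ (t, y)) (halfSpace (firstCoord m)) :=
    fun t ht ↦ hφ.comp (contDiff_const.prodMk contDiff_id).contDiffOn fun y hy ↦ ⟨ht, hy⟩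
  choose! ψ hψ hψH hψφ hφψ using hφinv
  let β : ℝ → ℝ := Real.smoothTransition
  have hβ : ContDiff ℝ ∞ β := Real.smoothTransition.contDiff
  have hβI : ∀ t, β t ∈ Icc (0 : ℝ) 1 := fun t ↦
    ⟨Real.smoothTransition.nonneg t, Real.smoothTransition.le_one t⟩
  have hβ0 : β 0 = 0 := Real.smoothTransition.zero
  have hβ1 : β 1 = 1 := Real.smoothTransition.one
  have hβd : ∀ t, HasDerivAt β (deriv β t) t := fun t ↦
    (hβ.differentiable (by simp) t).hasDerivAt
  have hβ' : ContDiff ℝ ∞ (deriv β) := (contDiff_infty_iff_deriv.1 hβ).2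
  have hφT : ∀ t ∈ Icc (0 : ℝ) 1, MapsTo (fun y ↦ φ (t, y)) (extChartAt (𝓡∂ m) x₀).target
      (extChartAt (𝓡∂ m) x₀).target := fun t ht ↦
    mapsTo_target_of_eq_off hQO (hφH' t ht) (hψφ t ht) (hφQ t ht)
  let Ψ : ℝ → M ≃ₘ^∞⟮𝓡∂ m, 𝓡∂ m⟯ M := fun t ↦
    transplantDiffeomorph x₀ hQ hQO (hφs _ (hβI t)) (hψ _ (hβI t)) (hφH' _ (hβI t)) (hψH _ (hβI t))
      (hψφ _ (hβI t)) (hφψ _ (hβI t)) (hφQ _ (hβI t))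
  have hΨ : ∀ t x, Ψ t x = transplant x₀ (fun y ↦ φ (β t, y)) x := fun _ _ ↦ rfl
  have hm : MapsTo (fun p : ℝ × EuclideanSpace ℝ (Fin m) ↦ (β p.1, p.2))
      (univ ×ˢ (extChartAt (𝓡∂ m) x₀).target) (Icc 0 1 ×ˢ halfSpace (firstCoord m)) :=
    fun p hp ↦ ⟨hβI _, hT hp.2⟩
  have hms : ContDiffOn ℝ ∞ (fun p : ℝ × EuclideanSpace ℝ (Fin m) ↦ (β p.1, p.2))
      (univ ×ˢ (extChartAt (𝓡∂ m) x₀).target) :=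
    ((hβ.comp contDiff_fst).prodMk contDiff_snd).contDiffOn
  have hΨs : ContMDiff (𝓘(ℝ, ℝ).prod (𝓡∂ m)) (𝓡∂ m) ∞ (fun p : ℝ × M ↦ Ψ p.1 p.2) :=
    contMDiff_transplant (F := fun p ↦ φ (β p.1, p.2)) hQ hQO (hφ.comp hms hm)
      (fun p hp ↦ hφT _ (hβI _) hp.2) fun t y hy ↦ hφQ _ (hβI t) y (hT hy)
  let Hm : ℝ → M → ℝ := fun t ↦ chartExtend x₀ (fun y ↦ deriv β t * K (β t, y))
  have hHs : ContMDiff (𝓘(ℝ, ℝ).prod (𝓡∂ m)) 𝓘(ℝ, ℝ) ∞ (fun p : ℝ × M ↦ Hm p.1 p.2) :=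
    contMDiff_chartExtend (K := fun p ↦ deriv β p.1 * K (β p.1, p.2)) hQ hQO
      ((hβ'.comp contDiff_fst).contDiffOn.mul (hK.comp hms hm))
      fun t y hy hyQ ↦ by simp [hKQ _ (hβI t) y (hT hy) hyQ]
  have hSs : ContMDiff (𝓡∂ m) 𝓘(ℝ, ℝ) ∞ (chartExtend x₀ s) :=
    (contMDiff_chartExtend (x₀ := x₀) (K := fun p ↦ s p.2) hQ hQO
      (hs.comp contDiff_snd.contDiffOn fun p hp ↦ hT hp.2) fun _ y hy ↦ hsQ y (hT hy)).comp
        (contMDiff_const (c := (0 : ℝ)).prodMk contMDiff_id)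
  have hoff : ∀ x ∉ (extChartAt (𝓡∂ m) x₀).source, ∀ᶠ z in 𝓝 x, z ∉ chartImage x₀ Q := fun x hx ↦
    (isClosed_chartImage hQ hQO).isOpen_compl.mem_nhds fun h ↦ hx (chartImage_subset_source hQO h)
  refine ⟨Ψ, ⟨hΨs, fun x ↦ ?_, fun t x hx ↦ ?_, Hm, hHs, fun t x w ↦ ?_⟩, chartExtend x₀ s, hSs,
    fun x w ↦ ?_, fun x hx ↦ ?_⟩
  · rw [hΨ, hβ0]
    exact transplant_of_notMem_chartImage (Q := ∅) (fun y hy _ ↦ hφ0 y (hT hy)) (by simp [chartImage])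
  · rw [hΨ]
    by_cases hxs : x ∈ (extChartAt (𝓡∂ m) x₀).source
    · rw [mem_boundary_iff_of_mem_source x₀ hxs] at hx
      rw [transplant_of_mem hxs, hφb _ (hβI t) _ hx, (extChartAt (𝓡∂ m) x₀).left_inv hxs]
    · exact transplant_of_notMem hxs
  · have hHd : MDifferentiableAt (𝓡∂ m) 𝓘(ℝ, ℝ) (Hm t) (Ψ t x) :=
      (hHs.comp (contMDiff_const (c := t).prodMk contMDiff_id)).mdifferentiableAt (by simp)
    by_cases hxs : x ∈ (extChartAt (𝓡∂ m) x₀).source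
    · obtain ⟨y, hy, rfl⟩ := exists_eq_symm hxs
      have hΨy : ∀ s, Ψ s ((extChartAt (𝓡∂ m) x₀).symm y) =
          (extChartAt (𝓡∂ m) x₀).symm (φ (β s, y)) := fun s ↦
        transplant_symm (f := fun y ↦ φ (β s, y)) hy
      have hcΨ : ∀ s, extChartAt (𝓡∂ m) x₀ (Ψ s ((extChartAt (𝓡∂ m) x₀).symm y)) = φ (β s, y) :=
        fun s ↦ by rw [hΨy, (extChartAt (𝓡∂ m) x₀).right_inv (hφT _ (hβI s) hy)]
      refine d_mfderiv_curve_eq_of_chart θ (x₀ := x₀) (F := Hm t)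
        (γ := fun s ↦ Ψ s ((extChartAt (𝓡∂ m) x₀).symm y))
        (V := deriv β t • X (β t, φ (β t, y)))
        ((hΨs.comp (contMDiff_id.prodMk contMDiff_const)).mdifferentiableAt (by simp)) hHd ?_ ?_ ?_ w
      · rw [hΨy]
        exact (extChartAt (𝓡∂ m) x₀).map_target (hφT _ (hβI t) hy)
      · have h1 := (hφd y (hT hy) (β t) (hβI t)).scomp_hasDerivAt t (hβd t) hβI
        refine h1.congr_of_eventuallyEq (.of_forall fun s ↦ hcΨ s)
      · intro w'
        rw [hcΨ, map_smul, smul_apply, ← hod _ (hTeq ▸ hφT _ (hβI t) hy),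
          hXK _ (hβI t) _ (hTeq ▸ hφT _ (hβI t) hy), smul_eq_mul, mul_neg]
        have hKd := (hasFDerivWithinAt_spatialFDerivWithin (hK.differentiableOn (by simp)) (hβI t)
          (hT (hφT _ (hβI t) hy))).const_mul (deriv β t)
        have hHm : ∀ z ∈ (extChartAt (𝓡∂ m) x₀).target,
            Hm t ((extChartAt (𝓡∂ m) x₀).symm z) = deriv β t * K (β t, z) := fun z hz ↦
          chartExtend_symm (k := fun y ↦ deriv β t * K (β t, y)) hz
        have h2 : HasFDerivWithinAt (Hm t ∘ (extChartAt (𝓡∂ m) x₀).symm)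
            (deriv β t • spatialFDerivWithin K (halfSpace (firstCoord m)) (β t, φ (β t, y)))
            (halfSpace (firstCoord m)) (φ (β t, y)) := by
          refine hKd.congr_of_eventuallyEq ?_ (hHm _ (hφT _ (hβI t) hy))
          rw [← range_model]
          filter_upwards [extChartAt_target_mem_nhdsWithin_of_mem (hφT _ (hβI t) hy)] with z hz
          exact hHm z hz
        rw [h2.fderivWithin (uniqueDiffOn_halfSpace firstCoord_single _ (hT (hφT _ (hβI t) hy))),
          smul_apply, smul_eq_mul]
    · have h1 : ∀ s, Ψ s x = x := fun s ↦ transplant_of_notMem (f := fun y ↦ φ (β s, y)) hxs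
      have h2 : (mfderiv 𝓘(ℝ, ℝ) (𝓡∂ m) (fun s ↦ Ψ s x) t (1 : ℝ) : EuclideanSpace ℝ (Fin m)) = 0 := by
        have : (fun s ↦ Ψ s x) = fun _ ↦ x := funext h1
        rw [this, mfderiv_const]
        rfl
      have h3 : differential (m := m) (Hm t) (Ψ t x) = 0 := by
        rw [h1 t]
        refine differential_eq_zero_of_eventuallyEq ((hoff x hxs).mono fun z hz ↦ ?_)
        exact chartExtend_of_notMem_chartImage
          (fun y hy hyQ ↦ by simp [hKQ _ (hβI t) y (hT hy) hyQ]) hz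
      have h4 : (mfderiv (𝓡∂ m) 𝓘(ℝ, ℝ) (Hm t) (Ψ t x) w : ℝ) = 0 :=
        congrArg (fun B : EuclideanSpace ℝ (Fin m) →L[ℝ] ℝ ↦ B w) h3
      rw [h4, neg_zero]
      have h5 := d_eq_oneFormDeriv θ (x₀ := Ψ t x) (mem_extChartAt_source (Ψ t x))
        (mfderiv 𝓘(ℝ, ℝ) (𝓡∂ m) (fun s ↦ Ψ s x) t (1 : ℝ)) w
      have h6 : ∀ (B : EuclideanSpace ℝ (Fin m) →L[ℝ] EuclideanSpace ℝ (Fin m) →L[ℝ] ℝ)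
          (D : EuclideanSpace ℝ (Fin m) →L[ℝ] EuclideanSpace ℝ (Fin m)) (u u' : EuclideanSpace ℝ (Fin m)),
          u = 0 → B (D u) u' = 0 := by
        rintro B D _ u' rfl
        simp
      exact h5.trans (h6 _ (chartDeriv (Ψ t x) (Ψ t x)) _ _ h2)
  · by_cases hxs : x ∈ (extChartAt (𝓡∂ m) x₀).source
    · obtain ⟨y, hy, rfl⟩ := exists_eq_symm hxs
      have hf1 : MapsTo (fun y ↦ φ (1, y)) (extChartAt (𝓡∂ m) x₀).target
          (extChartAt (𝓡∂ m) x₀).target := hφT 1 ⟨zero_le_one, le_rfl⟩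
      have hΨy : ∀ z ∈ (extChartAt (𝓡∂ m) x₀).target, Ψ 1 ((extChartAt (𝓡∂ m) x₀).symm z) =
          (extChartAt (𝓡∂ m) x₀).symm (φ (1, z)) := fun z hz ↦
        (transplant_symm (f := fun y ↦ φ (β 1, y)) hz).trans (by simp only [hβ1])
      have h1 := chartDeriv_mfderiv (x₀ := x₀) (Ψ 1).contMDiff hf1 hΨy hy w
      have hΨsrc : Ψ 1 ((extChartAt (𝓡∂ m) x₀).symm y) ∈ (extChartAt (𝓡∂ m) x₀).source := by
        rw [hΨy y hy]
        exact (extChartAt (𝓡∂ m) x₀).map_target (hf1 hy)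
      have h2 := inChartAdd_chartDeriv θ hA hΨsrc (mfderiv (𝓡∂ m) (𝓡∂ m) (Ψ 1) _ w)
      have hcΨ : extChartAt (𝓡∂ m) x₀ (Ψ 1 ((extChartAt (𝓡∂ m) x₀).symm y)) = φ (1, y) := by
        rw [hΨy y hy, (extChartAt (𝓡∂ m) x₀).right_inv (hf1 hy)]
      rw [h1, hcΨ, hpull y (hTeq ▸ hy)] at h2
      have h3 := inChartAdd_chartDeriv θ hA hxs w
      rw [(extChartAt (𝓡∂ m) x₀).right_inv hy] at h3
      have h4 := fderivWithin_comp_extChartAt_symm (F := chartExtend x₀ s) hxs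
        (hSs.mdifferentiableAt (by simp)) w
      rw [range_model, (extChartAt (𝓡∂ m) x₀).right_inv hy] at h4
      have h5 : fderivWithin ℝ (chartExtend x₀ s ∘ (extChartAt (𝓡∂ m) x₀).symm)
          (halfSpace (firstCoord m)) y = fderivWithin ℝ s (halfSpace (firstCoord m)) y := by
        refine Filter.EventuallyEq.fderivWithin_eq ?_ (chartExtend_symm hy)
        rw [← range_model]
        filter_upwards [extChartAt_target_mem_nhdsWithin_of_mem hy] with z hz
        exact chartExtend_symm hz
      rw [h5] at h4
      rw [h3] at h2
      refine h2.symm.trans (congrArg (fun r : ℝ ↦ _ + r) h4)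
    · have h1 : Ψ 1 =ᶠ[𝓝 x] id := (hoff x hxs).mono fun z hz ↦
        transplant_of_notMem_chartImage (fun y hy ↦ hφQ _ (hβI 1) y (hT hy)) hz
      have h2 : differential (m := m) (chartExtend x₀ s) x = 0 :=
        differential_eq_zero_of_eventuallyEq ((hoff x hxs).mono fun z hz ↦
          chartExtend_of_notMem_chartImage (fun y hy ↦ hsQ y (hT hy)) hz)
      rw [h2, apply_mfderiv_of_eventuallyEq_id θ h1, differential_mfderiv_of_eventuallyEq_id h1]
      exact (add_zero _).symm
  · by_cases hxs : x ∈ (extChartAt (𝓡∂ m) x₀).source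
    · rw [mem_boundary_iff_of_mem_source x₀ hxs] at hx
      refine (eventually_extChartAt_mem hxs (hsG _ hx)).mono fun z hz ↦ ?_
      rw [chartExtend_of_mem hz.1, chartExtend_of_mem hz.1, hz.2]
    · have h1 : ∀ᶠ z in 𝓝 x, z ∉ chartImage x₀ C :=
        (isClosed_chartImage hC hCO).isOpen_compl.mem_nhds fun h ↦
          hxs (chartImage_subset_source hCO h)
      filter_upwards [hoff x hxs, h1] with z hz hz'
      rw [chartExtend_of_notMem_chartImage (fun y hy ↦ hsQ y (hT hy)) hz,
        chartExtend_of_notMem_chartImage (fun y hy ↦ hGC y (hT hy)) hz']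

end ChartIsotopy

/-! ### Concatenation of Hamiltonian isotopies -/

section Concatenation

variable {m : ℕ} [NeZero m] {M : Type*} [TopologicalSpace M]
  [ChartedSpace (EuclideanHalfSpace m) M] [IsManifold (𝓡∂ m) ∞ M]

/-- The velocity of a curve in `M`, as a vector of the coordinate space. -/
noncomputable def curveVelocity (γ : ℝ → M) (t : ℝ) : EuclideanSpace ℝ (Fin m) :=
  mfderiv 𝓘(ℝ, ℝ) (𝓡∂ m) γ t (1 : ℝ)

/-- The tangent vector `v` at `x` is the value at `x` of the Hamiltonian vector field of `F`. -/
def IsHamiltonianVector (θ : OneForm m M) (x : M) (v : EuclideanSpace ℝ (Fin m)) (F : M → ℝ) : Prop :=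
  ∀ w : EuclideanSpace ℝ (Fin m), θ.d x v w = -differential F x w

variable {θ : OneForm m M} {x : M} {v : EuclideanSpace ℝ (Fin m)} {F : M → ℝ}

theorem IsHamiltonianVector.smul (h : IsHamiltonianVector θ x v F)
    (hF : MDifferentiableAt (𝓡∂ m) 𝓘(ℝ, ℝ) F x) (c : ℝ) :
    IsHamiltonianVector θ x (c • v) fun z ↦ c * F z := fun w ↦ by
  have h1 : differential (m := m) (fun z ↦ c * F z) x = c • differential F x :=
    (hF.hasMFDerivAt.const_smul c).mfderiv
  have h2 : ∀ (B : EuclideanSpace ℝ (Fin m) →L[ℝ] EuclideanSpace ℝ (Fin m) →L[ℝ] ℝ)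
      (D : EuclideanSpace ℝ (Fin m) →L[ℝ] EuclideanSpace ℝ (Fin m)),
      B (D (c • v)) (D w) = c * B (D v) (D w) := by simp
  have h3 := d_eq_oneFormDeriv θ (mem_extChartAt_source x) (c • v) w
  have h4 := d_eq_oneFormDeriv θ (mem_extChartAt_source x) v w
  rw [h1, smul_apply, smul_eq_mul, ← mul_neg, ← h w, h4]
  exact h3.trans (h2 _ (chartDeriv x x))

theorem isHamiltonianVector_zero : IsHamiltonianVector θ x 0 fun _ ↦ 0 := fun w ↦ by
  have h1 : differential (m := m) (fun _ : M ↦ (0 : ℝ)) x = 0 := mfderiv_const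
  have h2 : ∀ (B : EuclideanSpace ℝ (Fin m) →L[ℝ] EuclideanSpace ℝ (Fin m) →L[ℝ] ℝ)
      (D : EuclideanSpace ℝ (Fin m) →L[ℝ] EuclideanSpace ℝ (Fin m)), B (D 0) (D w) = 0 := by simp
  rw [h1, zero_apply, neg_zero]
  exact (d_eq_oneFormDeriv θ (mem_extChartAt_source x) 0 w).trans (h2 _ (chartDeriv x x))

theorem curveVelocity_congr {γ γ' : ℝ → M} {t : ℝ} (h : γ =ᶠ[𝓝 t] γ') :
    curveVelocity (m := m) γ t = curveVelocity γ' t :=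
  congrArg (fun B : ℝ →L[ℝ] EuclideanSpace ℝ (Fin m) ↦ B 1)
    (h.mfderiv_eq (I := 𝓘(ℝ, ℝ)) (I' := 𝓡∂ m))

theorem curveVelocity_comp {γ : ℝ → M} {b : ℝ → ℝ} {t b' : ℝ}
    (hγ : MDifferentiableAt 𝓘(ℝ, ℝ) (𝓡∂ m) γ (b t)) (hb : HasDerivAt b b' t) :
    curveVelocity (m := m) (fun s ↦ γ (b s)) t = b' • curveVelocity γ (b t) := by
  have h1 := (hγ.hasMFDerivAt.comp t hb.hasFDerivAt.hasMFDerivAt).mfderiv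
  refine (congrArg (fun B : ℝ →L[ℝ] EuclideanSpace ℝ (Fin m) ↦ B 1) h1).trans ?_
  have h2 : ∀ B : ℝ →L[ℝ] EuclideanSpace ℝ (Fin m),
      (B.comp (ContinuousLinearMap.toSpanSingleton ℝ b')) 1 = b' • B 1 := fun B ↦ by
    rw [ContinuousLinearMap.comp_apply, ContinuousLinearMap.toSpanSingleton_apply, one_smul,
      ← map_smul, smul_eq_mul, mul_one]
  exact h2 _

variable (θ) in
theorem isHamiltonianIsotopyRelBoundary_refl :
    IsHamiltonianIsotopyRelBoundary θ fun _ ↦ Diffeomorph.refl (𝓡∂ m) M ∞ where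
  contMDiff := contMDiff_snd
  map_zero _ := rfl
  fixes_boundary _ _ _ := rfl
  hamiltonian := by
    refine ⟨fun _ _ ↦ 0, contMDiff_const, fun t x w ↦ ?_⟩
    have h : curveVelocity (m := m) (fun _ ↦ x) t = 0 :=
      congrArg (fun B : ℝ →L[ℝ] EuclideanSpace ℝ (Fin m) ↦ B 1) (mfderiv_const (I := 𝓘(ℝ, ℝ)))
    have h1 : IsHamiltonianVector θ x (curveVelocity (m := m) (fun _ ↦ x) t) fun _ ↦ 0 :=
      h ▸ isHamiltonianVector_zero
    exact h1 w

/-- Two Hamiltonian isotopies can be performed one after the other, each of them slowed down so that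
the result is smooth in time. -/
theorem IsHamiltonianIsotopyRelBoundary.exists_concat {Φ Ψ : ℝ → M ≃ₘ^∞⟮𝓡∂ m, 𝓡∂ m⟯ M}
    (hΦ : IsHamiltonianIsotopyRelBoundary θ Φ) (hΨ : IsHamiltonianIsotopyRelBoundary θ Ψ) :
    ∃ Ξ : ℝ → M ≃ₘ^∞⟮𝓡∂ m, 𝓡∂ m⟯ M, IsHamiltonianIsotopyRelBoundary θ Ξ ∧
      ∀ x, Ξ 1 x = Φ 1 (Ψ 1 x) := by
  obtain ⟨H, hH, hHam⟩ := hΦ.hamiltonian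
  obtain ⟨H', hH', hHam'⟩ := hΨ.hamiltonian
  -- `Ψ` is performed before the time `1/3`, and `Φ` after the time `2/3`
  let b : ℝ → ℝ := fun t ↦ Real.smoothTransition (3 * t)
  let c : ℝ → ℝ := fun t ↦ Real.smoothTransition (3 * t - 2)
  have hb : ContDiff ℝ ∞ b := Real.smoothTransition.contDiff.comp (contDiff_const.mul contDiff_id)
  have hc : ContDiff ℝ ∞ c :=
    Real.smoothTransition.contDiff.comp ((contDiff_const.mul contDiff_id).sub contDiff_const)
  have hbd : ∀ t, HasDerivAt b (deriv b t) t := fun t ↦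
    (hb.differentiable (by simp) t).hasDerivAt
  have hcd : ∀ t, HasDerivAt c (deriv c t) t := fun t ↦
    (hc.differentiable (by simp) t).hasDerivAt
  have hb1 : ∀ t, 1 / 3 < t → b t = 1 := fun t ht ↦
    Real.smoothTransition.one_of_one_le (by linarith)
  have hc0 : ∀ t, t < 2 / 3 → c t = 0 := fun t ht ↦
    Real.smoothTransition.zero_of_nonpos (by linarith)
  have hb0 : b 0 = 0 := Real.smoothTransition.zero_of_nonpos (by simp)
  have hc1 : c 1 = 1 := Real.smoothTransition.one_of_one_le (by norm_num)
  have hbm : ContMDiff (𝓘(ℝ, ℝ).prod (𝓡∂ m)) 𝓘(ℝ, ℝ) ∞ (fun p : ℝ × M ↦ b p.1) :=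
    hb.contMDiff.comp contMDiff_fst
  have hcm : ContMDiff (𝓘(ℝ, ℝ).prod (𝓡∂ m)) 𝓘(ℝ, ℝ) ∞ (fun p : ℝ × M ↦ c p.1) :=
    hc.contMDiff.comp contMDiff_fst
  have hbm' : ContMDiff (𝓘(ℝ, ℝ).prod (𝓡∂ m)) 𝓘(ℝ, ℝ) ∞ (fun p : ℝ × M ↦ deriv b p.1) :=
    (contDiff_infty_iff_deriv.1 hb).2.contMDiff.comp contMDiff_fst
  have hcm' : ContMDiff (𝓘(ℝ, ℝ).prod (𝓡∂ m)) 𝓘(ℝ, ℝ) ∞ (fun p : ℝ × M ↦ deriv c p.1) :=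
    (contDiff_infty_iff_deriv.1 hc).2.contMDiff.comp contMDiff_fst
  refine ⟨fun t ↦ (Ψ (b t)).trans (Φ (c t)), ⟨?_, fun x ↦ ?_, fun t x hx ↦ ?_, fun t x ↦
    deriv b t * H' (b t) x + deriv c t * H (c t) x, ?_, fun t x ↦ ?_⟩, fun x ↦ ?_⟩
  · exact hΦ.contMDiff.comp (hcm.prodMk (hΨ.contMDiff.comp (hbm.prodMk contMDiff_snd)))
  · change Φ (c 0) (Ψ (b 0) x) = x
    rw [hb0, hc0 0 (by norm_num), hΨ.map_zero, hΦ.map_zero]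
  · change Φ (c t) (Ψ (b t) x) = x
    rw [hΨ.fixes_boundary _ x hx, hΦ.fixes_boundary _ x hx]
  · exact (hbm'.mul (hH'.comp (hbm.prodMk contMDiff_snd))).add
      (hcm'.mul (hH.comp (hcm.prodMk contMDiff_snd)))
  · suffices h : IsHamiltonianVector θ (Φ (c t) (Ψ (b t) x))
        (curveVelocity (fun s ↦ Φ (c s) (Ψ (b s) x)) t)
        fun x ↦ deriv b t * H' (b t) x + deriv c t * H (c t) x from h
    rcases lt_or_ge t (2 / 3) with ht | ht
    · have h1 : ∀ᶠ s in 𝓝 t, c s = 0 := (gt_mem_nhds ht).mono hc0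
      have h2 : deriv c t = 0 := by
        rw [Filter.EventuallyEq.deriv_eq (f := fun _ ↦ (0 : ℝ)) h1, deriv_const]
      have h3 : (fun s ↦ Φ (c s) (Ψ (b s) x)) =ᶠ[𝓝 t] fun s ↦ Ψ (b s) x := h1.mono fun s hs ↦ by
        simp only [hs, hΦ.map_zero]
      have h4 : (fun x ↦ deriv b t * H' (b t) x + deriv c t * H (c t) x) =
          fun x ↦ deriv b t * H' (b t) x := by
        simp [h2]
      rw [curveVelocity_congr h3, h4, h3.eq_of_nhds]
      rw [curveVelocity_comp (γ := fun s ↦ Ψ s x) ((hΨ.contMDiff.comp (contMDiff_id.prodMk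
        contMDiff_const)).mdifferentiableAt (by simp)) (hbd t)]
      exact IsHamiltonianVector.smul (hHam' (b t) x) ((hH'.comp (contMDiff_const.prodMk
        contMDiff_id)).mdifferentiableAt (by simp)) _
    · have h1 : ∀ᶠ s in 𝓝 t, b s = 1 := (lt_mem_nhds (by linarith : 1 / 3 < t)).mono hb1
      have h2 : deriv b t = 0 := by
        rw [Filter.EventuallyEq.deriv_eq (f := fun _ ↦ (1 : ℝ)) h1, deriv_const]
      have h3 : (fun s ↦ Φ (c s) (Ψ (b s) x)) =ᶠ[𝓝 t] fun s ↦ Φ (c s) (Ψ 1 x) :=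
        h1.mono fun s hs ↦ by simp only [hs]
      have h4 : (fun x ↦ deriv b t * H' (b t) x + deriv c t * H (c t) x) =
          fun x ↦ deriv c t * H (c t) x := by
        simp [h2]
      rw [curveVelocity_congr h3, h4, h3.eq_of_nhds]
      rw [curveVelocity_comp (γ := fun s ↦ Φ s (Ψ 1 x)) ((hΦ.contMDiff.comp (contMDiff_id.prodMk
        contMDiff_const)).mdifferentiableAt (by simp)) (hcd t)]
      exact IsHamiltonianVector.smul (hHam (c t) (Ψ 1 x)) ((hH.comp (contMDiff_const.prodMk
        contMDiff_id)).mdifferentiableAt (by simp)) _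
  · change Φ (c 1) (Ψ (b 1) x) = _
    rw [hc1, hb1 1 (by norm_num)]

theorem differential_add {F' : M → ℝ} (hF : MDifferentiableAt (𝓡∂ m) 𝓘(ℝ, ℝ) F x)
    (hF' : MDifferentiableAt (𝓡∂ m) 𝓘(ℝ, ℝ) F' x) :
    differential (m := m) (fun z ↦ F z + F' z) x = differential F x + differential F' x :=
  (hF.hasMFDerivAt.add hF'.hasMFDerivAt).mfderiv

/-- A finite sum of functions supported in charts and vanishing on the boundary is, near the boundary,
a primitive of the change of `θ` under a Hamiltonian isotopy. The isotopies of the local theorem for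
the successive summands are concatenated, each of them being constructed for the form which the
preceding ones produce. -/
theorem exists_isotopy_of_sum_chartExtend [T2Space M] (hθ : IsLiouvilleForm θ) {ι : Type*}
    (s : Finset ι) (c : ι → M) {G : ι → EuclideanSpace ℝ (Fin m) → ℝ}
    {C : ι → Set (EuclideanSpace ℝ (Fin m))}
    (hG : ∀ i, ContDiffOn ℝ ∞ (G i) (halfSpace (firstCoord m))) (hC : ∀ i, IsCompact (C i))
    (hCO : ∀ i, C i ⊆ chartOpen (c i))
    (hGC : ∀ i, ∀ y ∈ halfSpace (firstCoord m), y ∉ C i → G i y = 0)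
    (hG0 : ∀ i y, firstCoord m y = 0 → G i y = 0) :
    ∃ Φ : ℝ → M ≃ₘ^∞⟮𝓡∂ m, 𝓡∂ m⟯ M, IsHamiltonianIsotopyRelBoundary θ Φ ∧
      ∃ S : M → ℝ, ContMDiff (𝓡∂ m) 𝓘(ℝ, ℝ) ∞ S ∧
        (∀ (x : M) (w : TangentSpace (𝓡∂ m) x),
          θ (Φ 1 x) (mfderiv (𝓡∂ m) (𝓡∂ m) (Φ 1) x w) = θ x w + differential S x w) ∧
        ∀ x ∈ (𝓡∂ m).boundary M, ∀ᶠ z in 𝓝 x, S z = ∑ i ∈ s, chartExtend (c i) (G i) z := by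
  classical
  induction s using Finset.induction_on with
  | empty =>
    refine ⟨_, isHamiltonianIsotopyRelBoundary_refl θ, fun _ ↦ 0, contMDiff_const, fun x w ↦ ?_,
      fun x _ ↦ by simp⟩
    have h1 : differential (m := m) (fun _ : M ↦ (0 : ℝ)) x = 0 := mfderiv_const
    rw [h1]
    exact (apply_mfderiv_of_eventuallyEq_id θ (Ψ := id) (.of_forall fun _ ↦ rfl) w).trans
      (add_zero _).symm
  | insert i s hi ih =>
    obtain ⟨Φ, hΦ, S, hS, hpull, hSG⟩ := ih
    have hS0 : ∀ x ∈ (𝓡∂ m).boundary M, S x = 0 := fun x hx ↦ by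
      rw [(hSG x hx).self_of_nhds]
      refine Finset.sum_eq_zero fun j _ ↦ ?_
      by_cases hxs : x ∈ (extChartAt (𝓡∂ m) (c j)).source
      · rw [mem_boundary_iff_of_mem_source (c j) hxs] at hx
        rw [chartExtend_of_mem hxs, hG0 j _ hx]
      · exact chartExtend_of_notMem hxs
    obtain ⟨Ψ, hΨ, S', hS', hpull', hSG'⟩ := exists_isotopy_of_chart hθ hS hS0 (c i) (hG i) (hC i)
      (hCO i) (hGC i) (hG0 i)
    obtain ⟨Ξ, hΞ, hΞ1⟩ := hΦ.exists_concat hΨ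
    refine ⟨Ξ, hΞ, fun z ↦ S z + S' z, hS.add hS', fun x w ↦ ?_, fun x hx ↦ ?_⟩
    · rw [differential_add (hS.mdifferentiableAt (by simp)) (hS'.mdifferentiableAt (by simp))]
      have hcomp : ⇑(Ξ 1) = Φ 1 ∘ Ψ 1 := funext hΞ1
      have hD : mfderiv (𝓡∂ m) (𝓡∂ m) (Φ 1 ∘ Ψ 1) x =
          (mfderiv (𝓡∂ m) (𝓡∂ m) (Φ 1) (Ψ 1 x)).comp (mfderiv (𝓡∂ m) (𝓡∂ m) (Ψ 1) x) :=
        mfderiv_comp x ((Φ 1).contMDiff.mdifferentiableAt (by simp))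
          ((Ψ 1).contMDiff.mdifferentiableAt (by simp))
      have h1 := hpull (Ψ 1 x) (mfderiv (𝓡∂ m) (𝓡∂ m) (Ψ 1) x w)
      have h2 := hpull' x w
      have h3 : θ (Φ 1 (Ψ 1 x)) (mfderiv (𝓡∂ m) (𝓡∂ m) (Φ 1 ∘ Ψ 1) x w) =
          θ x w + differential S x w + differential S' x w :=
        (congrArg (fun u : EuclideanSpace ℝ (Fin m) ↦ (θ (Φ 1 (Ψ 1 x)) u : ℝ))
          (congrArg (fun B : EuclideanSpace ℝ (Fin m) →L[ℝ] EuclideanSpace ℝ (Fin m) ↦ B w) hD)).trans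
          (h1.trans h2)
      rw [hcomp]
      exact h3.trans (add_assoc _ _ _)
    · filter_upwards [hSG x hx, hSG' x hx] with z hz hz'
      rw [Finset.sum_insert hi, hz, hz', add_comm]

end Concatenation

/-! ### Realizing a function near the boundary -/

section Realize

variable {m : ℕ} [NeZero m] {M : Type*} [TopologicalSpace M]
  [ChartedSpace (EuclideanHalfSpace m) M] [IsManifold (𝓡∂ m) ∞ M] [T2Space M] [CompactSpace M]

open Classical in
/-- A smooth function on `M` with support in the domain of a chart comes from a function on the
half-space. -/
theorem exists_chartExtend_eq {A : M → ℝ} (hA : ContMDiff (𝓡∂ m) 𝓘(ℝ, ℝ) ∞ A)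
    (hA0 : ∀ x ∈ (𝓡∂ m).boundary M, A x = 0) {x₀ : M}
    (hsupp : tsupport A ⊆ (extChartAt (𝓡∂ m) x₀).source) :
    ∃ (G : EuclideanSpace ℝ (Fin m) → ℝ) (C : Set (EuclideanSpace ℝ (Fin m))),
      ContDiffOn ℝ ∞ G (halfSpace (firstCoord m)) ∧ IsCompact C ∧ C ⊆ chartOpen x₀ ∧
      (∀ y ∈ halfSpace (firstCoord m), y ∉ C → G y = 0) ∧ (∀ y, firstCoord m y = 0 → G y = 0) ∧
      chartExtend x₀ G = A := by
  have hTeq : (extChartAt (𝓡∂ m) x₀).target = halfSpace (firstCoord m) ∩ chartOpen x₀ :=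
    extChartAt_target_eq x₀
  let G : EuclideanSpace ℝ (Fin m) → ℝ := fun y ↦
    if y ∈ (extChartAt (𝓡∂ m) x₀).target then A ((extChartAt (𝓡∂ m) x₀).symm y) else 0
  have hC : IsCompact (extChartAt (𝓡∂ m) x₀ '' tsupport A) :=
    (isClosed_tsupport A).isCompact.image_of_continuousOn ((continuousOn_extChartAt x₀).mono hsupp)
  have hCT : extChartAt (𝓡∂ m) x₀ '' tsupport A ⊆ (extChartAt (𝓡∂ m) x₀).target := by
    rintro _ ⟨x, hx, rfl⟩
    exact (extChartAt (𝓡∂ m) x₀).map_source (hsupp hx)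
  have hCO : extChartAt (𝓡∂ m) x₀ '' tsupport A ⊆ chartOpen x₀ :=
    hCT.trans (hTeq ▸ inter_subset_right)
  have hGC : ∀ y, y ∉ extChartAt (𝓡∂ m) x₀ '' tsupport A → G y = 0 := fun y hy ↦ by
    by_cases hyT : y ∈ (extChartAt (𝓡∂ m) x₀).target
    · simp only [G, if_pos hyT]
      by_contra h
      exact hy ⟨_, subset_tsupport A h, (extChartAt (𝓡∂ m) x₀).right_inv hyT⟩
    · exact if_neg hyT
  refine ⟨G, _, ?_, hC, hCO, fun y _ ↦ hGC y, fun y hy ↦ ?_, funext fun x ↦ ?_⟩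
  · refine ContDiffOn.of_eq_zero (A := chartOpen x₀) ?_ (isOpen_chartOpen x₀) hC.isClosed hCO
      fun y _ ↦ hGC y
    rw [← hTeq]
    exact (contDiffOn_comp_extChartAt_symm hA).congr fun y hy ↦ if_pos hy
  · by_cases hyT : y ∈ (extChartAt (𝓡∂ m) x₀).target
    · simp only [G, if_pos hyT]
      refine hA0 _ ?_
      rw [mem_boundary_iff_of_mem_source x₀ ((extChartAt (𝓡∂ m) x₀).map_target hyT),
        (extChartAt (𝓡∂ m) x₀).right_inv hyT, hy]
    · exact if_neg hyT
  · by_cases hx : x ∈ (extChartAt (𝓡∂ m) x₀).source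
    · rw [chartExtend_of_mem hx]
      simp only [G, if_pos ((extChartAt (𝓡∂ m) x₀).map_source hx)]
      rw [(extChartAt (𝓡∂ m) x₀).left_inv hx]
    · rw [chartExtend_of_notMem hx]
      by_contra h
      exact hx (hsupp (subset_tsupport A (Ne.symm h)))

/-- Every function vanishing on the boundary is, near the boundary, a primitive of the change of `θ`
under a Hamiltonian isotopy. -/
theorem exists_isotopy_of_eq_zero_boundary {θ : OneForm m M} (hθ : IsLiouvilleForm θ) {A : M → ℝ}
    (hA : ContMDiff (𝓡∂ m) 𝓘(ℝ, ℝ) ∞ A) (hA0 : ∀ x ∈ (𝓡∂ m).boundary M, A x = 0) :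
    ∃ Φ : ℝ → M ≃ₘ^∞⟮𝓡∂ m, 𝓡∂ m⟯ M, IsHamiltonianIsotopyRelBoundary θ Φ ∧
      ∃ S : M → ℝ, ContMDiff (𝓡∂ m) 𝓘(ℝ, ℝ) ∞ S ∧
        (∀ (x : M) (w : TangentSpace (𝓡∂ m) x),
          θ (Φ 1 x) (mfderiv (𝓡∂ m) (𝓡∂ m) (Φ 1) x w) = θ x w + differential S x w) ∧
        ∀ x ∈ (𝓡∂ m).boundary M, ∀ᶠ z in 𝓝 x, S z = A z := by
  obtain ⟨f, hf⟩ := SmoothPartitionOfUnity.exists_isSubordinate_chartAt_source (𝓡∂ m) M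
  have hfin : {c : M | (Function.support (f c)).Nonempty}.Finite :=
    f.locallyFinite.finite_nonempty_of_compact
  have hfs : ∀ c, tsupport (fun x ↦ f c x * A x) ⊆ (extChartAt (𝓡∂ m) c).source := fun c ↦ by
    rw [extChartAt_source]
    exact (tsupport_mul_subset_left (f := f c) (g := A)).trans (hf c)
  have hsmooth : ∀ c, ContMDiff (𝓡∂ m) 𝓘(ℝ, ℝ) ∞ (fun x ↦ f c x * A x) := fun c ↦
    (f c).contMDiff.mul hA
  choose G C hG hC hCO hGC hG0 hGA using fun c ↦ exists_chartExtend_eq (hsmooth c)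
    (fun x hx ↦ by simp [hA0 x hx]) (hfs c)
  obtain ⟨Φ, hΦ, S, hS, hpull, hSA⟩ := exists_isotopy_of_sum_chartExtend hθ hfin.toFinset id hG hC hCO
    hGC hG0
  refine ⟨Φ, hΦ, S, hS, hpull, fun x hx ↦ (hSA x hx).mono fun z hz ↦ ?_⟩
  have h1 : ∑ c ∈ hfin.toFinset, f c z = 1 := by
    rw [← f.sum_eq_one (mem_univ z)]
    refine (finsum_eq_sum_of_support_subset _ fun c hc ↦ ?_).symm
    simp only [Finite.coe_toFinset, mem_ofPred_eq]
    exact ⟨z, hc⟩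
  rw [hz]
  simp only [id, hGA]
  rw [← Finset.sum_mul, h1, one_mul]

end Realize

/-! ### Charts of the maximal atlas, and immersions -/

section MaximalAtlas

variable {m : ℕ} [NeZero m] {M : Type*} [TopologicalSpace M]
  [ChartedSpace (EuclideanHalfSpace m) M] [IsManifold (𝓡∂ m) ∞ M]

theorem mem_boundary_iff_of_mem_maximalAtlas {e : OpenPartialHomeomorph M (EuclideanHalfSpace m)}
    (he : e ∈ IsManifold.maximalAtlas (𝓡∂ m) ∞ M) {x : M} (hx : x ∈ e.source) :
    x ∈ (𝓡∂ m).boundary M ↔ firstCoord m (e.extend (𝓡∂ m) x) = 0 := by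
  have h1 : IsLocalDiffeomorphAt (𝓡∂ m) (𝓡∂ m) ∞ e x :=
    ⟨⟨e.toPartialEquiv, e.open_source, e.open_target, contMDiffOn_of_mem_maximalAtlas he,
      contMDiffOn_symm_of_mem_maximalAtlas he⟩, hx, fun _ _ ↦ rfl⟩
  have h2 := h1.isBoundaryPoint_iff (by simp)
  refine h2.trans ((mem_boundary_iff_of_mem_source (e x) (mem_extChartAt_source (e x))).trans ?_)
  rfl

variable {m' : ℕ} [NeZero m'] {N : Type*} [TopologicalSpace N]
  [ChartedSpace (EuclideanHalfSpace m') N] [IsManifold (𝓡∂ m') ∞ N]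

theorem mem_maximalAtlas_diffeomorph_trans {e : OpenPartialHomeomorph M (EuclideanHalfSpace m)}
    (he : e ∈ IsManifold.maximalAtlas (𝓡∂ m) ∞ M) (φ : M ≃ₘ^∞⟮𝓡∂ m, 𝓡∂ m⟯ M) :
    φ.toHomeomorph.toOpenPartialHomeomorph.trans e ∈ IsManifold.maximalAtlas (𝓡∂ m) ∞ M := by
  refine OpenPartialHomeomorph.mem_maximalAtlas_of_contMDiffOn _ ?_ ?_
  · exact (contMDiffOn_of_mem_maximalAtlas he).comp φ.contMDiff.contMDiffOn fun x hx ↦ hx.2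
  · exact φ.symm.contMDiff.comp_contMDiffOn ((contMDiffOn_symm_of_mem_maximalAtlas he).mono
      fun x hx ↦ hx.1)

theorem Manifold.IsSmoothEmbedding.diffeomorph_comp {f : N → M}
    (hf : Manifold.IsSmoothEmbedding (𝓡∂ m') (𝓡∂ m) ∞ f) (φ : M ≃ₘ^∞⟮𝓡∂ m, 𝓡∂ m⟯ M) :
    Manifold.IsSmoothEmbedding (𝓡∂ m') (𝓡∂ m) ∞ (φ ∘ f) := by
  refine ⟨⟨hf.isImmersion.complement, inferInstance, inferInstance, fun p ↦ ?_⟩,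
    φ.toHomeomorph.isEmbedding.comp hf.isEmbedding⟩
  have h := hf.isImmersion.isImmersionOfComplement_complement p
  refine Manifold.IsImmersionAtOfComplement.mk_of_charts h.equiv h.domChart
    (φ.symm.toHomeomorph.toOpenPartialHomeomorph.trans h.codChart) h.mem_domChart_source ?_
    h.domChart_mem_maximalAtlas (mem_maximalAtlas_diffeomorph_trans h.codChart_mem_maximalAtlas φ.symm)
    (fun q hq ↦ ?_) fun y hy ↦ ?_
  · refine ⟨mem_univ _, ?_⟩
    change φ.symm (φ (f p)) ∈ h.codChart.source
    rw [φ.symm_apply_apply]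
    exact h.mem_codChart_source
  · refine ⟨mem_univ _, ?_⟩
    change φ.symm (φ (f q)) ∈ h.codChart.source
    rw [φ.symm_apply_apply]
    exact h.source_subset_preimage_source hq
  · rw [← h.writtenInCharts hy]
    change h.codChart.extend (𝓡∂ m) (φ.symm (φ _)) = _
    rw [φ.symm_apply_apply]
    rfl

end MaximalAtlas

/-! ### Extending functions from a neat submanifold -/

section Extension

variable {m : ℕ} [NeZero m] {M : Type*} [TopologicalSpace M]
  [ChartedSpace (EuclideanHalfSpace m) M] [IsManifold (𝓡∂ m) ∞ M]
  {m' : ℕ} [NeZero m'] {N : Type*} [TopologicalSpace N]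
  [ChartedSpace (EuclideanHalfSpace m') N] [IsManifold (𝓡∂ m') ∞ N] {f : N → M}

/-- The linear part of a local retraction onto a slice `ι u` of a half-space. The projection to the
slice along a complement is corrected in the transverse direction, so that it preserves the
half-spaces near `ι u₀`. -/
theorem exists_slice_projection {E E' : Type*} [NormedAddCommGroup E] [NormedSpace ℝ E]
    [NormedAddCommGroup E'] [NormedSpace ℝ E'] {ℓ : E →L[ℝ] ℝ} {ℓ' : E' →L[ℝ] ℝ} {e' : E'}
    (he' : ℓ' e' = 1) {ι : E' →L[ℝ] E} {pr : E →L[ℝ] E'} (hpr : ∀ u, pr (ι u) = u) {u₀ : E'}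
    (hu₀ : 0 ≤ ℓ' u₀)
    (hι : ∀ᶠ u in 𝓝[halfSpace ℓ'] u₀, 0 ≤ ℓ (ι u) ∧ (ℓ (ι u) = 0 ↔ ℓ' u = 0)) :
    ∃ π : E →L[ℝ] E', (∀ u, π (ι u) = u) ∧ ∀ᶠ y in 𝓝[halfSpace ℓ] ι u₀,
      0 ≤ ℓ' (π y) ∧ (ℓ y = 0 → ℓ' (π y) = 0) := by
  have hι₀ := hι.self_of_nhdsWithin hu₀
  rcases hu₀.eq_or_lt with h0 | h0
  · have h0' : ℓ (ι u₀) = 0 := hι₀.2.2 h0.symm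
    obtain ⟨a, ha, hav⟩ := exists_nonneg_apply_eq_mul he' (ι.hasFDerivAt.hasFDerivWithinAt) h0.symm h0'
      (hι.mono fun u hu ↦ hu.1)
    have ha0 : a ≠ 0 := by
      rintro rfl
      have h1 : Tendsto (fun t : ℝ ↦ u₀ + t • e') (𝓝[>] 0) (𝓝[halfSpace ℓ'] u₀) := by
        refine tendsto_nhdsWithin_iff.2 ⟨?_, ?_⟩
        · have : Continuous fun t : ℝ ↦ u₀ + t • e' := by fun_prop
          exact (this.tendsto' 0 u₀ (by simp)).mono_left nhdsWithin_le_nhds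
        · filter_upwards [self_mem_nhdsWithin] with t ht
          simpa [halfSpace, he', ← h0] using (mem_Ioi.1 ht).le
      obtain ⟨t, ht, ht'⟩ := ((h1.eventually hι).and self_mem_nhdsWithin).exists
      have h2 : ℓ' (u₀ + t • e') = 0 := ht.2.1 (by rw [hav, zero_mul])
      simp only [map_add, ← h0, map_smul, he', smul_eq_mul, mul_one, zero_add] at h2
      exact (mem_Ioi.1 ht').ne' h2
    refine ⟨pr + (a⁻¹ • ℓ - ℓ'.comp pr).smulRight e', fun u ↦ ?_, ?_⟩
    · simp [hpr, hav, ha0]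
    · have h1 : ∀ y, ℓ' ((pr + (a⁻¹ • ℓ - ℓ'.comp pr).smulRight e') y) = a⁻¹ * ℓ y := fun y ↦ by
        simp [he']
      filter_upwards [self_mem_nhdsWithin] with y hy
      rw [h1]
      exact ⟨mul_nonneg (inv_nonneg.2 ha) hy, fun h ↦ by rw [h, mul_zero]⟩
  · refine ⟨pr, hpr, ?_⟩
    have h1 : ∀ᶠ y in 𝓝 (ι u₀), 0 < ℓ' (pr y) :=
      ((ℓ'.comp pr).continuous.tendsto (ι u₀)).eventually (lt_mem_nhds (by simpa [hpr] using h0))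
    have h2 : ∀ᶠ y in 𝓝 (ι u₀), ℓ y ≠ 0 :=
      (ℓ.continuous.tendsto (ι u₀)).eventually (isOpen_ne.mem_nhds fun h ↦ h0.ne' (hι₀.2.1 h))
    filter_upwards [mem_nhdsWithin_of_mem_nhds h1, mem_nhdsWithin_of_mem_nhds h2] with y hy hy'
    exact ⟨hy.le, fun h ↦ absurd h hy'⟩

theorem extend_mem_halfSpace (e : OpenPartialHomeomorph M (EuclideanHalfSpace m)) (x : M) :
    e.extend (𝓡∂ m) x ∈ halfSpace (firstCoord m) := by
  rw [← range_model]
  exact mem_range_self _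

theorem Manifold.IsSmoothEmbedding.exists_local_retraction
    (hf : Manifold.IsSmoothEmbedding (𝓡∂ m') (𝓡∂ m) ∞ f)
    (hb : (𝓡∂ m').boundary N = f ⁻¹' (𝓡∂ m).boundary M) (p : N) :
    ∃ U ∈ 𝓝 (f p), ∃ σ : M → N, ContMDiffOn (𝓡∂ m) (𝓡∂ m') ∞ σ U ∧ (∀ q, f q ∈ U → σ (f q) = q) ∧
      ∀ x ∈ U, x ∈ (𝓡∂ m).boundary M → σ x ∈ (𝓡∂ m').boundary N := by
  have h := hf.isImmersion.isImmersionOfComplement_complement p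
  set d := h.domChart with hd
  set c := h.codChart with hc
  have hda := h.domChart_mem_maximalAtlas
  have hca := h.codChart_mem_maximalAtlas
  let ι : EuclideanSpace ℝ (Fin m') →L[ℝ] EuclideanSpace ℝ (Fin m) :=
    h.equiv.toContinuousLinearMap.comp (ContinuousLinearMap.inl ℝ _ _)
  let pr : EuclideanSpace ℝ (Fin m) →L[ℝ] EuclideanSpace ℝ (Fin m') :=
    (ContinuousLinearMap.fst ℝ _ _).comp h.equiv.symm.toContinuousLinearMap
  have hpr : ∀ u, pr (ι u) = u := fun u ↦ by simp [pr, ι]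
  have hwr : ∀ q ∈ d.source, c.extend (𝓡∂ m) (f q) = ι (d.extend (𝓡∂ m') q) := fun q hq ↦ by
    have hq' : q ∈ (d.extend (𝓡∂ m')).source := by rwa [d.extend_source]
    have h1 := h.writtenInCharts ((d.extend (𝓡∂ m')).map_source hq')
    simp only [Function.comp_apply] at h1
    rwa [← hd, (d.extend (𝓡∂ m')).left_inv hq'] at h1
  have hps : p ∈ d.source := h.mem_domChart_source
  have hfps : f p ∈ c.source := h.mem_codChart_source
  have hdt : (d.extend (𝓡∂ m')).target ∈ 𝓝[halfSpace (firstCoord m')] (d.extend (𝓡∂ m') p) := by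
    rw [← range_model]
    exact d.extend_target_mem_nhdsWithin hps
  obtain ⟨π, hπι, hπ⟩ := exists_slice_projection (ℓ := firstCoord m) firstCoord_single hpr
    (extend_mem_halfSpace d p) (by
      filter_upwards [hdt] with u hu
      have hq : (d.extend (𝓡∂ m')).symm u ∈ d.source := by
        rw [← d.extend_source (I := 𝓡∂ m')]
        exact (d.extend (𝓡∂ m')).map_target hu
      have h1 := hwr _ hq
      rw [(d.extend (𝓡∂ m')).right_inv hu] at h1
      rw [← h1]
      refine ⟨extend_mem_halfSpace c _, ?_⟩
      rw [← mem_boundary_iff_of_mem_maximalAtlas hca (h.source_subset_preimage_source hq),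
        ← mem_preimage, ← hb, mem_boundary_iff_of_mem_maximalAtlas hda hq,
        (d.extend (𝓡∂ m')).right_inv hu])
  obtain ⟨V, hV, hVd⟩ : ∃ V ∈ 𝓝 (f p), f ⁻¹' V ⊆ d.source := by
    have h1 := d.open_source.mem_nhds hps
    rw [hf.isEmbedding.nhds_eq_comap, mem_comap] at h1
    exact h1
  rw [← hwr p hps] at hπ
  have hct : Tendsto (c.extend (𝓡∂ m)) (𝓝 (f p)) (𝓝[halfSpace (firstCoord m)] (c.extend (𝓡∂ m) (f p))) :=
    tendsto_nhdsWithin_iff.2 ⟨c.continuousAt_extend hfps, .of_forall fun x ↦ extend_mem_halfSpace c x⟩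
  have hπt : Tendsto (fun x ↦ π (c.extend (𝓡∂ m) x)) (𝓝 (f p))
      (𝓝[halfSpace (firstCoord m')] (d.extend (𝓡∂ m') p)) := by
    refine tendsto_nhdsWithin_iff.2 ⟨?_, (hct.eventually hπ).mono fun x hx ↦ hx.1⟩
    have := (π.continuous.tendsto (c.extend (𝓡∂ m) (f p))).comp (c.continuousAt_extend hfps)
    rwa [hwr p hps, hπι] at this
  refine ⟨{x | x ∈ c.source ∧ x ∈ V ∧ π (c.extend (𝓡∂ m) x) ∈ (d.extend (𝓡∂ m')).target ∧
    (firstCoord m (c.extend (𝓡∂ m) x) = 0 → firstCoord m' (π (c.extend (𝓡∂ m) x)) = 0)}, ?_,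
    fun x ↦ (d.extend (𝓡∂ m')).symm (π (c.extend (𝓡∂ m) x)), ?_, fun q hq ↦ ?_, fun x hx hxb ↦ ?_⟩
  · filter_upwards [c.open_source.mem_nhds hfps, hV, hπt.eventually hdt, hct.eventually hπ]
      with x h1 h2 h3 h4 using ⟨h1, h2, h3, h4.2⟩
  · have h1 : ContMDiffOn 𝓘(ℝ, EuclideanSpace ℝ (Fin m')) (𝓡∂ m') ∞ (d.extend (𝓡∂ m')).symm
        (d.extend (𝓡∂ m')).target := by
      rw [d.extend_target, ← (𝓡∂ m').image_eq]
      exact contMDiffOn_extend_symm hda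
    exact h1.comp ((π.contDiff.contMDiff.comp_contMDiffOn (c.contMDiffOn_extend hca)).mono
      fun x hx ↦ hx.1) fun x hx ↦ hx.2.2.1
  · have hqd : q ∈ d.source := hVd hq.2.1
    change (d.extend (𝓡∂ m')).symm (π (c.extend (𝓡∂ m) (f q))) = q
    rw [hwr q hqd, hπι, d.extend_left_inv hqd]
  · have hσ : (d.extend (𝓡∂ m')).symm (π (c.extend (𝓡∂ m) x)) ∈ d.source := by
      rw [← d.extend_source (I := 𝓡∂ m')]
      exact (d.extend (𝓡∂ m')).map_target hx.2.2.1
    rw [mem_boundary_iff_of_mem_maximalAtlas hda hσ, (d.extend (𝓡∂ m')).right_inv hx.2.2.1]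
    exact hx.2.2.2 ((mem_boundary_iff_of_mem_maximalAtlas hca hx.1).1 hxb)

/-- A smooth function vanishing on the boundary of a neat compact submanifold extends to a smooth
function vanishing on the boundary of the ambient manifold. -/
theorem Manifold.IsSmoothEmbedding.exists_extension [T2Space M] [CompactSpace M] [CompactSpace N]
    (hf : Manifold.IsSmoothEmbedding (𝓡∂ m') (𝓡∂ m) ∞ f)
    (hb : (𝓡∂ m').boundary N = f ⁻¹' (𝓡∂ m).boundary M) {B : N → ℝ}
    (hB : ContMDiff (𝓡∂ m') 𝓘(ℝ, ℝ) ∞ B) (hB0 : ∀ q ∈ (𝓡∂ m').boundary N, B q = 0) :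
    ∃ A : M → ℝ, ContMDiff (𝓡∂ m) 𝓘(ℝ, ℝ) ∞ A ∧ (∀ x ∈ (𝓡∂ m).boundary M, A x = 0) ∧
      ∀ q, A (f q) = B q := by
  let t : M → Set ℝ := fun x ↦ {a | (x ∈ (𝓡∂ m).boundary M → a = 0) ∧ ∀ q, f q = x → a = B q}
  have ht : ∀ x, Convex ℝ (t x) := fun x a ha b hb' r s _ _ hrs ↦ by
    refine ⟨fun hx ↦ by simp [ha.1 hx, hb'.1 hx], fun q hq ↦ ?_⟩
    rw [ha.2 q hq, hb'.2 q hq, ← add_smul, hrs, one_smul]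
  obtain ⟨A, hA⟩ := exists_contMDiffMap_forall_mem_convex_of_local (𝓡∂ m) (n := ⊤) ht fun x ↦ by
    by_cases hx : x ∈ range f
    · obtain ⟨p, rfl⟩ := hx
      obtain ⟨U, hU, σ, hσ, hσf, hσb⟩ := hf.exists_local_retraction hb p
      refine ⟨U, hU, B ∘ σ, hB.comp_contMDiffOn hσ, fun y hy ↦ ⟨fun hyb ↦ hB0 _ (hσb y hy hyb), ?_⟩⟩
      rintro q rfl
      exact congrArg B (hσf q hy)
    · refine ⟨(range f)ᶜ, (isCompact_range hf.contMDiff.continuous).isClosed.isOpen_compl.mem_nhds hx,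
        fun _ ↦ 0, contMDiffOn_const, fun y hy ↦ ⟨fun _ ↦ rfl, ?_⟩⟩
      rintro q rfl
      exact absurd (mem_range_self q) hy
  exact ⟨A, A.contMDiff, fun x hx ↦ (hA x).1 hx, fun q ↦ (hA (f q)).2 q rfl⟩

end Extension

/-! ### Primitives on a submanifold with Legendrian boundary -/

section Primitive

variable {m : ℕ} [NeZero m] {N : Type*} [TopologicalSpace N]
  [ChartedSpace (EuclideanHalfSpace m) N] [IsManifold (𝓡∂ m) ∞ N] {F : N → ℝ}

/-- A function whose differential vanishes on the vectors tangent to the boundary is locally constant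
on the boundary. -/
theorem eventually_eq_of_differential_eq_zero (hF : ContMDiff (𝓡∂ m) 𝓘(ℝ, ℝ) ∞ F)
    (h0 : ∀ p ∈ (𝓡∂ m).boundary N, ∀ v, firstCoord m v = 0 → differential F p v = 0) {p : N}
    (hp : p ∈ (𝓡∂ m).boundary N) : ∀ᶠ q in 𝓝 p, q ∈ (𝓡∂ m).boundary N → F q = F p := by
  have hps := mem_extChartAt_source (I := 𝓡∂ m) p
  have hT : (extChartAt (𝓡∂ m) p).target ∈ 𝓝[halfSpace (firstCoord m)] (extChartAt (𝓡∂ m) p p) := by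
    rw [← range_model]
    exact extChartAt_target_mem_nhdsWithin p
  obtain ⟨ε, hε, hεT⟩ := Metric.mem_nhdsWithin_iff.1 hT
  rw [mem_boundary_iff_of_mem_source p hps] at hp
  filter_upwards [(isOpen_extChartAt_source p).mem_nhds hps,
    (continuousAt_extChartAt (I := 𝓡∂ m) p).preimage_mem_nhds (ball_mem_nhds _ hε)] with q hqs hq hqb
  rw [mem_boundary_iff_of_mem_source p hqs] at hqb
  set a := extChartAt (𝓡∂ m) p p with ha
  set b := extChartAt (𝓡∂ m) p q with hb
  have hv : firstCoord m (b - a) = 0 := by rw [map_sub, hqb, hp, sub_zero]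
  have hs0 : ∀ s : ℝ, firstCoord m (a + s • (b - a)) = 0 := fun s ↦ by
    rw [map_add, map_smul, hv, hp, smul_zero, zero_add]
  have hsT : ∀ s ∈ Icc (0 : ℝ) 1, a + s • (b - a) ∈ (extChartAt (𝓡∂ m) p).target := fun s hs ↦ by
    refine hεT ⟨?_, (hs0 s).ge⟩
    exact (convex_ball a ε).add_smul_sub_mem (mem_ball_self hε) hq hs
  have key : ∀ s ∈ Icc (0 : ℝ) 1, HasDerivWithinAt
      (fun s : ℝ ↦ (F ∘ (extChartAt (𝓡∂ m) p).symm) (a + s • (b - a))) 0 (Icc 0 1) s := fun s hs ↦ by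
    have hy := hsT s hs
    have hx := (extChartAt (𝓡∂ m) p).map_target hy
    have hright := (extChartAt (𝓡∂ m) p).right_inv hy
    have hxb : (extChartAt (𝓡∂ m) p).symm (a + s • (b - a)) ∈ (𝓡∂ m).boundary N := by
      rw [mem_boundary_iff_of_mem_source p hx, hright, hs0]
    obtain ⟨r, hr, hrv⟩ := exists_pos_firstCoord_chartDeriv hy (hs0 s)
    have hw : firstCoord m (chartDerivSymm p (a + s • (b - a)) (b - a)) = 0 := by
      have h1 := hrv (chartDerivSymm p (a + s • (b - a)) (b - a))
      rw [chartDeriv_chartDerivSymm hy, hv] at h1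
      exact (mul_eq_zero.1 h1.symm).resolve_left hr.ne'
    have hd : fderivWithin ℝ (F ∘ (extChartAt (𝓡∂ m) p).symm) (halfSpace (firstCoord m))
        (a + s • (b - a)) (b - a) = 0 := by
      have h1 := fderivWithin_comp_extChartAt_symm hx (hF.mdifferentiableAt (by simp))
        (chartDerivSymm p (a + s • (b - a)) (b - a))
      rw [hright, range_model] at h1
      have h2 := chartDeriv_chartDerivSymm hy (b - a)
      exact ((congrArg _ h2).symm.trans h1).trans (h0 _ hxb _ hw)
    have hD : DifferentiableWithinAt ℝ (F ∘ (extChartAt (𝓡∂ m) p).symm)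
        (halfSpace (firstCoord m)) (a + s • (b - a)) := by
      refine ((contDiffOn_comp_extChartAt_symm hF).differentiableOn (by simp) _
        hy).mono_of_mem_nhdsWithin ?_
      rw [← range_model]
      exact extChartAt_target_mem_nhdsWithin_of_mem hy
    have hline : HasDerivWithinAt (fun s : ℝ ↦ a + s • (b - a)) (b - a) (Icc 0 1) s := by
      simpa using ((hasDerivAt_id s).smul_const (b - a)).const_add a |>.hasDerivWithinAt
    have h3 := hD.hasFDerivWithinAt.comp_hasDerivWithinAt s hline fun s' _ ↦ (hs0 s').ge
    rwa [hd] at h3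
  have h4 := eq_of_hasDerivWithinAt_zero key (t := 1) ⟨zero_le_one, le_rfl⟩
  simp only [Function.comp_apply, one_smul, zero_smul, add_zero, add_sub_cancel] at h4
  rwa [hb, ha, (extChartAt (𝓡∂ m) p).left_inv hqs, (extChartAt (𝓡∂ m) p).left_inv hps] at h4

theorem IsCompact.finite_image_of_eventually_eq {X Y : Type*} [TopologicalSpace X] {K : Set X}
    (hK : IsCompact K) {F : X → Y} (h : ∀ p ∈ K, ∀ᶠ q in 𝓝 p, q ∈ K → F q = F p) :
    (F '' K).Finite := by
  refine hK.induction_on (p := fun s ↦ (F '' s).Finite) (by simp)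
    (fun s t hst ht ↦ ht.subset (image_mono hst))
    (fun s t hs ht ↦ by rw [image_union]; exact hs.union ht)
    fun p hp ↦ ⟨{q | q ∈ K ∧ F q = F p}, ?_, ?_⟩
  · filter_upwards [mem_nhdsWithin_of_mem_nhds (h p hp), self_mem_nhdsWithin] with q hq hqK
      using ⟨hqK, hq hqK⟩
  · refine (finite_singleton (F p)).subset ?_
    rintro _ ⟨q, hq, rfl⟩
    exact hq.2

theorem Set.Finite.exists_contDiff_eventually_const {T : Set ℝ} (hT : T.Finite) :
    ∃ h : ℝ → ℝ, ContDiff ℝ ∞ h ∧ ∀ c ∈ T, ∀ᶠ y in 𝓝 c, h y = c := by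
  induction T, hT using Set.Finite.induction_on with
  | empty => exact ⟨fun _ ↦ 0, contDiff_const, by simp⟩
  | @insert c T hc hT ih =>
    obtain ⟨h, hh, hhT⟩ := ih
    obtain ⟨κ, Q, hκ, hQ, hQT, hκ1, hκ0, -⟩ := (isCompact_singleton (x := c)).exists_contDiff_cutoff
      hT.isClosed.isOpen_compl (by simpa using hc)
    refine ⟨fun y ↦ h y + κ y * (c - h y), hh.add (hκ.mul (contDiff_const.sub hh)), ?_⟩
    rintro d (rfl | hd)
    · rw [nhdsSet_singleton] at hκ1
      filter_upwards [hκ1] with y hy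
      rw [hy]
      ring
    · have h1 : ∀ᶠ y in 𝓝 d, y ∉ Q := hQ.isClosed.isOpen_compl.mem_nhds fun h ↦ hQT h hd
      filter_upwards [h1, hhT d hd] with y hy hy'
      rw [hκ0 y hy, hy']
      ring

end Primitive

/-! ### Lagrangian submanifolds -/

section Lagrangian

variable {n : ℕ} [NeZero n] {M : Type*} [TopologicalSpace M]
  [ChartedSpace (EuclideanHalfSpace (2 * n)) M] [IsManifold (𝓡∂ (2 * n)) ∞ M]
  {L : Type*} [TopologicalSpace L] [ChartedSpace (EuclideanHalfSpace n) L] [IsManifold (𝓡∂ n) ∞ L]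
  {θ : OneForm (2 * n) M} {i : L → M}

theorem pullback_comp_eq {Φ : M ≃ₘ^∞⟮𝓡∂ (2 * n), 𝓡∂ (2 * n)⟯ M} {S : M → ℝ} {F : L → ℝ}
    (hi : ContMDiff (𝓡∂ n) (𝓡∂ (2 * n)) ∞ i) (hS : ContMDiff (𝓡∂ (2 * n)) 𝓘(ℝ, ℝ) ∞ S)
    (hF : ContMDiff (𝓡∂ n) 𝓘(ℝ, ℝ) ∞ F)
    (hΦ : ∀ (x : M) (w : TangentSpace (𝓡∂ (2 * n)) x),
      θ (Φ x) (mfderiv (𝓡∂ (2 * n)) (𝓡∂ (2 * n)) Φ x w) = θ x w + differential S x w)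
    (hFi : ∀ (p : L) (v : TangentSpace (𝓡∂ n) p), θ.pullback i p v = mfderiv (𝓡∂ n) 𝓘(ℝ, ℝ) F p v)
    (p : L) (v : TangentSpace (𝓡∂ n) p) :
    θ.pullback (Φ ∘ i) p v = mfderiv (𝓡∂ n) 𝓘(ℝ, ℝ) (fun q ↦ F q + S (i q)) p v := by
  have hD := mfderiv_comp (I := 𝓡∂ n) (I' := 𝓡∂ (2 * n)) (I'' := 𝓡∂ (2 * n)) p
    (Φ.contMDiff.mdifferentiableAt (by simp)) (hi.mdifferentiableAt (by simp) (x := p))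
  have h1 : θ.pullback (Φ ∘ i) p v = _ :=
    congrArg (fun u : EuclideanSpace ℝ (Fin (2 * n)) ↦ (θ (Φ (i p)) u : ℝ))
      (congrArg (fun T : EuclideanSpace ℝ (Fin n) →L[ℝ] EuclideanSpace ℝ (Fin (2 * n)) ↦ T v) hD)
  have h2 : differential (m := n) (S ∘ i) p = (differential S (i p)).comp
      (mfderiv (𝓡∂ n) (𝓡∂ (2 * n)) i p) :=
    mfderiv_comp (I := 𝓡∂ n) (I' := 𝓡∂ (2 * n)) (I'' := 𝓘(ℝ, ℝ)) p
      (hS.mdifferentiableAt (by simp)) (hi.mdifferentiableAt (by simp))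
  have h3 := differential_add (m := n) (x := p) (hF.mdifferentiableAt (by simp))
    ((hS.comp hi).mdifferentiableAt (by simp))
  refine h1.trans ((hΦ (i p) (mfderiv (𝓡∂ n) (𝓡∂ (2 * n)) i p v)).trans ?_)
  refine (congrArg₂ (fun a b : ℝ ↦ a + b) (hFi p v) ?_).trans
    (congrArg (fun T : EuclideanSpace ℝ (Fin n) →L[ℝ] ℝ ↦ T v) h3).symm
  exact (congrArg (fun T : EuclideanSpace ℝ (Fin n) →L[ℝ] ℝ ↦ T v) h2).symm

/-- A diffeomorphism fixing the boundary multiplies the transverse coordinate there by a positive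
factor. -/
theorem exists_pos_firstCoord_mfderiv_diffeomorph {m : ℕ} [NeZero m] {M : Type*} [TopologicalSpace M]
    [ChartedSpace (EuclideanHalfSpace m) M] [IsManifold (𝓡∂ m) ∞ M] (Φ : M ≃ₘ^∞⟮𝓡∂ m, 𝓡∂ m⟯ M)
    {x : M} (hx : x ∈ (𝓡∂ m).boundary M) (hΦx : Φ x ∈ (𝓡∂ m).boundary M) :
    ∃ a, 0 < a ∧ ∀ v : EuclideanSpace ℝ (Fin m),
      firstCoord m (mfderiv (𝓡∂ m) (𝓡∂ m) Φ x v) = a * firstCoord m v := by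
  obtain ⟨a, ha, hav⟩ := exists_nonneg_firstCoord_mfderiv (Φ.contMDiff.mdifferentiableAt (by simp))
    hx hΦx
  refine ⟨a, lt_of_le_of_ne ha ?_, hav⟩
  rintro rfl
  have h1 := (Φ.mfderivToContinuousLinearEquiv (by simp) x).surjective
    (EuclideanSpace.single 0 1 : EuclideanSpace ℝ (Fin m))
  obtain ⟨v, hv⟩ := h1
  have h2 := hav v
  rw [zero_mul] at h2
  exact one_ne_zero ((firstCoord_single (m := m)).symm.trans ((congrArg (firstCoord m) hv).symm.trans h2))

theorem IsLagrangianSubmanifold.diffeomorph_comp {Φ : M ≃ₘ^∞⟮𝓡∂ (2 * n), 𝓡∂ (2 * n)⟯ M}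
    (hL : IsLagrangianSubmanifold θ i) (hΦ : ∀ x ∈ (𝓡∂ (2 * n)).boundary M, Φ x = x)
    (hexact : IsExactOn θ (Φ ∘ i)) : IsLagrangianSubmanifold θ (Φ ∘ i) := by
  have hemb := hL.isSmoothEmbedding.diffeomorph_comp Φ
  obtain ⟨F, hF, hFi⟩ := hexact
  refine ⟨hemb, d_mfderiv_eq_zero_of_exact θ hemb.contMDiff hF hFi, ?_, fun p hp w ↦ ?_⟩
  · rw [hL.boundary_eq]
    ext p
    simp only [mem_preimage, Function.comp_apply]
    refine ⟨fun h ↦ (hΦ _ h).symm ▸ h, fun h ↦ ?_⟩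
    have h1 : Φ (i p) = i p := Φ.injective (hΦ _ h)
    rwa [h1] at h
  · have hip : i p ∈ (𝓡∂ (2 * n)).boundary M := by
      rw [hL.boundary_eq] at hp
      exact hp
    obtain ⟨a, ha, hav⟩ := exists_pos_firstCoord_mfderiv_diffeomorph Φ hip ((hΦ _ hip).symm ▸ hip)
    obtain ⟨v, hv⟩ := hL.transverse p hp ((a⁻¹ • w : EuclideanSpace ℝ (Fin (2 * n))))
    have hD := mfderiv_comp (I := 𝓡∂ n) (I' := 𝓡∂ (2 * n)) (I'' := 𝓡∂ (2 * n)) p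
      (Φ.contMDiff.mdifferentiableAt (by simp))
      (hL.isSmoothEmbedding.contMDiff.mdifferentiableAt (by simp) (x := p))
    refine ⟨v, ?_⟩
    let D : EuclideanSpace ℝ (Fin (2 * n)) →L[ℝ] EuclideanSpace ℝ (Fin (2 * n)) :=
      mfderiv (𝓡∂ (2 * n)) (𝓡∂ (2 * n)) Φ (i p)
    let u : EuclideanSpace ℝ (Fin (2 * n)) := mfderiv (𝓡∂ n) (𝓡∂ (2 * n)) i p v
    have h1 : (mfderiv (𝓡∂ n) (𝓡∂ (2 * n)) (Φ ∘ i) p v : EuclideanSpace ℝ (Fin (2 * n))) = D u :=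
      congrArg (fun T : EuclideanSpace ℝ (Fin n) →L[ℝ] EuclideanSpace ℝ (Fin (2 * n)) ↦ T v) hD
    have hDu : firstCoord (2 * n) (D u) = a * firstCoord (2 * n) u := hav u
    have h2 : ∀ w' : EuclideanSpace ℝ (Fin (2 * n)), firstCoord (2 * n) (a⁻¹ • w' - u) = 0 →
        firstCoord (2 * n) (w' - D u) = 0 := fun w' h ↦ by
      rw [map_sub, hDu]
      rw [map_sub, map_smul, smul_eq_mul, sub_eq_zero] at h
      rw [← h, mul_inv_cancel_left₀ ha.ne', sub_self]
    have h3 : ∀ w' z : EuclideanSpace ℝ (Fin (2 * n)), z = D u →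
        firstCoord (2 * n) (w' - D u) = 0 → firstCoord (2 * n) (w' - z) = 0 := by
      rintro w' _ rfl h
      exact h
    exact h3 w _ h1 (h2 w hv)

end Lagrangian

theorem mainTheorem12 {n : ℕ} [NeZero n]
    {M : Type*} [TopologicalSpace M] [T2Space M] [CompactSpace M]
    [ChartedSpace (EuclideanHalfSpace (2 * n)) M] [IsManifold (𝓡∂ (2 * n)) ∞ M]
    (θ : OneForm (2 * n) M) (hθ : IsLiouvilleForm θ)
    {L : Type*} [TopologicalSpace L] [CompactSpace L]
    [ChartedSpace (EuclideanHalfSpace n) L] [IsManifold (𝓡∂ n) ∞ L]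
    (i₀ : L → M) (hL₀ : IsLagrangianSubmanifold θ i₀)
    (hexact : IsExactOn θ i₀) (hboundary : VanishesOnBoundary θ i₀) :
    ∃ φ : ℝ → M ≃ₘ^∞⟮𝓡∂ (2 * n), 𝓡∂ (2 * n)⟯ M,
      IsHamiltonianIsotopyRelBoundary θ φ ∧
      IsLagrangianSubmanifold θ (φ 1 ∘ i₀) ∧
      IsExactOn θ (φ 1 ∘ i₀) ∧
      VanishesNearBoundary θ (φ 1 ∘ i₀) := by
  obtain ⟨F, hF, hFi⟩ := hexact
  have hemb := hL₀.isSmoothEmbedding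
  have hi := hemb.contMDiff
  have hFloc : ∀ p ∈ (𝓡∂ n).boundary L, ∀ᶠ q in 𝓝 p, q ∈ (𝓡∂ n).boundary L → F q = F p :=
    fun p hp ↦ eventually_eq_of_differential_eq_zero hF
      (fun q hq v hv ↦ (hFi q v).symm.trans (hboundary q hq v hv)) hp
  obtain ⟨h, hh, hhF⟩ := (((𝓡∂ n).isClosed_boundary (M := L) (n := ∞)
    (by simp)).isCompact.finite_image_of_eventually_eq hFloc).exists_contDiff_eventually_const
  have hhF' : ∀ p ∈ (𝓡∂ n).boundary L, ∀ᶠ y in 𝓝 (F p), h y = F p := fun p hp ↦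
    hhF _ (mem_image_of_mem F hp)
  -- near the boundary, `h ∘ F` is locally constant and hence `h ∘ F - F` is a primitive of `-θ`
  obtain ⟨A, hA, hA0, hAi⟩ := hemb.exists_extension hL₀.boundary_eq
    (B := fun q ↦ h (F q) - F q) ((hh.contMDiff.comp hF).sub hF) fun q hq ↦ by
      rw [(hhF' q hq).self_of_nhds, sub_self]
  obtain ⟨Φ, hΦ, S, hS, hpull, hSA⟩ := exists_isotopy_of_eq_zero_boundary hθ hA hA0
  have hprim := pullback_comp_eq hi hS hF hpull hFi
  have hprims : ContMDiff (𝓡∂ n) 𝓘(ℝ, ℝ) ∞ (fun q ↦ F q + S (i₀ q)) := hF.add (hS.comp hi)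
  have hex : IsExactOn θ (Φ 1 ∘ i₀) := ⟨_, hprims, hprim⟩
  refine ⟨Φ, hΦ, hL₀.diffeomorph_comp (hΦ.fixes_boundary 1) hex, hex,
    {p | ∀ᶠ q in 𝓝 p, F q + S (i₀ q) = F p + S (i₀ p)}, ?_, fun p hp ↦ ?_, fun p hp v ↦ ?_⟩
  · rw [isOpen_iff_eventually]
    intro p hp
    filter_upwards [eventually_eventually_nhds.2 hp] with q hq
    exact hq.mono fun r hr ↦ hr.trans hq.self_of_nhds.symm
  · have hip : i₀ p ∈ (𝓡∂ (2 * n)).boundary M := by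
      rw [hL₀.boundary_eq] at hp
      exact hp
    have h1 : ∀ᶠ q in 𝓝 p, F q + S (i₀ q) = F p := by
      filter_upwards [hi.continuous.continuousAt.eventually (hSA _ hip),
        hF.continuous.continuousAt.eventually (hhF' p hp)] with q hq hq'
      rw [hq, hAi, hq']
      ring
    exact h1.mono fun q hq ↦ hq.trans h1.self_of_nhds.symm
  · refine (hprim p v).trans ?_
    have h1 : mfderiv (𝓡∂ n) 𝓘(ℝ, ℝ) (fun q ↦ F q + S (i₀ q)) p = _ :=
      Filter.EventuallyEq.mfderiv_eq (f := fun _ ↦ F p + S (i₀ p)) hp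
    exact (congrArg (fun T : EuclideanSpace ℝ (Fin n) →L[ℝ] ℝ ↦ T v) (h1.trans mfderiv_const))
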